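/- Let $F$ be an algebraically closed field (for instance $\overline{\mathbb F_q}$), let $E$ be an elliptic curve over $F$ given by a non-singular Weierstrass equation in $X,Y$, with point at infinity $\mathcal O$, and let $n$ be a positive integer that is not divisible by the characteristic of $F$. For a divisor $D=\sum_S n_S[S]$ and a rational function $f$ whose zeros and poles avoid the support of $D$ put $f(D)=\prod_S f(S)^{n_S}$; write $\sim$ for linear equivalence of divisors. The leading coefficient at $\mathcal O$ of a rational function $f\ne 0$ is the value at $\mathcal O$ of $(X/Y)^{-\operatorname{ord}_{\mathcal O}(f)}f$, and $f$ is monic if this is $1$. For $Q\in E$ let $\tau_Q\colon R\mapsto R+Q$. Then for all $P,Q\in E[n]$ the following three definitions of the Weil pairing are meaningful (all functions and divisors mentioned exist), do not depend on the choices made, and give the same element $e_n(P,Q)\in F^*$: 1. $e_n(P,Q)=\dfrac{g_P\circ\tau_Q}{g_P}$, which is a constant function, where $g_P$ is any function with $\operatorname{div} g_P=\sum_{R\in E[n]}\big([P_0+R]-[R]\big)$ for some point $P_0$ with $nP_0=P$; 2. if $P\neq\mathcal O$, $Q\ne\mathcal O$ and $P\ne Q$, $$e_n(P,Q)=(-1)^n\,\frac{f_P(Q)}{f_Q(P)}\cdot\frac{f_Q}{f_P}(\mathcal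 O),$$ where $f_P,f_Q$ are any functions with $\operatorname{div} f_P=n[P]-n[\mathcal O]$ and $\operatorname{div} f_Q=n[Q]-n[\mathcal O]$, so that $e_n(P,Q)=(-1)^n f_P(Q)/f_Q(P)$ if $f_P$ and $f_Q$ are monic; and $e_n(P,Q)=1$ if $P=\mathcal O$, $Q=\mathcal O$ or $P=Q$; 3. $$e_n(P,Q)=\frac{f_{D_P}(D_Q)}{f_{D_Q}(D_P)},$$ where $D_P\sim[P]-[\mathcal O]$ and $D_Q\sim[Q]-[\mathcal O]$ are any divisors with disjoint supports, and $f_{D}$ denotes the monic function with $\operatorname{div} f_D=nD$. -/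

import Mathlib

open Polynomial Polynomial.Bivariate WeierstrassCurve

namespace WeilPairing

variable {F : Type*} [Field F]

/-! ### Rational functions: values, orders, divisors -/

section Functions

variable {W : Affine F}

variable (W) in
/-- The coordinate function `X` in the function field `F(W)`. -/
noncomputable def xFun : W.FunctionField :=
  algebraMap W.CoordinateRing W.FunctionField (Affine.CoordinateRing.mk W (C X))

variable (W) in
/-- The coordinate function `Y` in the function field `F(W)`. -/
noncomputable def yFun : W.FunctionField :=
  algebraMap W.CoordinateRing W.FunctionField (Affine.CoordinateRing.mk W Y)

variable (W) in
/-- Constants, as rational functions. -/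
noncomputable def const : F →+* W.FunctionField :=
  (algebraMap W.CoordinateRing W.FunctionField).comp (algebraMap F W.CoordinateRing)

/-- The affine coordinates centred at a point `P` in a standard affine chart of the projective
curve: `(X - x, Y - y)` at an affine point `(x, y)`, and `(X / Y, 1 / Y)`, the coordinates of the
chart `Y ≠ 0`, at the point at infinity `[0 : 1 : 0]`. Both coordinates take the value `0`
at `P`. -/
noncomputable def chart : W.Point → W.FunctionField × W.FunctionField
  | .zero => (xFun W / yFun W, 1 / yFun W)
  | .some x y _ => (xFun W - const W x, yFun W - const W y)

/-- The rational function obtained by substituting the two chart coordinates at `P` into a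
polynomial in two variables. -/
noncomputable def inChart (P : W.Point) (A : F[X][Y]) : W.FunctionField :=
  A.eval₂ (eval₂RingHom (const W) (chart P).1) (chart P).2

/-- `f` is regular at `P` with value `f(P) = c`: in the chart around `P` it is a quotient `A / B`
of polynomials, where `B` does not vanish at `P`, and `c = A(P) / B(P)`. -/
def HasValueAt (f : W.FunctionField) (P : W.Point) (c : F) : Prop :=
  ∃ A B : F[X][Y], B.evalEval 0 0 ≠ 0 ∧ f * inChart P B = inChart P A ∧
    c = A.evalEval 0 0 / B.evalEval 0 0

/-- `f` belongs to the local ring at `P`, that is, `f` has no pole at `P`. -/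
def IsRegularAt (f : W.FunctionField) (P : W.Point) : Prop :=
  ∃ c, HasValueAt f P c

/-- The value of `f` at `P` (with the convention `0` if `f` has a pole at `P`). -/
noncomputable def value (f : W.FunctionField) (P : W.Point) : F :=
  open Classical in if h : IsRegularAt f P then h.choose else 0

/-- `f` as a map from the curve to `F ∪ {∞}`; the value is `∞` exactly at the poles. -/
noncomputable def toMap (f : W.FunctionField) (P : W.Point) : OnePoint F :=
  open Classical in if IsRegularAt f P then OnePoint.some (value f P) else OnePoint.infty

/-- `t` generates the maximal ideal of the local ring at `P`. -/
def IsUniformizerAt (t : W.FunctionField) (P : W.Point) : Prop :=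
  HasValueAt t P 0 ∧ ∀ f, HasValueAt f P 0 → ∃ g, IsRegularAt g P ∧ f = t * g

/-- `ord_P(f) = k`: `f` is `t ^ k` times a unit of the local ring at `P`, for a uniformizer `t`.
In particular `f` is not zero. -/
def HasOrderAt (f : W.FunctionField) (P : W.Point) (k : ℤ) : Prop :=
  ∃ t u : W.FunctionField, IsUniformizerAt t P ∧ (∃ c, c ≠ 0 ∧ HasValueAt u P c) ∧ f = t ^ k * u

/-- The group of divisors: the free abelian group on the points of the curve. -/
abbrev Divisor (W : Affine F) : Type _ := W.Point →₀ ℤ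

/-- The divisor `[P]`. -/
noncomputable def pt (P : W.Point) : Divisor W := Finsupp.single P 1

/-- `div f = D`. In particular `f` is not zero. -/
def HasDivisor (f : W.FunctionField) (D : Divisor W) : Prop :=
  ∀ P, HasOrderAt f P (D P)

/-- Linear equivalence of divisors: the difference is the divisor of a function. -/
def LinEquiv (D D' : Divisor W) : Prop :=
  ∃ h : W.FunctionField, HasDivisor h (D - D')

/-- The value `f(D) = ∏ f(P) ^ n_P` of `f` in the divisor `D = ∑ n_P [P]`. -/
noncomputable def valueDiv (f : W.FunctionField) (D : Divisor W) : F :=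
  D.prod fun P k => value f P ^ k

/-- `c` is the leading coefficient of `f` at the point at infinity `O`: the value at `O` of
`(X / Y) ^ (- ord_O(f)) * f`. -/
def HasLeadingCoeff (f : W.FunctionField) (c : F) : Prop :=
  ∃ k : ℤ, HasOrderAt f 0 k ∧ HasValueAt ((xFun W / yFun W) ^ (-k) * f) 0 c

/-- `f` is monic at `O`. -/
def IsMonic (f : W.FunctionField) : Prop :=
  HasLeadingCoeff f 1

end Functions

/-! ### The three definitions -/

section Definitions

variable [DecidableEq F] {W : Affine F}

/-- `h = f ∘ τ_Q` as maps from the curve to `F ∪ {∞}`, where `τ_Q : R ↦ R + Q`. -/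
def IsTranslate (Q : W.Point) (f h : W.FunctionField) : Prop :=
  ∀ R, toMap h R = toMap f (R + Q)

/-- `g` is a function `g_P`: its divisor is `∑ ([P₀ + R] - [R])`, the sum being over all
`n`-torsion points `R` and `P₀` being some point such that `n P₀ = P`. -/
def IsG (n : ℕ) (P : W.Point) (g : W.FunctionField) : Prop :=
  ∃ T : Finset W.Point, (∀ R, R ∈ T ↔ n • R = 0) ∧
    ∃ P₀ : W.Point, n • P₀ = P ∧ HasDivisor g (∑ R ∈ T, (pt (P₀ + R) - pt R))

/-- The first definition is meaningful for `P`, `Q` and gives the value `c`: a function `g_P`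
exists, and for each one the function `(g_P ∘ τ_Q) / g_P` is the constant `c`. -/
def FirstDefinition (n : ℕ) (P Q : W.Point) (c : F) : Prop :=
  (∃ g, IsG n P g) ∧
    ∀ g, IsG n P g → ∃ h, IsTranslate Q g h ∧ h / g = const W c

/-- `f` is a function whose divisor is `n [P] - n [O]`. -/
def IsMillerFun (n : ℕ) (P : W.Point) (f : W.FunctionField) : Prop :=
  HasDivisor f ((n : ℤ) • pt P - (n : ℤ) • pt 0)

/-- The second definition is meaningful for `P`, `Q` and gives the value `c`. If `P` and `Q` are
distinct and different from `O`, then (monic) functions `f_P`, `f_Q` exist, and all choices give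
`(-1)^n f_P(Q) / f_Q(P) · (f_Q / f_P)(O) = c`, with the last factor omitted when `f_P` and `f_Q`
are monic at `O`. In the other cases the value is `1`. -/
def SecondDefinition (n : ℕ) (P Q : W.Point) (c : F) : Prop :=
  ((P = 0 ∨ Q = 0 ∨ P = Q) → c = 1) ∧
  (P ≠ 0 → Q ≠ 0 → P ≠ Q →
    (∃ f, IsMillerFun n P f ∧ IsMonic f) ∧ (∃ f, IsMillerFun n Q f ∧ IsMonic f) ∧
    ∀ fP fQ, IsMillerFun n P fP → IsMillerFun n Q fQ →
      (IsRegularAt fP Q ∧ IsRegularAt fQ P ∧ IsRegularAt (fQ / fP) 0) ∧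
      (-1) ^ n * (value fP Q / value fQ P) * value (fQ / fP) 0 = c ∧
      (IsMonic fP → IsMonic fQ → (-1) ^ n * (value fP Q / value fQ P) = c))

/-- `f` is the function `f_D`: it is monic at `O` and its divisor is `n D`. -/
def IsF (n : ℕ) (D : Divisor W) (f : W.FunctionField) : Prop :=
  HasDivisor f ((n : ℤ) • D) ∧ IsMonic f

/-- `D_P` and `D_Q` are admissible in the third definition: they are linearly equivalent to
`[P] - [O]` and `[Q] - [O]`, and their supports are disjoint. -/
def IsAdmissible (P Q : W.Point) (DP DQ : Divisor W) : Prop :=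
  LinEquiv DP (pt P - pt 0) ∧ LinEquiv DQ (pt Q - pt 0) ∧ Disjoint DP.support DQ.support

/-- The third definition is meaningful for `P`, `Q` and gives the value `c`, independently of the
choice of the divisors: admissible divisors exist, and for any admissible `D_P`, `D_Q` the functions
`f_{D_P}`, `f_{D_Q}` exist and `f_{D_P}(D_Q) / f_{D_Q}(D_P) = c`. -/
def ThirdDefinition (n : ℕ) (P Q : W.Point) (c : F) : Prop :=
  (∃ DP DQ, IsAdmissible P Q DP DQ) ∧
    ∀ DP DQ, IsAdmissible P Q DP DQ →
      (∃ f, IsF n DP f) ∧ (∃ f, IsF n DQ f) ∧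
      ∀ fP fQ, IsF n DP fP → IsF n DQ fQ →
        (∀ S ∈ DQ.support, IsRegularAt fP S) ∧ (∀ S ∈ DP.support, IsRegularAt fQ S) ∧
        valueDiv fP DQ / valueDiv fQ DP = c

end Definitions

end WeilPairing

namespace WeilPairing

variable {F : Type*} [Field F] {W : Affine F}

/-! ### The valuation at infinity -/

section ValuationAtInfinity

open Affine Affine.CoordinateRing

/-! The common value is the constant `c` with g ∘ τ_Q = c·g, where g = g_P. It exists because div g
is the pullback of [P] - [O] under [n], which τ_Q preserves since nQ = O, and functions with equal
divisors are proportional (`exists_transHom_eq`). For g itself one needs a point P₀ with nP₀ = P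
(`exists_nsmul_eq`) and the fact that the prescribed divisor has sum |E[n]|·P₀ = n²P₀ = nP = O
(`card_torsion`).

Comparison with the third definition. Let nQ₀ = Q and nS₀ = S with S generic, let f and f' have
divisors n[P] - n[O] and n[Q+S] - n[S], and let v have divisor n[Q₀+S₀] - n[S₀] - [S₀+Q] + [S₀]. Up
to constants f ∘ [n] is gⁿ, and f' ∘ [n] is the product of the v ∘ τ_R over R in E[n]. Weil
reciprocity g(div v) = v(div g) then reads f([Q+S] - [S]) / c = f'([P] - [O]); this is
`pairing_eq_mul_pairing`. Another use of reciprocity shows that the quotient depends only on the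
classes of the two divisors (`pairing_mul_pairing_comm`).

Comparison with the second definition. The divisors [P] - [O] and [Q] - [O] meet at O. Moving the
second one to [Q+S] - [S] by a function with a simple zero at O costs a tame symbol at O, and this
is the sign (-1)ⁿ (`unitVal_eq_mul_unitVal`). For P = Q the value is 1 because the product of the g
∘ τ_{iP₀}, 0 ≤ i < n, has trivial divisor (`transHom_eq_self_of_isRootFun`).

Reciprocity (`reciprocal`) is reduced to lines: a divisor of degree and sum zero is a combination of
divisors of lines, and these lines can be made to avoid any finite set of affine points
(`mem_lineDivisors`). For two lines it is an explicit identity. All lines have a pole at O, so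
values at O are replaced by leading coefficients and the law carries a sign.

Translations and [n] are F-endomorphisms of the function field, that is, points of E over F(E): the
generic point G goes to G + Q or nG. Specialization of such points at a point of E is a homomorphism
(`spec_add`), so these endomorphisms induce the expected maps on points. The map [n] is unramified
because it multiplies the invariant differential by n (`ram_mulHom`), and x ∘ [n] has degree 2n² by
the parallelogram law (`nsmul_generic`); together these count E[n]. -/

instance : Module.Finite F[X] W.CoordinateRing := .of_basis (CoordinateRing.basis W)

/-- The norm of p + qY has degree max(2 deg p, 2 deg q + 3), which is visibly non-archimedean in (p,
q). This degree is the pole order at infinity. -/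
lemma degree_norm_add_le (r s : W.CoordinateRing) :
    (Algebra.norm F[X] (r + s)).degree ≤
      max (Algebra.norm F[X] r).degree (Algebra.norm F[X] s).degree := by
  obtain ⟨p, q, rfl⟩ := exists_smul_basis_eq r
  obtain ⟨p', q', rfl⟩ := exists_smul_basis_eq s
  have h : p • (1 : W.CoordinateRing) + q • mk W Y + (p' • (1 : W.CoordinateRing) + q' • mk W Y) =
      (p + p') • (1 : W.CoordinateRing) + (q + q') • mk W Y := by
    rw [add_smul, add_smul]; abel
  rw [h, degree_norm_smul_basis, degree_norm_smul_basis, degree_norm_smul_basis]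
  refine max_le ?_ ?_
  · rcases le_max_iff.mp (degree_add_le p p') with h | h
    · exact (nsmul_le_nsmul_right h 2).trans ((le_max_left _ _).trans (le_max_left _ _))
    · exact (nsmul_le_nsmul_right h 2).trans ((le_max_left _ _).trans (le_max_right _ _))
  · rcases le_max_iff.mp (degree_add_le q q') with h | h
    · exact (add_le_add_left (nsmul_le_nsmul_right h 2) 3).trans
        ((le_max_right _ _).trans (le_max_left _ _))
    · exact (add_le_add_left (nsmul_le_nsmul_right h 2) 3).trans
        ((le_max_right _ _).trans (le_max_right _ _))

open WithZero Classical in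
variable (W) in
/-- The valuation of the coordinate ring given by the order of the pole at infinity. -/
noncomputable def inftyValuationAux : Valuation W.CoordinateRing (WithZero (Multiplicative ℤ)) where
  toFun r := if Algebra.norm F[X] r = 0 then 0 else exp ((Algebra.norm F[X] r).natDegree : ℤ)
  map_zero' := by simp [Algebra.norm_zero]
  map_one' := by simp
  map_mul' r s := by
    simp only [map_mul]
    by_cases hr : Algebra.norm F[X] r = 0
    · simp [hr]
    by_cases hs : Algebra.norm F[X] s = 0
    · simp [hs]
    rw [if_neg hr, if_neg hs, if_neg (mul_ne_zero hr hs), natDegree_mul hr hs]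
    simp [exp_add]
  map_add_le_max' r s := by
    by_cases h : Algebra.norm F[X] (r + s) = 0
    · simp [h]
    have key := degree_norm_add_le r s
    rw [le_max_iff] at key ⊢
    refine key.imp (fun h' => ?_) (fun h' => ?_)
    all_goals
      have h0 := ne_zero_of_degree_ge_degree h' h
      rw [if_neg h, if_neg h0, exp_le_exp]
      exact_mod_cast natDegree_le_natDegree h'

lemma inftyValuationAux_supp :
    nonZeroDivisors W.CoordinateRing ≤ (inftyValuationAux W).supp.primeCompl := by
  intro r hr h
  have hr0 : r ≠ 0 := nonZeroDivisors.ne_zero hr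
  have h' : inftyValuationAux W r = 0 := h
  simp [inftyValuationAux] at h'
  exact hr0 h'

variable (W) in
/-- The valuation of the function field at infinity. -/
noncomputable def inftyValuation : Valuation W.FunctionField (WithZero (Multiplicative ℤ)) :=
  (inftyValuationAux W).extendToLocalization inftyValuationAux_supp W.FunctionField

open WithZero Classical in
lemma inftyValuation_smul_basis (p q : F[X]) (d : ℕ)
    (h : max (2 • p.degree) (2 • q.degree + 3) = d) :
    inftyValuation W (algebraMap _ _ (p • (1 : W.CoordinateRing) + q • mk W Y)) = exp (d : ℤ) := by
  rw [inftyValuation, Valuation.extendToLocalization_apply_map_apply]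
  have h1 : (Algebra.norm F[X] (p • (1 : W.CoordinateRing) + q • mk W Y)).degree = d := by
    rw [degree_norm_smul_basis, h]
  have h2 : Algebra.norm F[X] (p • (1 : W.CoordinateRing) + q • mk W Y) ≠ 0 := by
    intro h0; rw [h0] at h1; simp at h1
  change (if Algebra.norm F[X] (p • (1 : W.CoordinateRing) + q • mk W Y) = 0 then 0 else
    exp ((Algebra.norm F[X] (p • (1 : W.CoordinateRing) + q • mk W Y)).natDegree : ℤ)) = _
  rw [if_neg h2, natDegree_eq_of_degree_eq_some h1]

open WithZero in
lemma inftyValuation_xFun : inftyValuation W (xFun W) = exp (2 : ℤ) := by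
  have := inftyValuation_smul_basis (W := W) X 0 2 (by simp)
  simpa [xFun, Affine.CoordinateRing.smul] using this

open WithZero in
lemma inftyValuation_yFun : inftyValuation W (yFun W) = exp (3 : ℤ) := by
  have := inftyValuation_smul_basis (W := W) 0 1 3 (by simp)
  simpa [yFun] using this

open WithZero in
lemma inftyValuation_const {c : F} (hc : c ≠ 0) : inftyValuation W (const W c) = 1 := by
  have := inftyValuation_smul_basis (W := W) (C c) 0 0 (by simp [degree_C hc])
  rw [zero_smul, add_zero, Affine.CoordinateRing.smul, mul_one] at this
  exact this

end ValuationAtInfinity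

end WeilPairing

namespace WeilPairing

variable {F : Type*} [Field F] {W : Affine F}

/-! ### Values -/

section Values

/-- The substitution of the chart coordinates as a ring homomorphism. -/
noncomputable def inChartHom (P : W.Point) : F[X][Y] →+* W.FunctionField :=
  eval₂RingHom (eval₂RingHom (const W) (chart P).1) (chart P).2

@[simp] lemma inChartHom_CC (P : W.Point) (c : F) : inChartHom P (C (C c)) = const W c := by
  simp [inChartHom]

@[simp] lemma inChartHom_CX (P : W.Point) : inChartHom P (C X) = (chart P).1 := by
  simp [inChartHom]

@[simp] lemma inChartHom_Y (P : W.Point) : inChartHom P Y = (chart P).2 := by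
  simp [inChartHom]

lemma hasValueAt_iff {f : W.FunctionField} {P : W.Point} {c : F} : HasValueAt f P c ↔
    ∃ A B : F[X][Y], B.evalEval 0 0 ≠ 0 ∧ f * inChartHom P B = inChartHom P A ∧
      c = A.evalEval 0 0 / B.evalEval 0 0 := Iff.rfl

lemma const_injective : Function.Injective (const W) := (const W).injective

/-- The polynomials vanishing at the origin form the ideal (X, Y). This reduces questions about the
maximal ideal of a local ring to the two chart coordinates. -/
lemma exists_eq_X_mul_add_Y_mul_add (P : F[X][Y]) : ∃ A B : F[X][Y], ∃ c : F, P = C X * A + Y * B + C (C c) ∧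
    P.evalEval 0 0 = c := by
  refine ⟨C (P.coeff 0).divX, P.divX, (P.coeff 0).coeff 0, ?_, ?_⟩
  · conv_lhs => rw [← divX_mul_X_add P, ← divX_mul_X_add (P.coeff 0)]
    simp only [map_add, map_mul]
    ring
  · conv_lhs => rw [← divX_mul_X_add P, ← divX_mul_X_add (P.coeff 0)]
    simp [evalEval]

open WithZero in
lemma inftyValuation_inChart_le (A : F[X][Y]) :
    inftyValuation W (inChartHom (0 : W.Point) A) ≤ 1 := by
  have hx : inftyValuation W (chart (0 : W.Point)).1 ≤ 1 := by
    change inftyValuation W (xFun W / yFun W) ≤ 1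
    rw [map_div₀, inftyValuation_xFun, inftyValuation_yFun, ← exp_sub, ← exp_zero, exp_le_exp]
    norm_num
  have hy : inftyValuation W (chart (0 : W.Point)).2 ≤ 1 := by
    change inftyValuation W (1 / yFun W) ≤ 1
    rw [map_div₀, map_one, inftyValuation_yFun, one_div, ← exp_neg, ← exp_zero, exp_le_exp]
    norm_num
  have hc : ∀ c, inftyValuation W (const W c) ≤ 1 := fun c => by
    by_cases h : c = 0
    · simp [h]
    · rw [inftyValuation_const h]
  have hp : ∀ p : F[X], inChartHom (0 : W.Point) (C p) ∈ (inftyValuation W).integer := by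
    intro p
    induction p using Polynomial.induction_on' with
    | add p q hp hq => rw [map_add, map_add]; exact add_mem hp hq
    | monomial n a =>
      rw [← C_mul_X_pow_eq_monomial, map_mul, map_pow, map_mul, map_pow, inChartHom_CC,
        inChartHom_CX]
      exact mul_mem (hc a) (pow_mem hx n)
  change inChartHom (0 : W.Point) A ∈ (inftyValuation W).integer
  induction A using Polynomial.induction_on' with
  | add p q hp hq => rw [map_add]; exact add_mem hp hq
  | monomial n a =>
    rw [← C_mul_X_pow_eq_monomial, map_mul, map_pow, inChartHom_Y]
    exact mul_mem (hp a) (pow_mem hy n)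

variable (W) in
/-- Substitution of the centred coordinates at `(x, y)`, with values in the coordinate ring. -/
noncomputable def shiftHom (x y : F) : F[X][Y] →+* W.CoordinateRing :=
  eval₂RingHom (eval₂RingHom (algebraMap F W.CoordinateRing)
    (Affine.CoordinateRing.mk W (C X) - algebraMap F _ x))
    (Affine.CoordinateRing.mk W Y - algebraMap F _ y)

lemma algebraMap_shiftHom {x y : F} (h : W.Nonsingular x y) (A : F[X][Y]) :
    algebraMap _ W.FunctionField (shiftHom W x y A) = inChartHom (.some x y h) A := by
  have : (algebraMap W.CoordinateRing W.FunctionField).comp (shiftHom W x y) =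
      inChartHom (.some x y h) := by
    refine Polynomial.ringHom_ext' (Polynomial.ringHom_ext' ?_ ?_) ?_
    · ext c; simp [shiftHom, const]
    · simp [shiftHom, chart, xFun, const]
    · simp [shiftHom, chart, yFun, const]
  exact congr($this A)

lemma algebraMap_coordinateRing (c : F) :
    algebraMap F W.CoordinateRing c = Affine.CoordinateRing.mk W (C (C c)) := rfl

lemma evalEval_shiftHom {x y : F} (h : W.polynomial.evalEval x y = 0) (A : F[X][Y]) :
    AdjoinRoot.evalEval h (shiftHom W x y A) = A.evalEval 0 0 := by
  have : (AdjoinRoot.evalEval h).comp (shiftHom W x y) = evalEvalRingHom 0 0 := by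
    refine Polynomial.ringHom_ext' (Polynomial.ringHom_ext' ?_ ?_) ?_
    · ext c; simp [shiftHom, algebraMap_coordinateRing, AdjoinRoot.evalEval_mk, -AdjoinRoot.mk_C]
    · simp [shiftHom, algebraMap_coordinateRing, AdjoinRoot.evalEval_mk, -AdjoinRoot.mk_C,
        evalEval_C]
    · simp [shiftHom, algebraMap_coordinateRing, AdjoinRoot.evalEval_mk, -AdjoinRoot.mk_C,
        -AdjoinRoot.mk_X]
  exact congr($this A)

open WithZero in
lemma inftyValuation_chart_zero : inftyValuation W (chart (0 : W.Point)).1 < 1 ∧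
    inftyValuation W (chart (0 : W.Point)).2 < 1 := by
  constructor
  · change inftyValuation W (xFun W / yFun W) < 1
    rw [map_div₀, inftyValuation_xFun, inftyValuation_yFun, ← exp_sub, ← exp_zero, exp_lt_exp]
    norm_num
  · change inftyValuation W (1 / yFun W) < 1
    rw [map_div₀, map_one, inftyValuation_yFun, one_div, ← exp_neg, ← exp_zero, exp_lt_exp]
    norm_num

/-- A polynomial that vanishes identically in a chart vanishes at the centre. -/
lemma evalEval_eq_zero_of_inChartHom_eq_zero (P : W.Point) {G : F[X][Y]}
    (hG : inChartHom P G = 0) : G.evalEval 0 0 = 0 := by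
  match P, hG with
  | .some x y h, hG =>
    rw [← algebraMap_shiftHom, map_eq_zero_iff _ (IsFractionRing.injective _ _)] at hG
    rw [← evalEval_shiftHom (W := W) h.1, hG, map_zero]
  | 0, hG =>
    -- In G = X·A + Y·B + c the first two terms have valuation less than 1 at infinity, while a
    -- non-zero constant has valuation exactly 1.
    obtain ⟨A, B, c, rfl, hc⟩ := exists_eq_X_mul_add_Y_mul_add G
    rw [hc]
    by_contra h0
    rw [map_add, map_add, map_mul, map_mul, inChartHom_CX, inChartHom_Y, inChartHom_CC] at hG
    have h1 := inftyValuation_const (W := W) h0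
    rw [← Valuation.map_neg, ← eq_neg_of_add_eq_zero_left hG] at h1
    refine ne_of_lt ?_ h1
    refine Valuation.map_add_lt _ ?_ ?_
    · rw [map_mul]
      exact mul_lt_one_of_lt_of_le inftyValuation_chart_zero.1 (inftyValuation_inChart_le A)
    · rw [map_mul]
      exact mul_lt_one_of_lt_of_le inftyValuation_chart_zero.2 (inftyValuation_inChart_le B)

namespace HasValueAt

variable {f g : W.FunctionField} {P : W.Point} {a b : F}

/-- Two representations A/B and A'/B' of one function make AB' - A'B vanish identically in the
chart, hence at its centre. -/
lemma unique (hf : HasValueAt f P a) (hg : HasValueAt f P b) : a = b := by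
  obtain ⟨A, B, hB, h, rfl⟩ := hasValueAt_iff.mp hf
  obtain ⟨A', B', hB', h', rfl⟩ := hasValueAt_iff.mp hg
  have := evalEval_eq_zero_of_inChartHom_eq_zero P (G := A * B' - A' * B) (by
    rw [map_sub, map_mul, map_mul, ← h, ← h']; ring)
  rw [evalEval_sub, evalEval_mul, evalEval_mul] at this
  field_simp
  linear_combination this

lemma inChart (P : W.Point) (A : F[X][Y]) : HasValueAt (inChartHom P A) P (A.evalEval 0 0) :=
  hasValueAt_iff.mpr ⟨A, 1, by simp, by simp, by simp⟩

lemma const (P : W.Point) (c : F) : HasValueAt (const W c) P c := by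
  simpa using inChart P (C (C c))

lemma one (P : W.Point) : HasValueAt (1 : W.FunctionField) P 1 := by simpa using const P (1 : F)

lemma zero (P : W.Point) : HasValueAt (0 : W.FunctionField) P 0 := by simpa using const P (0 : F)

lemma chart_fst (P : W.Point) : HasValueAt (chart P).1 P 0 := by simpa [evalEval_C] using inChart P (C X)

lemma chart_snd (P : W.Point) : HasValueAt (chart P).2 P 0 := by simpa using inChart P Y

lemma add (hf : HasValueAt f P a) (hg : HasValueAt g P b) : HasValueAt (f + g) P (a + b) := by
  obtain ⟨A, B, hB, h, rfl⟩ := hasValueAt_iff.mp hf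
  obtain ⟨A', B', hB', h', rfl⟩ := hasValueAt_iff.mp hg
  refine hasValueAt_iff.mpr ⟨A * B' + A' * B, B * B', by simp [hB, hB'], ?_, ?_⟩
  · rw [map_add, map_mul, map_mul, map_mul, ← h, ← h']; ring
  · simp only [evalEval_add, evalEval_mul]; field_simp

lemma mul (hf : HasValueAt f P a) (hg : HasValueAt g P b) : HasValueAt (f * g) P (a * b) := by
  obtain ⟨A, B, hB, h, rfl⟩ := hasValueAt_iff.mp hf
  obtain ⟨A', B', hB', h', rfl⟩ := hasValueAt_iff.mp hg
  refine hasValueAt_iff.mpr ⟨A * A', B * B', by simp [hB, hB'], ?_, ?_⟩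
  · rw [map_mul, map_mul, ← h, ← h']; ring
  · simp only [evalEval_mul]; field_simp

lemma neg (hf : HasValueAt f P a) : HasValueAt (-f) P (-a) := by
  simpa using (const P (-1 : F)).mul hf

lemma sub (hf : HasValueAt f P a) (hg : HasValueAt g P b) : HasValueAt (f - g) P (a - b) := by
  simpa [sub_eq_add_neg] using hf.add hg.neg

lemma pow (hf : HasValueAt f P a) (n : ℕ) : HasValueAt (f ^ n) P (a ^ n) := by
  induction n with
  | zero => simpa using one P
  | succ n ih => rw [pow_succ, pow_succ]; exact ih.mul hf

lemma ne_zero (hf : HasValueAt f P a) (ha : a ≠ 0) : f ≠ 0 := by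
  rintro rfl
  exact ha (hf.unique (zero P))

lemma inv (hf : HasValueAt f P a) (ha : a ≠ 0) : HasValueAt f⁻¹ P a⁻¹ := by
  have h0 := hf.ne_zero ha
  obtain ⟨A, B, hB, h, rfl⟩ := hasValueAt_iff.mp hf
  refine hasValueAt_iff.mpr ⟨B, A, fun h' => ha (by simp [h']), ?_, by simp⟩
  rw [← h]; field_simp

lemma div (hf : HasValueAt f P a) (hg : HasValueAt g P b) (hb : b ≠ 0) :
    HasValueAt (f / g) P (a / b) := by
  rw [div_eq_mul_inv, div_eq_mul_inv]; exact hf.mul (hg.inv hb)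

lemma zpow (hf : HasValueAt f P a) (ha : a ≠ 0) (n : ℤ) : HasValueAt (f ^ n) P (a ^ n) := by
  cases n with
  | ofNat n => simpa using hf.pow n
  | negSucc n => rw [zpow_negSucc, zpow_negSucc]; exact (hf.pow _).inv (pow_ne_zero _ ha)

lemma congr (hf : HasValueAt f P a) (h : a = b) : HasValueAt f P b := h ▸ hf

lemma isRegularAt (hf : HasValueAt f P a) : IsRegularAt f P := ⟨a, hf⟩

end HasValueAt

/-- Substitution of regular functions into a polynomial in two variables. -/
lemma HasValueAt.eval₂ {u v : W.FunctionField} {P : W.Point} {a b : F} (hu : HasValueAt u P a)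
    (hv : HasValueAt v P b) (A : F[X][Y]) :
    HasValueAt (A.eval₂ (eval₂RingHom (WeilPairing.const W) u) v) P (A.evalEval a b) := by
  have hp : ∀ p : F[X], HasValueAt (p.eval₂ (WeilPairing.const W) u) P (p.eval a) := by
    intro p
    induction p using Polynomial.induction_on' with
    | add p q hp hq => rw [eval₂_add, eval_add]; exact hp.add hq
    | monomial n c => rw [eval₂_monomial, eval_monomial]; exact (HasValueAt.const P c).mul (hu.pow n)
  induction A using Polynomial.induction_on' with
  | add p q hp hq => rw [eval₂_add, evalEval_add]; exact hp.add hq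
  | monomial n c =>
    rw [eval₂_monomial, ← C_mul_X_pow_eq_monomial, evalEval_mul, evalEval_C, evalEval_pow,
      evalEval_X]
    exact (hp c).mul (hv.pow n)

lemma IsRegularAt.add {f g : W.FunctionField} {P : W.Point} (hf : IsRegularAt f P)
    (hg : IsRegularAt g P) : IsRegularAt (f + g) P := ⟨_, hf.choose_spec.add hg.choose_spec⟩

lemma IsRegularAt.mul {f g : W.FunctionField} {P : W.Point} (hf : IsRegularAt f P)
    (hg : IsRegularAt g P) : IsRegularAt (f * g) P := ⟨_, hf.choose_spec.mul hg.choose_spec⟩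

lemma value_eq {f : W.FunctionField} {P : W.Point} {c : F} (h : HasValueAt f P c) :
    value f P = c := by
  rw [value, dif_pos h.isRegularAt]
  exact h.isRegularAt.choose_spec.unique h

lemma IsRegularAt.hasValueAt {f : W.FunctionField} {P : W.Point} (h : IsRegularAt f P) :
    HasValueAt f P (value f P) := by
  obtain ⟨c, hc⟩ := h
  rwa [value_eq hc]

end Values

end WeilPairing

namespace WeilPairing

variable {F : Type*} [Field F] {W : Affine F}

/-! ### Uniformizers and orders -/

section Orders

lemma xFun_yFun_equation : yFun W ^ 2 + const W W.a₁ * xFun W * yFun W + const W W.a₃ * yFun W =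
    xFun W ^ 3 + const W W.a₂ * xFun W ^ 2 + const W W.a₄ * xFun W + const W W.a₆ := by
  have h : Affine.CoordinateRing.mk W (Y ^ 2 + C (C W.a₁) * C X * Y + C (C W.a₃) * Y) =
      Affine.CoordinateRing.mk W (C X ^ 3 + C (C W.a₂) * C X ^ 2 + C (C W.a₄) * C X +
        C (C W.a₆)) := AdjoinRoot.mk_eq_mk.mpr ⟨1, by
    rw [Affine.polynomial]; simp only [map_add, map_mul, map_pow]; ring⟩
  have := congrArg (algebraMap W.CoordinateRing W.FunctionField) h
  simp only [map_add, map_mul, map_pow] at this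
  exact this

lemma xFun_ne_const (c : F) : xFun W ≠ const W c := by
  intro h
  have h2 := inftyValuation_xFun (W := W)
  have h1 : inftyValuation W (const W c) ≤ 1 := by
    by_cases hc : c = 0
    · simp [hc]
    · rw [inftyValuation_const hc]
  rw [← h, h2, ← WithZero.exp_zero, WithZero.exp_le_exp] at h1
  norm_num at h1

lemma xFun_ne_zero : xFun W ≠ 0 := by simpa using xFun_ne_const (W := W) 0

lemma yFun_ne_zero : yFun W ≠ 0 := by
  intro h
  have := inftyValuation_yFun (W := W)
  rw [h, map_zero] at this
  exact WithZero.exp_ne_zero this.symm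

/-- A function vanishing at P is (X·A₁ + Y·A₂)/B in the chart coordinates, so it is enough that t
divides the two coordinates in the local ring. -/
lemma isUniformizerAt_of_chart {P : W.Point} {t r s : W.FunctionField} (ht : HasValueAt t P 0)
    (hr : IsRegularAt r P) (hs : IsRegularAt s P) (h1 : (chart P).1 = t * r)
    (h2 : (chart P).2 = t * s) : IsUniformizerAt t P := by
  refine ⟨ht, fun f hf => ?_⟩
  obtain ⟨A, B, hB, h, h0⟩ := hasValueAt_iff.mp hf
  obtain ⟨A₁, A₂, c, rfl, hc⟩ := exists_eq_X_mul_add_Y_mul_add A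
  rw [hc, eq_comm, div_eq_zero_iff, or_iff_left hB] at h0
  have hB' := HasValueAt.inChart P B
  refine ⟨(r * inChartHom P A₁ + s * inChartHom P A₂) * (inChartHom P B)⁻¹,
    ((hr.mul (HasValueAt.inChart P A₁).isRegularAt).add
      (hs.mul (HasValueAt.inChart P A₂).isRegularAt)).mul (hB'.inv hB).isRegularAt, ?_⟩
  have := hB'.ne_zero hB
  rw [h0] at h
  simp only [map_add, map_mul, inChartHom_CX, inChartHom_Y, map_zero, add_zero, h1, h2] at h
  field_simp
  linear_combination h

lemma exists_uniformizer_some {x y : F} (h : W.Nonsingular x y) :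
    ∃ (t u : W.FunctionField) (j : ℕ) (c : F), IsUniformizerAt t (.some x y h) ∧ c ≠ 0 ∧
      HasValueAt u (.some x y h) c ∧ xFun W - const W x = t ^ j * u ∧
      j = (open Classical in if 2 * y + W.a₁ * x + W.a₃ = 0 then 2 else 1) := by
  set P : W.Point := .some x y h with hP
  have hu : HasValueAt (xFun W - const W x) P 0 := HasValueAt.chart_fst P
  have hv : HasValueAt (yFun W - const W y) P 0 := HasValueAt.chart_snd P
  set u := xFun W - const W x with hu'
  set v := yFun W - const W y with hv'
  have hc := HasValueAt.const P (W := W)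
  -- Taylor expansion of the Weierstrass equation at (x, y). The coefficient of v decides which
  -- coordinate is the uniformizer: if it is non-zero, v is a multiple of u; otherwise
  -- nonsingularity makes the linear coefficient in u non-zero, and u is a unit times v².
  have key : v ^ 2 + const W W.a₁ * u * v + const W (2 * y + W.a₁ * x + W.a₃) * v =
      u * (u ^ 2 + const W (3 * x + W.a₂) * u +
        const W (3 * x ^ 2 + 2 * W.a₂ * x + W.a₄ - W.a₁ * y)) := by
    have h1 := xFun_yFun_equation (W := W)
    have h2 := congrArg (const W) ((Affine.equation_iff ..).mp h.1)
    simp only [map_add, map_mul, map_pow, map_sub, map_ofNat] at h2 ⊢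
    rw [hu', hv']
    linear_combination h1 - h2
  by_cases hψ : 2 * y + W.a₁ * x + W.a₃ = 0
  · have hd : 3 * x ^ 2 + 2 * W.a₂ * x + W.a₄ - W.a₁ * y ≠ 0 := by
      rcases ((Affine.nonsingular_iff' ..).mp h).2 with h' | h'
      · intro h0; apply h'; linear_combination -h0
      · exact absurd hψ h'
    have hg : HasValueAt (u ^ 2 + const W (3 * x + W.a₂) * u +
        const W (3 * x ^ 2 + 2 * W.a₂ * x + W.a₄ - W.a₁ * y) - const W W.a₁ * v) P
        (3 * x ^ 2 + 2 * W.a₂ * x + W.a₄ - W.a₁ * y) :=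
      ((((hu.pow 2).add ((hc _).mul hu)).add (hc _)).sub ((hc _).mul hv)).congr (by ring)
    rw [hψ, map_zero] at key
    set g := u ^ 2 + const W (3 * x + W.a₂) * u +
        const W (3 * x ^ 2 + 2 * W.a₂ * x + W.a₄ - W.a₁ * y) - const W W.a₁ * v with hg'
    have hg0 := hg.ne_zero hd
    have huv : u = v ^ 2 * g⁻¹ := by
      field_simp
      rw [hg']
      linear_combination -key
    refine ⟨v, g⁻¹, 2, _, isUniformizerAt_of_chart (r := v * g⁻¹) (s := 1) hv
      (hv.mul (hg.inv hd)).isRegularAt (HasValueAt.one P).isRegularAt ?_ (mul_one _).symm,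
      inv_ne_zero hd, hg.inv hd, huv, by rw [if_pos hψ]⟩
    change u = _
    rw [huv]; ring
  · have hg : HasValueAt (v + const W W.a₁ * u + const W (2 * y + W.a₁ * x + W.a₃)) P
        (2 * y + W.a₁ * x + W.a₃) :=
      ((hv.add ((hc _).mul hu)).add (hc _)).congr (by ring)
    have hr : HasValueAt (u ^ 2 + const W (3 * x + W.a₂) * u +
        const W (3 * x ^ 2 + 2 * W.a₂ * x + W.a₄ - W.a₁ * y)) P
        (3 * x ^ 2 + 2 * W.a₂ * x + W.a₄ - W.a₁ * y) :=
      (((hu.pow 2).add ((hc _).mul hu)).add (hc _)).congr (by ring)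
    have hg0 := hg.ne_zero hψ
    refine ⟨u, 1, 1, 1, isUniformizerAt_of_chart (r := 1) hu
      (HasValueAt.one P).isRegularAt (hr.mul (hg.inv hψ)).isRegularAt (mul_one _).symm ?_,
      one_ne_zero, HasValueAt.one P, by rw [pow_one, mul_one], by rw [if_neg hψ]⟩
    change v = _
    rw [← mul_assoc, eq_mul_inv_iff_mul_eq₀ hg0]
    linear_combination key

/-- With z = x/y and w = 1/y the equation of the curve is w·g = z³, where g has value 1 at O. Hence
y = z⁻³g and x = z⁻²g. That the value of g is exactly 1 makes x, y and all lines monic. -/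
lemma isUniformizerAt_zero : IsUniformizerAt (xFun W / yFun W) (0 : W.Point) ∧
    ∃ u, HasValueAt u (0 : W.Point) 1 ∧ xFun W = (xFun W / yFun W) ^ (-2 : ℤ) * u ∧
      yFun W = (xFun W / yFun W) ^ (-3 : ℤ) * u := by
  have hz : HasValueAt (xFun W / yFun W) (0 : W.Point) 0 := HasValueAt.chart_fst 0
  have hw : HasValueAt (1 / yFun W) (0 : W.Point) 0 := HasValueAt.chart_snd 0
  set z := xFun W / yFun W with hz'
  set w := 1 / yFun W with hw'
  have hy := yFun_ne_zero (W := W)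
  have hx := xFun_ne_zero (W := W)
  have hc := HasValueAt.const (0 : W.Point)
  have hg : HasValueAt (1 + const W W.a₁ * z + const W W.a₃ * w - const W W.a₂ * z ^ 2 -
      const W W.a₄ * z * w - const W W.a₆ * w ^ 2) 0 1 :=
    ((((((HasValueAt.one 0).add ((hc _).mul hz)).add ((hc _).mul hw)).sub
      ((hc _).mul (hz.pow 2))).sub (((hc _).mul hz).mul hw)).sub
      ((hc _).mul (hw.pow 2))).congr (by ring)
  have key : w * (1 + const W W.a₁ * z + const W W.a₃ * w - const W W.a₂ * z ^ 2 -
      const W W.a₄ * z * w - const W W.a₆ * w ^ 2) = z ^ 3 := by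
    rw [hz', hw']
    field_simp
    linear_combination xFun_yFun_equation (W := W)
  set g := 1 + const W W.a₁ * z + const W W.a₃ * w - const W W.a₂ * z ^ 2 -
      const W W.a₄ * z * w - const W W.a₆ * w ^ 2
  have hg0 := hg.ne_zero one_ne_zero
  have hz0 : z ≠ 0 := div_ne_zero hx hy
  have hyz : yFun W * z ^ 3 = g := by
    rw [← key, hw']; field_simp
  refine ⟨isUniformizerAt_of_chart (r := 1) (s := z ^ 2 * g⁻¹) hz (HasValueAt.one 0).isRegularAt
    ((hz.pow 2).mul (hg.inv one_ne_zero)).isRegularAt (mul_one _).symm ?_, g, hg, ?_, ?_⟩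
  · change w = _
    field_simp
    linear_combination key
  · rw [← hyz, show (-2 : ℤ) = -(2 : ℕ) by rfl, zpow_neg, zpow_natCast]
    field_simp
    rw [hz']; field_simp
  · rw [← hyz, show (-3 : ℤ) = -(3 : ℕ) by rfl, zpow_neg, zpow_natCast]
    field_simp

end Orders

end WeilPairing

namespace WeilPairing

variable {F : Type*} [Field F] {W : Affine F}

/-! ### Every non-zero function has an order at every point. -/

section Orders

lemma exists_isUniformizerAt (P : W.Point) : ∃ t : W.FunctionField, IsUniformizerAt t P := by
  match P with
  | 0 => exact ⟨_, isUniformizerAt_zero.1⟩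
  | .some x y h => exact ⟨_, (exists_uniformizer_some h).choose_spec.choose_spec.choose_spec.choose_spec.1⟩

lemma IsUniformizerAt.ne_zero {t : W.FunctionField} {P : W.Point} (ht : IsUniformizerAt t P) :
    t ≠ 0 := by
  rintro rfl
  obtain ⟨g, -, hg⟩ := ht.2 _ (HasValueAt.chart_fst P)
  rw [zero_mul] at hg
  match P, hg with
  | 0, hg => exact div_ne_zero xFun_ne_zero yFun_ne_zero hg
  | .some x y h, hg => exact xFun_ne_const x (sub_eq_zero.mp hg)

/-- `u` is a unit of the local ring at `P`. -/
def IsUnitAt (u : W.FunctionField) (P : W.Point) : Prop := ∃ c, c ≠ 0 ∧ HasValueAt u P c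

namespace IsUnitAt

variable {u v : W.FunctionField} {P : W.Point}

lemma mul (hu : IsUnitAt u P) (hv : IsUnitAt v P) : IsUnitAt (u * v) P := by
  obtain ⟨c, hc, hu⟩ := hu
  obtain ⟨d, hd, hv⟩ := hv
  exact ⟨_, mul_ne_zero hc hd, hu.mul hv⟩

lemma inv (hu : IsUnitAt u P) : IsUnitAt u⁻¹ P := by
  obtain ⟨c, hc, hu⟩ := hu
  exact ⟨_, inv_ne_zero hc, hu.inv hc⟩

lemma pow (hu : IsUnitAt u P) (n : ℕ) : IsUnitAt (u ^ n) P := by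
  obtain ⟨c, hc, hu⟩ := hu
  exact ⟨_, pow_ne_zero n hc, hu.pow n⟩

lemma zpow (hu : IsUnitAt u P) (n : ℤ) : IsUnitAt (u ^ n) P := by
  obtain ⟨c, hc, hu⟩ := hu
  exact ⟨_, zpow_ne_zero n hc, hu.zpow hc n⟩

lemma ne_zero (hu : IsUnitAt u P) : u ≠ 0 := by
  obtain ⟨c, hc, hu⟩ := hu
  exact hu.ne_zero hc

lemma isRegularAt (hu : IsUnitAt u P) : IsRegularAt u P := ⟨_, hu.choose_spec.2⟩

lemma of_mul_eq_one (hu : IsRegularAt u P) (hv : IsRegularAt v P) (h : u * v = 1) :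
    IsUnitAt u P := by
  obtain ⟨c, hc⟩ := hu
  obtain ⟨d, hd⟩ := hv
  refine ⟨c, ?_, hc⟩
  rintro rfl
  have := h ▸ hc.mul hd
  simpa using this.unique (HasValueAt.one P)

end IsUnitAt

lemma IsUniformizerAt.exists_unit {t s : W.FunctionField} {P : W.Point} (ht : IsUniformizerAt t P)
    (hs : IsUniformizerAt s P) : ∃ u, IsUnitAt u P ∧ s = t * u := by
  obtain ⟨g, hg, h1⟩ := ht.2 s hs.1
  obtain ⟨g', hg', h2⟩ := hs.2 t ht.1
  refine ⟨g, IsUnitAt.of_mul_eq_one hg hg' ?_, h1⟩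
  have := ht.ne_zero
  rw [h1, mul_assoc] at h2
  exact mul_left_cancel₀ this (by rw [← h2, mul_one])

lemma hasOrderAt_iff {t f : W.FunctionField} {P : W.Point} {k : ℤ} (ht : IsUniformizerAt t P) :
    HasOrderAt f P k ↔ ∃ u, IsUnitAt u P ∧ f = t ^ k * u := by
  constructor
  · rintro ⟨s, u, hs, hu, rfl⟩
    obtain ⟨v, hv, rfl⟩ := ht.exists_unit hs
    exact ⟨v ^ k * u, (hv.zpow k).mul hu, by rw [mul_zpow, mul_assoc]⟩
  · rintro ⟨u, hu, rfl⟩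
    exact ⟨t, u, ht, hu, rfl⟩

lemma HasOrderAt.mul {f g : W.FunctionField} {P : W.Point} {k l : ℤ} (hf : HasOrderAt f P k)
    (hg : HasOrderAt g P l) : HasOrderAt (f * g) P (k + l) := by
  obtain ⟨t, ht⟩ := exists_isUniformizerAt P
  obtain ⟨u, hu, rfl⟩ := (hasOrderAt_iff ht).mp hf
  obtain ⟨v, hv, rfl⟩ := (hasOrderAt_iff ht).mp hg
  exact (hasOrderAt_iff ht).mpr ⟨u * v, hu.mul hv, by rw [zpow_add₀ ht.ne_zero]; ring⟩

lemma HasOrderAt.inv {f : W.FunctionField} {P : W.Point} {k : ℤ} (hf : HasOrderAt f P k) :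
    HasOrderAt f⁻¹ P (-k) := by
  obtain ⟨t, ht⟩ := exists_isUniformizerAt P
  obtain ⟨u, hu, rfl⟩ := (hasOrderAt_iff ht).mp hf
  exact (hasOrderAt_iff ht).mpr ⟨u⁻¹, hu.inv, by rw [mul_inv, zpow_neg]⟩

lemma HasOrderAt.ne_zero {f : W.FunctionField} {P : W.Point} {k : ℤ} (hf : HasOrderAt f P k) :
    f ≠ 0 := by
  obtain ⟨t, u, ht, hu, rfl⟩ := hf
  exact mul_ne_zero (zpow_ne_zero _ ht.ne_zero) (IsUnitAt.ne_zero hu)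

lemma IsUniformizerAt.not_isUnitAt_zpow {t : W.FunctionField} {P : W.Point}
    (ht : IsUniformizerAt t P) {k : ℤ} (h : IsUnitAt (t ^ k) P) : k = 0 := by
  have key : ∀ n : ℕ, IsUnitAt (t ^ n) P → n = 0 := by
    rintro n ⟨c, hc, hn⟩
    by_contra h0
    exact hc (hn.unique ((ht.1.pow n).congr (zero_pow h0)))
  cases k with
  | ofNat n => simpa using key n (by simpa using h)
  | negSucc n =>
    have := key (n + 1) (by simpa [zpow_negSucc] using h.inv)
    omega

lemma HasOrderAt.unique {f : W.FunctionField} {P : W.Point} {k l : ℤ} (hf : HasOrderAt f P k)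
    (hg : HasOrderAt f P l) : k = l := by
  obtain ⟨t, ht⟩ := exists_isUniformizerAt P
  obtain ⟨u, hu, h⟩ := (hasOrderAt_iff ht).mp hf
  obtain ⟨v, hv, rfl⟩ := (hasOrderAt_iff ht).mp hg
  have : t ^ (l - k) = u * v⁻¹ := by
    have := hv.ne_zero
    rw [zpow_sub₀ ht.ne_zero]
    have h2 := zpow_ne_zero k ht.ne_zero
    field_simp
    linear_combination h
  have := ht.not_isUnitAt_zpow (this ▸ hu.mul hv.inv)
  omega

lemma IsUnitAt.hasOrderAt {u : W.FunctionField} {P : W.Point} (hu : IsUnitAt u P) :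
    HasOrderAt u P 0 := by
  obtain ⟨t, ht⟩ := exists_isUniformizerAt P
  exact (hasOrderAt_iff ht).mpr ⟨u, hu, by simp⟩

lemma HasOrderAt.pow {f : W.FunctionField} {P : W.Point} {k : ℤ} (hf : HasOrderAt f P k) (n : ℕ) :
    HasOrderAt (f ^ n) P (n * k) := by
  induction n with
  | zero => simpa using IsUnitAt.hasOrderAt ⟨1, one_ne_zero, HasValueAt.one P⟩
  | succ n ih => rw [pow_succ]; simpa [add_mul] using ih.mul hf

/-- While r vanishes at P a uniformizer can be divided out of it, and this lowers the order of the
product rs by one. Since s is regular, the process stops after at most m divisions. -/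
lemma exists_hasOrderAt_of_mul {r s : W.FunctionField} {P : W.Point} (hs : IsRegularAt s P) (m : ℕ)
    (hr : IsRegularAt r P) (h : HasOrderAt (r * s) P m) : ∃ k, HasOrderAt r P k := by
  obtain ⟨t, ht⟩ := exists_isUniformizerAt P
  induction m generalizing r with
  | zero =>
    obtain ⟨c, hc⟩ := hr
    refine ⟨0, IsUnitAt.hasOrderAt ⟨c, ?_, hc⟩⟩
    rintro rfl
    obtain ⟨d, hd⟩ := hs
    obtain ⟨u, ⟨e, he, hu⟩, h⟩ := (hasOrderAt_iff ht).mp h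
    simp only [Nat.cast_zero, zpow_zero, one_mul] at h
    rw [← h] at hu
    exact he (hu.unique ((hc.mul hd).congr (zero_mul d)))
  | succ m ih =>
    obtain ⟨c, hc⟩ := hr
    by_cases h0 : c = 0
    · subst h0
      obtain ⟨g, hg, rfl⟩ := ht.2 r hc
      obtain ⟨u, hu, h⟩ := (hasOrderAt_iff ht).mp h
      obtain ⟨k, hk⟩ := ih hg ((hasOrderAt_iff ht).mpr ⟨u, hu, by
        refine mul_left_cancel₀ ht.ne_zero ?_
        rw [← mul_assoc, h]
        push_cast
        rw [zpow_add_one₀ ht.ne_zero]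
        ring⟩)
      exact ⟨1 + k, HasOrderAt.mul ((hasOrderAt_iff ht).mpr
        ⟨1, ⟨1, one_ne_zero, HasValueAt.one P⟩, by simp⟩) hk⟩
    · exact ⟨0, IsUnitAt.hasOrderAt ⟨c, h0, hc⟩⟩

lemma algebraMap_mk (A : F[X][Y]) : algebraMap _ W.FunctionField (Affine.CoordinateRing.mk W A) =
    A.eval₂ (eval₂RingHom (const W) (xFun W)) (yFun W) := by
  have : (algebraMap W.CoordinateRing W.FunctionField).comp (Affine.CoordinateRing.mk W) =
      eval₂RingHom (eval₂RingHom (const W) (xFun W)) (yFun W) := by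
    refine Polynomial.ringHom_ext' (Polynomial.ringHom_ext' ?_ ?_) ?_
    · ext c; simp [const, algebraMap_coordinateRing]
    · simp [xFun]
    · simp [yFun]
  exact congr($this A)

lemma algebraMap_mk_C (p : F[X]) : algebraMap _ W.FunctionField (Affine.CoordinateRing.mk W (C p)) =
    p.eval₂ (const W) (xFun W) := by
  rw [algebraMap_mk]; simp

lemma hasValueAt_xFun {x y : F} (h : W.Nonsingular x y) :
    HasValueAt (xFun W) (.some x y h) x := by
  simpa using (HasValueAt.chart_fst (.some x y h)).add (HasValueAt.const _ x) |>.congr (zero_add x)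
    |> (by simpa [chart] using ·)

lemma hasValueAt_yFun {x y : F} (h : W.Nonsingular x y) :
    HasValueAt (yFun W) (.some x y h) y := by
  simpa using (HasValueAt.chart_snd (.some x y h)).add (HasValueAt.const _ y) |>.congr (zero_add y)
    |> (by simpa [chart] using ·)

lemma hasValueAt_mk {x y : F} (h : W.Nonsingular x y) (A : F[X][Y]) :
    HasValueAt (algebraMap _ W.FunctionField (Affine.CoordinateRing.mk W A)) (.some x y h)
      (A.evalEval x y) := by
  rw [algebraMap_mk]
  exact (hasValueAt_xFun h).eval₂ (hasValueAt_yFun h) A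

lemma isRegularAt_algebraMap {x y : F} (h : W.Nonsingular x y) (r : W.CoordinateRing) :
    IsRegularAt (algebraMap _ W.FunctionField r) (.some x y h) := by
  obtain ⟨A, rfl⟩ := AdjoinRoot.mk_surjective r
  exact (hasValueAt_mk h A).isRegularAt

lemma hasValueAt_poly_xFun {u : W.FunctionField} {P : W.Point} {a : F} (hu : HasValueAt u P a)
    (p : F[X]) : HasValueAt (p.eval₂ (const W) u) P (p.eval a) := by
  simpa [evalEval_C] using hu.eval₂ hu (C p)

/-- The cofactor is the conjugate of r over F[X], so that the product is the norm. Questions about r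
are thereby reduced to polynomials in x. -/
lemma exists_mul_eq_mk_C {r : W.CoordinateRing} (hr : r ≠ 0) :
    ∃ (s : W.CoordinateRing) (p : F[X]), p ≠ 0 ∧ r * s = Affine.CoordinateRing.mk W (C p) := by
  obtain ⟨p, q, rfl⟩ := Affine.CoordinateRing.exists_smul_basis_eq r
  have h := Affine.CoordinateRing.coe_norm_smul_basis (W' := W) p q
  refine ⟨Affine.CoordinateRing.mk W (C p + C q * (-(Y : F[X][Y]) - C (C W.a₁ * X + C W.a₃))), _,
    Algebra.norm_ne_zero_iff.mpr hr, Eq.trans ?_ h.symm⟩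
  rw [map_mul]
  congr 1
  simp [Affine.CoordinateRing.smul]

lemma hasOrderAt_xFun_sub {x y : F} (h : W.Nonsingular x y) :
    HasOrderAt (xFun W - const W x) (.some x y h)
      (open Classical in if 2 * y + W.a₁ * x + W.a₃ = 0 then 2 else 1) := by
  obtain ⟨t, u, j, c, ht, hc, hu, h1, h2⟩ := exists_uniformizer_some h
  refine (hasOrderAt_iff ht).mpr ⟨u, ⟨c, hc, hu⟩, ?_⟩
  rw [h1]
  split_ifs at h2 ⊢ <;> simp [h2]

lemma exists_hasOrderAt_poly {x y : F} (h : W.Nonsingular x y) {p : F[X]} (hp : p ≠ 0) :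
    ∃ m : ℕ, HasOrderAt (p.eval₂ (const W) (xFun W)) (.some x y h) m := by
  obtain ⟨q, hq, hd⟩ := exists_eq_pow_rootMultiplicity_mul_and_not_dvd p hp x
  rw [hq, eval₂_mul, eval₂_pow, eval₂_sub, eval₂_X, eval₂_C]
  have h1 : HasOrderAt (q.eval₂ (const W) (xFun W)) (.some x y h) 0 :=
    IsUnitAt.hasOrderAt ⟨q.eval x, fun h0 => hd (dvd_iff_isRoot.mpr h0),
      hasValueAt_poly_xFun (hasValueAt_xFun h) q⟩
  have h2 := ((hasOrderAt_xFun_sub h).pow (p.rootMultiplicity x)).mul h1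
  split_ifs at h2
  · exact ⟨p.rootMultiplicity x * 2, by simpa using h2⟩
  · exact ⟨p.rootMultiplicity x, by simpa using h2⟩

lemma exists_hasOrderAt_algebraMap_some {x y : F} (h : W.Nonsingular x y) {r : W.CoordinateRing}
    (hr : r ≠ 0) : ∃ k, HasOrderAt (algebraMap _ W.FunctionField r) (.some x y h) k := by
  obtain ⟨s, p, hp, hs⟩ := exists_mul_eq_mk_C hr
  obtain ⟨m, hm⟩ := exists_hasOrderAt_poly h hp
  refine exists_hasOrderAt_of_mul (isRegularAt_algebraMap h s) m (isRegularAt_algebraMap h r) ?_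
  rwa [← map_mul, hs, algebraMap_mk_C]

/-- p(x) is x to the power deg p times the reversed polynomial at 1/x. The latter takes the leading
coefficient of p as its value at O, because 1/x vanishes there. -/
lemma HasOrderAt.poly_zero {p : F[X]} (hp : p ≠ 0) :
    HasOrderAt (p.eval₂ (const W) (xFun W)) 0 (-(2 * p.natDegree : ℕ)) := by
  obtain ⟨hz, u, hu, hx, -⟩ := isUniformizerAt_zero (W := W)
  have hx0 := xFun_ne_zero (W := W)
  have hix : HasValueAt (xFun W)⁻¹ 0 0 := by
    rw [hx, mul_inv, ← zpow_neg]
    exact ((hz.1.pow 2).mul (hu.inv one_ne_zero)).congr (by simp)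
  let := invertibleOfNonzero hx0
  rw [← eval₂_reverse_mul_pow, invOf_eq_inv]
  have h1 : IsUnitAt (p.reverse.eval₂ (const W) (xFun W)⁻¹) 0 :=
    ⟨p.leadingCoeff, leadingCoeff_ne_zero.mpr hp, by
      simpa [← coeff_zero_eq_eval_zero, coeff_zero_reverse] using hasValueAt_poly_xFun hix p.reverse⟩
  have h2 : HasOrderAt (xFun W) 0 (-2) := (hasOrderAt_iff hz).mpr ⟨u, ⟨1, one_ne_zero, hu⟩, hx⟩
  convert h1.hasOrderAt.mul (h2.pow p.natDegree) using 1
  push_cast; ring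

lemma HasOrderAt.add_of_lt {f g : W.FunctionField} {P : W.Point} {k l : ℤ} (hf : HasOrderAt f P k)
    (hg : HasOrderAt g P l) (h : k < l) : HasOrderAt (f + g) P k := by
  obtain ⟨t, ht⟩ := exists_isUniformizerAt P
  obtain ⟨u, ⟨c, hc, hu⟩, rfl⟩ := (hasOrderAt_iff ht).mp hf
  obtain ⟨v, hv, rfl⟩ := (hasOrderAt_iff ht).mp hg
  obtain ⟨m, rfl⟩ : ∃ m : ℕ, l = k + (m + 1) := ⟨(l - k - 1).toNat, by omega⟩
  obtain ⟨d, -, hv⟩ := hv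
  refine (hasOrderAt_iff ht).mpr ⟨u + t ^ (m + 1) * v, ⟨c, hc, ?_⟩, ?_⟩
  · exact (hu.add ((ht.1.pow _).mul hv)).congr (by simp)
  · rw [zpow_add₀ ht.ne_zero]; norm_cast; ring

lemma HasOrderAt.algebraMap_zero {r : W.CoordinateRing} (hr : r ≠ 0) :
    HasOrderAt (algebraMap _ W.FunctionField r) 0 (-((Algebra.norm F[X] r).natDegree : ℕ)) := by
  obtain ⟨p, q, rfl⟩ := Affine.CoordinateRing.exists_smul_basis_eq r
  have hn := Affine.CoordinateRing.degree_norm_smul_basis (W' := W) p q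
  obtain ⟨hz, u, hu, -, hy⟩ := isUniformizerAt_zero (W := W)
  have h2 : HasOrderAt (yFun W) 0 (-3) := (hasOrderAt_iff hz).mpr ⟨u, ⟨1, one_ne_zero, hu⟩, hy⟩
  generalize hN : (Algebra.norm F[X] (p • (1 : W.CoordinateRing) +
    q • Affine.CoordinateRing.mk W Y)).natDegree = N
  rw [map_add, Affine.CoordinateRing.smul, Affine.CoordinateRing.smul, mul_one, map_mul,
    algebraMap_mk_C, algebraMap_mk_C]
  change HasOrderAt (_ + _ * yFun W) _ _
  by_cases hp : p = 0
  · have hq : q ≠ 0 := by rintro rfl; simp [hp] at hr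
    have : (Algebra.norm F[X] (p • (1 : W.CoordinateRing) +
        q • Affine.CoordinateRing.mk W Y)).natDegree = 2 * q.natDegree + 3 := by
      apply natDegree_eq_of_degree_eq_some
      rw [hn, hp, degree_zero, degree_eq_natDegree hq]; rfl
    rw [← hN, this, hp, eval₂_zero, zero_add]
    convert (HasOrderAt.poly_zero hq).mul h2 using 1
    push_cast; ring
  by_cases hq : q = 0
  · have : (Algebra.norm F[X] (p • (1 : W.CoordinateRing) +
        q • Affine.CoordinateRing.mk W Y)).natDegree = 2 * p.natDegree := by
      apply natDegree_eq_of_degree_eq_some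
      rw [hn, hq, degree_zero, degree_eq_natDegree hp]; rfl
    rw [← hN, this, hq, eval₂_zero, zero_mul, add_zero]
    exact HasOrderAt.poly_zero hp
  have : (Algebra.norm F[X] (p • (1 : W.CoordinateRing) +
      q • Affine.CoordinateRing.mk W Y)).natDegree =
      max (2 * p.natDegree) (2 * q.natDegree + 3) := by
    apply natDegree_eq_of_degree_eq_some
    rw [hn, degree_eq_natDegree hp, degree_eq_natDegree hq]; rfl
  rw [← hN, this]
  have hqy := (HasOrderAt.poly_zero hq).mul h2
  have hp' := HasOrderAt.poly_zero (W := W) hp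
  -- The pole orders of p(x) and q(x)y are even and odd respectively, so they never agree and no
  -- cancellation occurs.
  rcases lt_or_ge (2 * q.natDegree + 3) (2 * p.natDegree) with h | h
  · rw [max_eq_left h.le]
    exact hp'.add_of_lt hqy (by omega)
  · rw [max_eq_right h, add_comm]
    convert hqy.add_of_lt hp' (by omega) using 1
    push_cast; ring

/-- Every non-zero rational function has an order at each point. -/
lemma exists_hasOrderAt {f : W.FunctionField} (hf : f ≠ 0) (P : W.Point) :
    ∃ k, HasOrderAt f P k := by
  obtain ⟨a, b, hb, rfl⟩ := IsFractionRing.div_surjective (A := W.CoordinateRing) f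
  have hb0 : b ≠ 0 := nonZeroDivisors.ne_zero hb
  have ha0 : a ≠ 0 := by rintro rfl; simp at hf
  match P with
  | 0 =>
    exact ⟨_, div_eq_mul_inv _ (algebraMap _ W.FunctionField b) ▸
      (HasOrderAt.algebraMap_zero ha0).mul (HasOrderAt.algebraMap_zero hb0).inv⟩
  | .some x y h =>
    obtain ⟨k, hk⟩ := exists_hasOrderAt_algebraMap_some h ha0
    obtain ⟨l, hl⟩ := exists_hasOrderAt_algebraMap_some h hb0
    exact ⟨_, div_eq_mul_inv _ (algebraMap _ W.FunctionField b) ▸ hk.mul hl.inv⟩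

end Orders

end WeilPairing

namespace WeilPairing

variable {F : Type*} [Field F] {W : Affine F}

/-! ### The order function. -/

section Orders

/-- The order of a rational function at a point (with the convention `0` for the zero function). -/
noncomputable def ord (P : W.Point) (f : W.FunctionField) : ℤ :=
  open Classical in if h : ∃ k, HasOrderAt f P k then h.choose else 0

variable {f g : W.FunctionField} {P : W.Point}

lemma HasOrderAt.ord_eq {k : ℤ} (h : HasOrderAt f P k) : ord P f = k := by
  have h' : ∃ k, HasOrderAt f P k := ⟨k, h⟩
  rw [ord, dif_pos h']
  exact h'.choose_spec.unique h

lemma hasOrderAt_ord (hf : f ≠ 0) (P : W.Point) : HasOrderAt f P (ord P f) := by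
  obtain ⟨k, hk⟩ := exists_hasOrderAt hf P
  rwa [hk.ord_eq]

@[simp] lemma ord_zero : ord P (0 : W.FunctionField) = 0 :=
  dif_neg fun ⟨_, h⟩ => h.ne_zero rfl

lemma ord_mul (hf : f ≠ 0) (hg : g ≠ 0) : ord P (f * g) = ord P f + ord P g :=
  ((hasOrderAt_ord hf P).mul (hasOrderAt_ord hg P)).ord_eq

lemma ord_inv : ord P f⁻¹ = -ord P f := by
  by_cases hf : f = 0
  · simp [hf]
  · exact (hasOrderAt_ord hf P).inv.ord_eq

lemma ord_div (hf : f ≠ 0) (hg : g ≠ 0) : ord P (f / g) = ord P f - ord P g := by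
  rw [div_eq_mul_inv, ord_mul hf (inv_ne_zero hg), ord_inv, sub_eq_add_neg]

lemma ord_pow (n : ℕ) : ord P (f ^ n) = n * ord P f := by
  by_cases hf : f = 0
  · rcases n.eq_zero_or_pos with rfl | hn
    · simpa using (IsUnitAt.hasOrderAt ⟨1, one_ne_zero, HasValueAt.one P⟩).ord_eq
    · simp [hf, hn.ne']
  · exact ((hasOrderAt_ord hf P).pow n).ord_eq

lemma ord_zpow (n : ℤ) : ord P (f ^ n) = n * ord P f := by
  cases n with
  | ofNat n => simpa using ord_pow n
  | negSucc n => rw [zpow_negSucc, ord_inv, ord_pow, Int.negSucc_eq]; push_cast; ring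

lemma IsUnitAt.ord_eq (h : IsUnitAt f P) : ord P f = 0 := h.hasOrderAt.ord_eq

lemma HasValueAt.ord_eq {c : F} (h : HasValueAt f P c) (hc : c ≠ 0) : ord P f = 0 :=
  IsUnitAt.ord_eq ⟨c, hc, h⟩

@[simp] lemma ord_const (c : F) : ord P (const W c) = 0 := by
  by_cases hc : c = 0
  · simp [hc]
  · exact (HasValueAt.const P c).ord_eq hc

@[simp] lemma ord_one : ord P (1 : W.FunctionField) = 0 := (HasValueAt.one P).ord_eq one_ne_zero

@[simp] lemma ord_neg : ord P (-f) = ord P f := by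
  by_cases hf : f = 0
  · simp [hf]
  · rw [show -f = const W (-1) * f by simp, ord_mul (by simp) hf, ord_const, zero_add]

lemma isUnitAt_iff (hf : f ≠ 0) : IsUnitAt f P ↔ ord P f = 0 := by
  refine ⟨IsUnitAt.ord_eq, fun h => ?_⟩
  obtain ⟨t, u, ht, hu, h'⟩ := hasOrderAt_ord hf P
  rw [h, zpow_zero, one_mul] at h'
  rwa [h']

lemma HasValueAt.ord_pos (h : HasValueAt f P 0) (hf : f ≠ 0) : 0 < ord P f := by
  obtain ⟨t, u, ht, hu, h'⟩ := hasOrderAt_ord hf P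
  by_contra! hk
  obtain ⟨n, hn⟩ : ∃ n : ℕ, ord P f = -n := ⟨(-ord P f).toNat, by omega⟩
  obtain ⟨c, hc, hu⟩ := hu
  have : u = t ^ n * f := by
    rw [h', hn, zpow_neg, zpow_natCast]
    have := pow_ne_zero n ht.ne_zero
    field_simp
  exact hc (hu.unique (this ▸ ((ht.1.pow n).mul h).congr (mul_zero _)))

lemma hasValueAt_zero_of_ord_pos (h : 0 < ord P f) : HasValueAt f P 0 := by
  have hf : f ≠ 0 := by rintro rfl; simp at h
  obtain ⟨t, u, ht, ⟨c, hc, hu⟩, h'⟩ := hasOrderAt_ord hf P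
  obtain ⟨n, hn⟩ : ∃ n : ℕ, ord P f = n := ⟨(ord P f).toNat, by omega⟩
  rw [h', hn, zpow_natCast]
  exact ((ht.1.pow n).mul hu).congr (by rw [zero_pow (by omega), zero_mul])

lemma isRegularAt_of_ord_nonneg (h : 0 ≤ ord P f) : IsRegularAt f P := by
  by_cases hf : f = 0
  · exact hf ▸ (HasValueAt.zero P).isRegularAt
  rcases h.lt_or_eq with h | h
  · exact (hasValueAt_zero_of_ord_pos h).isRegularAt
  · exact ((isUnitAt_iff hf).mpr h.symm).isRegularAt

lemma IsRegularAt.ord_nonneg (h : IsRegularAt f P) : 0 ≤ ord P f := by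
  obtain ⟨c, hc⟩ := h
  by_cases h0 : c = 0
  · subst h0
    by_cases hf : f = 0
    · simp [hf]
    · exact (hc.ord_pos hf).le
  · exact (hc.ord_eq h0).ge

lemma isRegularAt_iff : IsRegularAt f P ↔ 0 ≤ ord P f :=
  ⟨IsRegularAt.ord_nonneg, isRegularAt_of_ord_nonneg⟩

lemma hasValueAt_inv_of_not_isRegularAt (h : ¬ IsRegularAt f P) : HasValueAt f⁻¹ P 0 := by
  refine hasValueAt_zero_of_ord_pos ?_
  rw [isRegularAt_iff] at h
  rw [ord_inv]; omega

lemma toMap_eq_toMap {P Q : W.Point} (h : ∀ c, HasValueAt f P c ↔ HasValueAt g Q c) :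
    toMap f P = toMap g Q := by
  have h' : IsRegularAt f P ↔ IsRegularAt g Q := exists_congr h
  by_cases hf : IsRegularAt f P
  · rw [toMap, toMap, if_pos hf, if_pos (h'.mp hf), value_eq ((h _).mpr (h'.mp hf).hasValueAt)]
  · rw [toMap, toMap, if_neg hf, if_neg (mt h'.mpr hf)]

lemma ord_zero_xFun : ord (0 : W.Point) (xFun W) = -2 := by
  obtain ⟨hz, u, hu, hx, -⟩ := isUniformizerAt_zero (W := W)
  exact ((hasOrderAt_iff hz).mpr ⟨u, ⟨1, one_ne_zero, hu⟩, hx⟩).ord_eq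

lemma ord_zero_yFun : ord (0 : W.Point) (yFun W) = -3 := by
  obtain ⟨hz, u, hu, -, hy⟩ := isUniformizerAt_zero (W := W)
  exact ((hasOrderAt_iff hz).mpr ⟨u, ⟨1, one_ne_zero, hu⟩, hy⟩).ord_eq

lemma ord_zero_chart : ord (0 : W.Point) (xFun W / yFun W) = 1 := by
  rw [ord_div xFun_ne_zero yFun_ne_zero, ord_zero_xFun, ord_zero_yFun]; rfl

end Orders

/-! ### Pulling back points along endomorphisms of the function field -/

section Pull

/-- `σ` maps the functions vanishing at `S` to functions vanishing at `P`. -/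
def IsPull (σ : W.FunctionField →+* W.FunctionField) (P S : W.Point) : Prop :=
  HasValueAt (σ (chart S).1) P 0 ∧ HasValueAt (σ (chart S).2) P 0

variable {σ τ : W.FunctionField →+* W.FunctionField} {P S : W.Point}

/-- A function regular at S is a quotient of polynomials in the chart coordinates at S, so it
suffices to know where `σ` sends these two. -/
lemma IsPull.hasValueAt (hσ : ∀ c, σ (const W c) = const W c) (h : IsPull σ P S)
    {f : W.FunctionField} {c : F} (hf : HasValueAt f S c) : HasValueAt (σ f) P c := by
  obtain ⟨A, B, hB, hAB, rfl⟩ := hasValueAt_iff.mp hf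
  have key : ∀ A, HasValueAt (σ (inChartHom S A)) P (A.evalEval 0 0) := fun A => by
    have h1 : σ.comp (inChartHom S) = eval₂RingHom (eval₂RingHom (const W) (σ (chart S).1))
        (σ (chart S).2) := by
      refine Polynomial.ringHom_ext' (Polynomial.ringHom_ext' ?_ ?_) ?_
      · ext c; simp [hσ]
      · simp
      · simp
    have h2 := HasValueAt.eval₂ h.1 h.2 A
    have h3 := congr($h1 A)
    rw [RingHom.comp_apply, coe_eval₂RingHom] at h3
    rwa [h3]
  have hB' := (key B)
  have h0 := hB'.ne_zero hB
  have : σ f = σ (inChartHom S A) / σ (inChartHom S B) := by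
    rw [eq_div_iff h0, ← map_mul, hAB]
  rw [this]
  exact (key A).div hB' hB

end Pull

end WeilPairing

namespace WeilPairing

variable {F : Type*} [Field F] {W : Affine F}

/-! ### The morphism of curves attached to an endomorphism of the function field, and its
ramification. -/

section Pull

lemma ord_uniformizer {t : W.FunctionField} {P : W.Point} (ht : IsUniformizerAt t P) : ord P t = 1 :=
  ((hasOrderAt_iff ht).mpr ⟨1, ⟨1, one_ne_zero, HasValueAt.one P⟩, by simp⟩).ord_eq

@[simp] lemma map_const (σ : W.FunctionField →ₐ[F] W.FunctionField) (c : F) :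
    σ (const W c) = const W c := σ.commutes c

lemma map_equation (σ : W.FunctionField →ₐ[F] W.FunctionField) :
    σ (yFun W) ^ 2 + const W W.a₁ * σ (xFun W) * σ (yFun W) + const W W.a₃ * σ (yFun W) =
    σ (xFun W) ^ 3 + const W W.a₂ * σ (xFun W) ^ 2 + const W W.a₄ * σ (xFun W) +
      const W W.a₆ := by
  simpa using congrArg σ (xFun_yFun_equation (W := W))

/-- The valuative criterion of properness by hand: the pair a = σ(x), b = σ(y) solves the
Weierstrass equation and has a limit at P on the projective curve. If a is regular at P, so is b,
and the limit is affine; otherwise the limit is O. -/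
lemma exists_isPull [W.IsElliptic] (σ : W.FunctionField →ₐ[F] W.FunctionField) (P : W.Point) :
    ∃ S, IsPull (σ : W.FunctionField →+* W.FunctionField) P S := by
  have key := map_equation σ
  have hb0 : σ (yFun W) ≠ 0 := (map_ne_zero σ).mpr yFun_ne_zero
  have ha0 : σ (xFun W) ≠ 0 := (map_ne_zero σ).mpr xFun_ne_zero
  have hx : ∀ S : W.Point, S = 0 → σ (chart S).1 = σ (xFun W) / σ (yFun W) := by
    rintro _ rfl; exact map_div₀ σ _ _
  have hy : ∀ S : W.Point, S = 0 → σ (chart S).2 = (σ (yFun W))⁻¹ := by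
    rintro _ rfl; change σ (1 / yFun W) = _; simp
  have hx' : ∀ (c d : F) (h : W.Nonsingular c d), σ (chart (.some c d h)).1 =
      σ (xFun W) - const W c := fun c d h => by
    change σ (xFun W - const W c) = _; simp
  have hy' : ∀ (c d : F) (h : W.Nonsingular c d), σ (chart (.some c d h)).2 =
      σ (yFun W) - const W d := fun c d h => by
    change σ (yFun W - const W d) = _; simp
  set a := σ (xFun W)
  set b := σ (yFun W)
  have hc := HasValueAt.const P (W := W)
  by_cases ha : IsRegularAt a P
  · obtain ⟨c, ha⟩ := ha
    have hb : IsRegularAt b P := by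
      by_contra hb
      replace hb := hasValueAt_inv_of_not_isRegularAt hb
      -- The equation divided by b²: if b had a pole, its value at P would be 1 = 0. The same device
      -- is used below after division by a³ and by z³.
      have h1 : 1 + (const W W.a₁ * a + const W W.a₃) * b⁻¹ =
          (a ^ 3 + const W W.a₂ * a ^ 2 + const W W.a₄ * a + const W W.a₆) * b⁻¹ ^ 2 := by
        field_simp
        linear_combination key
      have h2 := (HasValueAt.one P).add ((((hc W.a₁).mul ha).add (hc W.a₃)).mul hb)
      have h3 := ((((ha.pow 3).add ((hc W.a₂).mul (ha.pow 2))).add ((hc W.a₄).mul ha)).add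
        (hc W.a₆)).mul (hb.pow 2)
      rw [h1] at h2
      simpa using h2.unique h3
    obtain ⟨d, hb⟩ := hb
    have h2 := ((hb.pow 2).add (((hc W.a₁).mul ha).mul hb)).add ((hc W.a₃).mul hb)
    have h3 := (((ha.pow 3).add ((hc W.a₂).mul (ha.pow 2))).add ((hc W.a₄).mul ha)).add
        (hc W.a₆)
    rw [key] at h2
    have hE : W.Equation c d := (Affine.equation_iff ..).mpr (h2.unique h3)
    refine ⟨.some c d (Affine.equation_iff_nonsingular.mp hE), ?_, ?_⟩
    · exact (hx' ..).symm ▸ (ha.sub (hc c)).congr (sub_self c)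
    · exact (hy' ..).symm ▸ (hb.sub (hc d)).congr (sub_self d)
  · replace ha := hasValueAt_inv_of_not_isRegularAt ha
    have hb : HasValueAt b⁻¹ P 0 := by
      by_cases hb : IsRegularAt b P
      · obtain ⟨d, hb⟩ := hb
        have h1 : b ^ 2 * a⁻¹ ^ 3 + const W W.a₁ * b * a⁻¹ ^ 2 + const W W.a₃ * b * a⁻¹ ^ 3 =
            1 + const W W.a₂ * a⁻¹ + const W W.a₄ * a⁻¹ ^ 2 + const W W.a₆ * a⁻¹ ^ 3 := by
          field_simp
          linear_combination key
        have h2 := (((hb.pow 2).mul (ha.pow 3)).add (((hc W.a₁).mul hb).mul (ha.pow 2))).add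
          (((hc W.a₃).mul hb).mul (ha.pow 3))
        have h3 := (((HasValueAt.one P).add ((hc W.a₂).mul ha)).add
          ((hc W.a₄).mul (ha.pow 2))).add ((hc W.a₆).mul (ha.pow 3))
        rw [h1] at h2
        simpa using h2.unique h3
      · exact hasValueAt_inv_of_not_isRegularAt hb
    -- In the chart at infinity the equation is monic in z = a/b with coefficients that vanish with
    -- w = 1/b. So z is regular, and its value is a root of ζ³ = 0.
    have hw : b⁻¹ + const W W.a₁ * (a / b) * b⁻¹ + const W W.a₃ * b⁻¹ ^ 2 = (a / b) ^ 3 +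
        const W W.a₂ * (a / b) ^ 2 * b⁻¹ + const W W.a₄ * (a / b) * b⁻¹ ^ 2 +
          const W W.a₆ * b⁻¹ ^ 3 := by
      field_simp
      linear_combination key
    have hz0 : a / b ≠ 0 := div_ne_zero ha0 hb0
    set z := a / b
    set w := b⁻¹
    have hz : IsRegularAt z P := by
      by_contra hz
      replace hz := hasValueAt_inv_of_not_isRegularAt hz
      have h1 : w * z⁻¹ ^ 3 + const W W.a₁ * w * z⁻¹ ^ 2 + const W W.a₃ * w ^ 2 * z⁻¹ ^ 3 =
          1 + const W W.a₂ * w * z⁻¹ + const W W.a₄ * w ^ 2 * z⁻¹ ^ 2 +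
            const W W.a₆ * w ^ 3 * z⁻¹ ^ 3 := by
        field_simp
        linear_combination hw
      have h2 := ((hb.mul (hz.pow 3)).add (((hc W.a₁).mul hb).mul (hz.pow 2))).add
          (((hc W.a₃).mul (hb.pow 2)).mul (hz.pow 3))
      have h3 := (((HasValueAt.one P).add (((hc W.a₂).mul hb).mul hz)).add
          (((hc W.a₄).mul (hb.pow 2)).mul (hz.pow 2))).add
            (((hc W.a₆).mul (hb.pow 3)).mul (hz.pow 3))
      rw [h1] at h2
      simpa using h2.unique h3
    obtain ⟨ζ, hz⟩ := hz
    have h2 := (hb.add (((hc W.a₁).mul hz).mul hb)).add ((hc W.a₃).mul (hb.pow 2))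
    have h3 := (((hz.pow 3).add (((hc W.a₂).mul (hz.pow 2)).mul hb)).add
      (((hc W.a₄).mul hz).mul (hb.pow 2))).add ((hc W.a₆).mul (hb.pow 3))
    rw [hw] at h2
    have : ζ = 0 := by simpa using h3.unique h2
    refine ⟨0, ?_, ?_⟩
    · exact (hx 0 rfl).symm ▸ this ▸ hz
    · exact (hy 0 rfl).symm ▸ hb

lemma IsPull.unique {σ : W.FunctionField →ₐ[F] W.FunctionField} {P S S' : W.Point}
    (h : IsPull (σ : W.FunctionField →+* W.FunctionField) P S)
    (h' : IsPull (σ : W.FunctionField →+* W.FunctionField) P S') : S = S' := by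
  have hσ : ∀ c, (σ : W.FunctionField →+* W.FunctionField) (const W c) = const W c :=
    fun c => map_const σ c
  have hy0 := (map_ne_zero σ).mpr (yFun_ne_zero (W := W))
  have key : ∀ x y (hxy : W.Nonsingular x y), IsPull (σ : W.FunctionField →+* W.FunctionField) P
      (.some x y hxy) → ¬ IsPull (σ : W.FunctionField →+* W.FunctionField) P 0 := by
    intro x y hxy h h'
    have h1 := h.hasValueAt hσ (hasValueAt_yFun hxy)
    have h2 := h'.2
    change HasValueAt (σ (1 / yFun W)) P 0 at h2
    rw [map_div₀, map_one] at h2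
    have h3 := h1.mul h2
    rw [RingHom.coe_coe, mul_one_div_cancel hy0] at h3
    simpa using h3.unique (HasValueAt.one P)
  match S, S', h, h' with
  | 0, 0, _, _ => rfl
  | .some x y hxy, 0, h, h' => exact absurd h' (key x y hxy h)
  | 0, .some x y hxy, h, h' => exact absurd h (key x y hxy h')
  | .some x y hxy, .some x' y' hxy', h, h' =>
    have h1 := (h.hasValueAt hσ (hasValueAt_xFun hxy)).unique
      (h'.hasValueAt hσ (hasValueAt_xFun hxy'))
    have h2 := (h.hasValueAt hσ (hasValueAt_yFun hxy)).unique
      (h'.hasValueAt hσ (hasValueAt_yFun hxy'))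
    subst h1 h2
    rfl

variable [W.IsElliptic]

/-- The image of the point `P` under the morphism of curves given by `σ`. -/
noncomputable def pull (σ : W.FunctionField →ₐ[F] W.FunctionField) (P : W.Point) : W.Point :=
  (exists_isPull σ P).choose

variable (σ τ : W.FunctionField →ₐ[F] W.FunctionField) {P : W.Point}

lemma isPull_pull : IsPull (σ : W.FunctionField →+* W.FunctionField) P (pull σ P) :=
  (exists_isPull σ P).choose_spec

variable {σ} in
lemma IsPull.pull_eq {S : W.Point} (h : IsPull (σ : W.FunctionField →+* W.FunctionField) P S) :
    pull σ P = S := (isPull_pull σ).unique h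

variable {σ} in
lemma HasValueAt.map {f : W.FunctionField} {c : F} (h : HasValueAt f (pull σ P) c) :
    HasValueAt (σ f) P c := (isPull_pull σ).hasValueAt (map_const σ) h

lemma hasValueAt_map_iff {f : W.FunctionField} {c : F} :
    HasValueAt (σ f) P c ↔ HasValueAt f (pull σ P) c := by
  refine ⟨fun h => ?_, fun h => h.map⟩
  have hf : IsRegularAt f (pull σ P) := by
    by_contra hf
    have h0 : f ≠ 0 := by rintro rfl; exact hf (HasValueAt.zero _).isRegularAt
    -- If f had a pole at the image point, σ(f)·σ(1/f) = 1 would take the value 0 at P.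
    have h1 := h.mul (hasValueAt_inv_of_not_isRegularAt hf).map
    rw [← map_mul, mul_inv_cancel₀ h0, map_one] at h1
    simpa using h1.unique (HasValueAt.one P)
  obtain ⟨d, hd⟩ := hf
  rwa [h.unique hd.map]

lemma pull_comp (P : W.Point) : pull (σ.comp τ) P = pull τ (pull σ P) :=
  IsPull.pull_eq ⟨(isPull_pull τ).1.map, (isPull_pull τ).2.map⟩

lemma pull_id (P : W.Point) : pull (AlgHom.id F W.FunctionField) P = P :=
  IsPull.pull_eq ⟨HasValueAt.chart_fst P, HasValueAt.chart_snd P⟩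

/-- The ramification index at `P` of the morphism of curves given by `σ`. -/
noncomputable def ram (P : W.Point) : ℤ := ord P (σ (exists_isUniformizerAt (pull σ P)).choose)

lemma ram_pos : 0 < ram σ P := by
  have h := (exists_isUniformizerAt (pull σ P)).choose_spec
  exact h.1.map.ord_pos ((map_ne_zero σ).mpr h.ne_zero)

lemma ord_map (f : W.FunctionField) : ord P (σ f) = ram σ P * ord (pull σ P) f := by
  by_cases hf : f = 0
  · simp [hf]
  have h := (exists_isUniformizerAt (pull σ P)).choose_spec
  obtain ⟨u, ⟨c, hc, hu⟩, h'⟩ := (hasOrderAt_iff h).mp (hasOrderAt_ord hf (pull σ P))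
  conv_lhs => rw [h', map_mul, map_zpow₀]
  rw [ord_mul (zpow_ne_zero _ ((map_ne_zero σ).mpr h.ne_zero)) (hu.map.ne_zero hc), ord_zpow,
    hu.map.ord_eq hc, add_zero, mul_comm, ram]

lemma ram_comp (P : W.Point) : ram (σ.comp τ) P = ram σ P * ram τ (pull σ P) := by
  obtain ⟨t, ht⟩ := exists_isUniformizerAt (pull (σ.comp τ) P)
  have h := ord_map (P := P) (σ.comp τ) t
  rw [ord_uniformizer ht, mul_one, AlgHom.comp_apply, ord_map, ord_map, ← pull_comp,
    ord_uniformizer ht, mul_one] at h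
  exact h.symm

lemma ram_id (P : W.Point) : ram (AlgHom.id F W.FunctionField) P = 1 := by
  obtain ⟨t, ht⟩ := exists_isUniformizerAt P
  have h := ord_map (P := P) (AlgHom.id F W.FunctionField) t
  rw [pull_id, ord_uniformizer ht, mul_one, AlgHom.id_apply, ord_uniformizer ht] at h
  exact h.symm

/-- Ramification indices are positive integers and multiply under composition. -/
lemma ram_eq_one_of_comp {σ τ : W.FunctionField →ₐ[F] W.FunctionField}
    (h : σ.comp τ = AlgHom.id F W.FunctionField) (P : W.Point) : ram σ P = 1 := by
  have := ram_comp σ τ P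
  rw [h, ram_id] at this
  exact Int.eq_one_or_neg_one_of_mul_eq_one this.symm |>.resolve_right
    (by have := ram_pos σ (P := P); omega)

end Pull

/-! ### Evaluation at points over the function field -/

section Eval

lemma algHom_ext {σ τ : W.FunctionField →ₐ[F] W.FunctionField} (hx : σ (xFun W) = τ (xFun W))
    (hy : σ (yFun W) = τ (yFun W)) : σ = τ := by
  have h : ((σ : W.FunctionField →+* W.FunctionField).comp
      (algebraMap W.CoordinateRing W.FunctionField)).comp (Affine.CoordinateRing.mk W) =
      ((τ : W.FunctionField →+* W.FunctionField).comp
      (algebraMap W.CoordinateRing W.FunctionField)).comp (Affine.CoordinateRing.mk W) := by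
    refine Polynomial.ringHom_ext' (Polynomial.ringHom_ext' ?_ ?_) ?_
    · ext c
      exact (map_const σ c).trans (map_const τ c).symm
    · exact hx
    · exact hy
  refine AlgHom.ext fun f => ?_
  obtain ⟨a, b, hb, rfl⟩ := IsFractionRing.div_surjective (A := W.CoordinateRing) f
  obtain ⟨a, rfl⟩ := AdjoinRoot.mk_surjective a
  obtain ⟨b, rfl⟩ := AdjoinRoot.mk_surjective b
  rw [map_div₀, map_div₀]
  exact congrArg₂ (· / ·) congr($h a) congr($h b)

/-- An element of the function field that is not constant is transcendental. -/
lemma eval₂_ne_zero [IsAlgClosed F] {a : W.FunctionField} (ha : ∀ c, a ≠ const W c) {p : F[X]}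
    (hp : p ≠ 0) : p.eval₂ (const W) a ≠ 0 := by
  rw [(IsAlgClosed.splits p).eq_prod_roots, eval₂_mul, eval₂_C, eval₂_multiset_prod]
  refine mul_ne_zero ((_root_.map_ne_zero _).mpr (leadingCoeff_ne_zero.mpr hp)) ?_
  rw [Ne, Multiset.prod_eq_zero_iff]
  simp only [Multiset.map_map, Multiset.mem_map, not_exists, not_and, Function.comp_apply,
    eval₂_sub, eval₂_X, eval₂_C, sub_eq_zero]
  exact fun c _ => ha c

/-- A non-constant solution of the Weierstrass equation is a dominant rational map from the curve to
itself. Injectivity on the coordinate ring: an element of the kernel divides its norm p(X), but p(a)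
≠ 0 since a is transcendental. -/
lemma exists_algHom [IsAlgClosed F] {a b : W.FunctionField} (ha : ∀ c, a ≠ const W c)
    (h : b ^ 2 + const W W.a₁ * a * b + const W W.a₃ * b =
      a ^ 3 + const W W.a₂ * a ^ 2 + const W W.a₄ * a + const W W.a₆) :
    ∃ σ : W.FunctionField →ₐ[F] W.FunctionField, σ (xFun W) = a ∧ σ (yFun W) = b := by
  let i : F[X] →+* W.FunctionField := eval₂RingHom (const W) a
  let φ : W.CoordinateRing →+* W.FunctionField := AdjoinRoot.lift i b (by
    simp only [Affine.polynomial, i, eval₂_sub, eval₂_add, eval₂_mul, eval₂_pow, eval₂_X, eval₂_C,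
      coe_eval₂RingHom]
    linear_combination h)
  have hφ : ∀ c, φ (algebraMap F _ c) = const W c := fun c => by
    simp only [φ, algebraMap_coordinateRing, AdjoinRoot.lift_mk]
    simp [i]
  let φ' : W.CoordinateRing →ₐ[F] W.FunctionField := { φ with commutes' := hφ }
  have hinj : Function.Injective φ' := by
    rw [injective_iff_map_eq_zero]
    intro r hr
    by_contra h0
    obtain ⟨s, p, hp, hs⟩ := exists_mul_eq_mk_C h0
    have h1 : φ (Affine.CoordinateRing.mk W (C p)) = p.eval₂ (const W) a := by
      simp only [φ, AdjoinRoot.lift_mk]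
      simp [i]
    refine eval₂_ne_zero ha hp ?_
    rw [← h1, ← hs, map_mul]
    exact mul_eq_zero_of_left hr _
  refine ⟨IsFractionRing.liftAlgHom (K := W.FunctionField) hinj, ?_, ?_⟩
  · rw [xFun, IsFractionRing.liftAlgHom_apply, IsFractionRing.lift_algebraMap]
    change φ (Affine.CoordinateRing.mk W (C X)) = a
    simp only [φ, AdjoinRoot.lift_mk]
    simp [i]
  · rw [yFun, IsFractionRing.liftAlgHom_apply, IsFractionRing.lift_algebraMap]
    change φ (Affine.CoordinateRing.mk W Y) = b
    simp only [φ, AdjoinRoot.lift_mk]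
    simp

end Eval

end WeilPairing

namespace WeilPairing

variable {F : Type*} [Field F] {W : Affine F}

/-! ### Divisors of functions -/

/-! ### Negation as the conjugation of the function field over F(x). -/

section Negation

variable [IsAlgClosed F]

lemma exists_negHom : ∃ σ : W.FunctionField →ₐ[F] W.FunctionField, σ (xFun W) = xFun W ∧
    σ (yFun W) = -yFun W - const W W.a₁ * xFun W - const W W.a₃ :=
  exists_algHom xFun_ne_const (by linear_combination xFun_yFun_equation (W := W))

variable (W) in
/-- The automorphism of the function field given by the negation on the curve. -/
noncomputable def negHom : W.FunctionField →ₐ[F] W.FunctionField := (exists_negHom (W := W)).choose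

@[simp] lemma negHom_xFun : negHom W (xFun W) = xFun W := exists_negHom.choose_spec.1

@[simp] lemma negHom_yFun :
    negHom W (yFun W) = -yFun W - const W W.a₁ * xFun W - const W W.a₃ :=
  exists_negHom.choose_spec.2

lemma negHom_comp_negHom : (negHom W).comp (negHom W) = AlgHom.id F W.FunctionField :=
  algHom_ext (by simp) (by simp; ring)

variable [W.IsElliptic]

lemma pull_negHom (P : W.Point) : pull (negHom W) P = -P := by
  refine IsPull.pull_eq ?_
  match P with
  | 0 =>
    have hz := HasValueAt.chart_fst (0 : W.Point)
    have hw := HasValueAt.chart_snd (0 : W.Point)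
    change HasValueAt (xFun W / yFun W) _ _ at hz
    change HasValueAt (1 / yFun W) _ _ at hw
    have hc := HasValueAt.const (0 : W.Point)
    have hy := yFun_ne_zero (W := W)
    have hg := (((HasValueAt.one 0).neg.sub ((hc W.a₁).mul hz)).sub ((hc W.a₃).mul hw)).congr
      (show _ = -1 by ring)
    have hg0 := hg.ne_zero (by simp)
    -- Pulling out y leaves a factor with value -1 at O, so both coordinates of the chart at
    -- infinity still vanish after negation.
    have h1 : -yFun W - const W W.a₁ * xFun W - const W W.a₃ =
        yFun W * (-1 - const W W.a₁ * (xFun W / yFun W) - const W W.a₃ * (1 / yFun W)) := by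
      field_simp
    constructor
    · change HasValueAt (negHom W (xFun W / yFun W)) 0 0
      rw [map_div₀, negHom_xFun, negHom_yFun, h1, ← div_div]
      exact (hz.div hg (by simp)).congr (by simp)
    · change HasValueAt (negHom W (1 / yFun W)) 0 0
      rw [map_div₀, map_one, negHom_yFun, h1, ← div_div]
      exact (hw.div hg (by simp)).congr (by simp)
  | .some x y h =>
    have hc := HasValueAt.const (.some x y h)
    have hx := hasValueAt_xFun h
    have hy := hasValueAt_yFun h
    constructor
    · change HasValueAt (negHom W (xFun W - const W x)) _ 0
      rw [map_sub, negHom_xFun, map_const]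
      exact (hx.sub (hc x)).congr (sub_self x)
    · change HasValueAt (negHom W (yFun W - const W (W.negY x y))) _ 0
      rw [map_sub, negHom_yFun, map_const]
      exact (((hy.neg.sub ((hc _).mul hx)).sub (hc _)).sub (hc _)).congr (by
        rw [Affine.negY]; ring)

lemma ord_negHom (P : W.Point) (f : W.FunctionField) : ord P (negHom W f) = ord (-P) f := by
  rw [ord_map, ram_eq_one_of_comp negHom_comp_negHom, one_mul, pull_negHom]

omit [W.IsElliptic] in
-- The polynomial is the norm of r. On divisors it relates div r and its mirror image under negation
-- to the divisor of a polynomial in x.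
lemma exists_mul_negHom_eq {r : W.CoordinateRing} (hr : r ≠ 0) : ∃ p : F[X], p ≠ 0 ∧
    algebraMap _ W.FunctionField r * negHom W (algebraMap _ W.FunctionField r) =
      p.eval₂ (const W) (xFun W) := by
  obtain ⟨p, q, rfl⟩ := Affine.CoordinateRing.exists_smul_basis_eq r
  have h := congrArg (algebraMap _ W.FunctionField)
    (Affine.CoordinateRing.coe_norm_smul_basis (W' := W) p q)
  refine ⟨_, Algebra.norm_ne_zero_iff.mpr hr, ?_⟩
  have hp : ∀ p : F[X], negHom W (p.eval₂ (const W) (xFun W)) = p.eval₂ (const W) (xFun W) := by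
    intro p
    have := p.hom_eval₂ (const W) (negHom W : W.FunctionField →+* W.FunctionField) (xFun W)
    rw [RingHom.coe_coe] at this
    rw [this, negHom_xFun]
    congr 1
    ext c
    exact map_const _ c
  rw [← algebraMap_mk_C]
  refine Eq.trans ?_ h.symm
  rw [map_add, Affine.CoordinateRing.smul, Affine.CoordinateRing.smul, mul_one, map_mul,
    algebraMap_mk_C, algebraMap_mk_C]
  change (_ + _ * yFun W) * negHom W (_ + _ * yFun W) = _
  rw [map_add, map_mul, hp, hp, negHom_yFun, algebraMap_mk]
  simp only [eval₂_sub, eval₂_add, eval₂_mul, eval₂_neg, eval₂_X, eval₂_C, coe_eval₂RingHom]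
  ring

end Negation

/-! ### Divisors of functions and their degree. -/

section Divisors

lemma finite_setOf_x_eq (c : F) : {P : W.Point | ∃ y h, P = .some c y h}.Finite := by
  by_cases h : ∃ y, W.Nonsingular c y
  · obtain ⟨y, h⟩ := h
    refine (Set.toFinite {.some c y h, -.some c y h}).subset ?_
    rintro _ ⟨y', h', rfl⟩
    exact Affine.Point.X_eq_iff.mp rfl
  · refine Set.finite_empty.subset ?_
    rintro _ ⟨y', h', rfl⟩
    exact h ⟨y', h'⟩

variable [IsAlgClosed F] [W.IsElliptic]

/-- Both factors of r·(r ∘ [-1]) = p(x) are regular at affine points, so the affine zeros of r lie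
over the finitely many roots of p. -/
lemma finite_support_algebraMap {r : W.CoordinateRing} (hr : r ≠ 0) :
    {P : W.Point | ord P (algebraMap _ W.FunctionField r) ≠ 0}.Finite := by
  classical
  obtain ⟨p, hp, h⟩ := exists_mul_negHom_eq hr
  refine ((Set.finite_singleton 0).union (p.roots.toFinset.finite_toSet.biUnion
    fun c _ => finite_setOf_x_eq (W := W) c)).subset fun P hP => ?_
  match P, hP with
  | 0, _ => exact .inl rfl
  | .some x y hxy, hP =>
    right
    simp only [Set.mem_iUnion]
    refine ⟨x, ?_, y, hxy, rfl⟩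
    rw [Finset.mem_coe, Multiset.mem_toFinset, mem_roots hp, IsRoot.def]
    by_contra h0
    apply hP
    have h1 := (hasValueAt_poly_xFun (hasValueAt_xFun hxy) p).ord_eq h0
    have hr' : algebraMap _ W.FunctionField r ≠ 0 := by
      rwa [Ne, map_eq_zero_iff _ (IsFractionRing.injective _ _)]
    rw [← h, ord_mul hr' ((_root_.map_ne_zero _).mpr hr'), ord_negHom] at h1
    have h2 := (isRegularAt_algebraMap hxy r).ord_nonneg
    have h3 : 0 ≤ ord (-(.some x y hxy)) (algebraMap _ W.FunctionField r) :=
      (isRegularAt_algebraMap _ r).ord_nonneg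
    omega

lemma finite_support_ord (f : W.FunctionField) : (Function.support fun P => ord P f).Finite := by
  by_cases hf : f = 0
  · simp [hf]
  obtain ⟨a, b, hb, rfl⟩ := IsFractionRing.div_surjective (A := W.CoordinateRing) f
  have hb0 : b ≠ 0 := nonZeroDivisors.ne_zero hb
  have ha0 : a ≠ 0 := by rintro rfl; simp at hf
  refine ((finite_support_algebraMap ha0).union (finite_support_algebraMap hb0)).subset
    fun P hP => ?_
  rw [Function.mem_support, ord_div] at hP
  · by_contra! h
    rw [Set.mem_union, not_or] at h
    simp only [Set.mem_ofPred_eq, not_not] at h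
    omega
  all_goals rwa [Ne, map_eq_zero_iff _ (IsFractionRing.injective _ _)]

/-- The divisor of a rational function (with the convention `0` for the zero function). -/
noncomputable def divOf (f : W.FunctionField) : Divisor W :=
  Finsupp.ofSupportFinite (fun P => ord P f) (finite_support_ord f)

@[simp] lemma divOf_apply (f : W.FunctionField) (P : W.Point) : divOf f P = ord P f := rfl

variable {f g : W.FunctionField}

lemma divOf_mul (hf : f ≠ 0) (hg : g ≠ 0) : divOf (f * g) = divOf f + divOf g := by
  ext P; simp [ord_mul hf hg]

lemma divOf_inv : divOf f⁻¹ = -divOf f := by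
  ext P; simp [ord_inv]

lemma divOf_div (hf : f ≠ 0) (hg : g ≠ 0) : divOf (f / g) = divOf f - divOf g := by
  ext P; simp [ord_div hf hg]

lemma divOf_pow (n : ℕ) : divOf (f ^ n) = n • divOf f := by
  ext P; simp [ord_pow]

@[simp] lemma divOf_const (c : F) : divOf (const W c) = 0 := by
  ext P; simp

lemma hasDivisor_iff {D : Divisor W} : HasDivisor f D ↔ f ≠ 0 ∧ divOf f = D := by
  refine ⟨fun h => ⟨(h 0).ne_zero, ?_⟩, ?_⟩
  · ext P; exact (h P).ord_eq
  · rintro ⟨hf, rfl⟩ P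
    exact hasOrderAt_ord hf P

/-- The degree of a divisor. -/
noncomputable def deg : Divisor W →+ ℤ := Finsupp.liftAddHom fun _ => AddMonoidHom.id ℤ

omit [IsAlgClosed F] [W.IsElliptic] in
@[simp] lemma deg_pt (P : W.Point) : deg (pt P) = 1 := by simp [deg, pt]

omit [IsAlgClosed F] [W.IsElliptic] in
lemma deg_eq_sum (D : Divisor W) : deg D = ∑ P ∈ D.support, D P := by
  simp [deg, Finsupp.sum]

/-- The sum of a divisor in the group of points. -/
noncomputable def pointSum [DecidableEq F] : Divisor W →+ W.Point :=
  Finsupp.liftAddHom fun P => zmultiplesHom W.Point P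

omit [IsAlgClosed F] [W.IsElliptic] in
@[simp] lemma pointSum_pt [DecidableEq F] (P : W.Point) : pointSum (pt P) = P := by simp [pointSum, pt]

lemma divOf_negHom (f : W.FunctionField) :
    divOf (negHom W f) = (divOf f).mapDomain (fun P => -P) := by
  ext P
  conv_rhs => rw [← neg_neg P]
  rw [Finsupp.mapDomain_apply neg_injective, divOf_apply, divOf_apply, ord_negHom]

omit [IsAlgClosed F] [W.IsElliptic] in
lemma deg_mapDomain (φ : W.Point → W.Point) (D : Divisor W) : deg (D.mapDomain φ) = deg D := by
  simp only [deg, Finsupp.liftAddHom_apply]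
  exact Finsupp.sum_mapDomain_index (by simp) (by simp)

omit [IsAlgClosed F] [W.IsElliptic] in
lemma neg_eq_self_iff {x y : F} (h : W.Nonsingular x y) :
    -(.some x y h : W.Point) = .some x y h ↔ 2 * y + W.a₁ * x + W.a₃ = 0 := by
  rw [Affine.Point.neg_some, Affine.Point.some.injEq, Affine.negY]
  constructor
  · rintro ⟨-, h⟩; linear_combination -h
  · intro h; exact ⟨rfl, by linear_combination -h⟩

/-- The only affine points with abscissa x are the given one and its negative. They coincide exactly
when 2y + a₁x + a₃ = 0, which is when x-coordinate minus x has a double zero. -/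
lemma divOf_xFun_sub {x y : F} (h : W.Nonsingular x y) : divOf (xFun W - const W x) =
    pt (.some x y h) + pt (-.some x y h) - (2 : ℤ) • pt 0 := by
  classical
  ext P
  simp only [divOf_apply, pt, Finsupp.sub_apply, Finsupp.add_apply, Finsupp.smul_apply,
    Finsupp.single_apply]
  match P with
  | 0 =>
    have h0 : -(.some x y h : W.Point) ≠ 0 := Affine.Point.some_ne_zero _
    rw [if_neg (Affine.Point.some_ne_zero h), if_neg h0, if_pos rfl]
    have hx : HasOrderAt (xFun W) 0 (-2) := ord_zero_xFun (W := W) ▸ hasOrderAt_ord xFun_ne_zero 0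
    by_cases h0 : x = 0
    · rw [h0, map_zero, sub_zero, ord_zero_xFun]; rfl
    · have := hx.add_of_lt (IsUnitAt.hasOrderAt ⟨-x, neg_ne_zero.mpr h0, HasValueAt.const 0 (-x)⟩)
        (by norm_num)
      rw [map_neg, ← sub_eq_add_neg] at this
      rw [this.ord_eq]; rfl
  | .some x' y' h' =>
    rw [if_neg (Affine.Point.some_ne_zero h').symm, smul_zero, sub_zero]
    by_cases hx : x' = x
    · subst hx
      have h1 := (hasOrderAt_xFun_sub h').ord_eq
      have h2 := neg_eq_self_iff h'
      have h3 : (Affine.Point.some x' y h) = .some x' y' h' ∨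
          (Affine.Point.some x' y h) = -.some x' y' h' := Affine.Point.X_eq_iff.mp rfl
      rw [h1]
      rcases h3 with h3 | h3
      · rw [h3, if_pos rfl]
        by_cases h4 : 2 * y' + W.a₁ * x' + W.a₃ = 0
        · rw [if_pos h4, if_pos (h2.mpr h4)]; rfl
        · rw [if_neg h4, if_neg (mt h2.mp h4)]; rfl
      · rw [h3, neg_neg, if_pos rfl]
        by_cases h4 : 2 * y' + W.a₁ * x' + W.a₃ = 0
        · rw [if_pos h4, if_pos (h2.mpr h4)]; rfl
        · rw [if_neg h4, if_neg (mt h2.mp h4)]; rfl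
    · have h1 := (((hasValueAt_xFun h').sub (HasValueAt.const _ x)).ord_eq (sub_ne_zero.mpr hx))
      rw [h1, if_neg, if_neg]
      · rfl
      · rw [Affine.Point.neg_some, Affine.Point.some.injEq]
        rintro ⟨rfl, -⟩; exact hx rfl
      · rw [Affine.Point.some.injEq]
        rintro ⟨rfl, -⟩; exact hx rfl

lemma exists_point_of_x (x : F) : ∃ y, W.Nonsingular x y := by
  obtain ⟨y, hy⟩ := IsAlgClosed.exists_root (X ^ 2 + C (W.a₁ * x + W.a₃) * X -
    C (x ^ 3 + W.a₂ * x ^ 2 + W.a₄ * x + W.a₆)) (by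
      have : (X ^ 2 + C (W.a₁ * x + W.a₃) * X -
        C (x ^ 3 + W.a₂ * x ^ 2 + W.a₄ * x + W.a₆)).natDegree = 2 := by compute_degree!
      intro h
      rw [natDegree_eq_of_degree_eq_some h] at this
      exact absurd this (by norm_num))
  refine ⟨y, Affine.equation_iff_nonsingular.mp ((Affine.equation_iff ..).mpr ?_)⟩
  simp only [IsRoot.def, eval_sub, eval_add, eval_pow, eval_X, eval_mul, eval_C] at hy
  linear_combination hy

lemma deg_divOf_xFun_sub (x : F) : deg (divOf (xFun W - const W x)) = 0 := by
  obtain ⟨y, h⟩ := exists_point_of_x (W := W) x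
  rw [divOf_xFun_sub h, map_sub, map_add, map_zsmul, deg_pt, deg_pt, deg_pt]; rfl

lemma deg_divOf_poly (p : F[X]) : deg (divOf (p.eval₂ (const W) (xFun W))) = 0 := by
  rw [(IsAlgClosed.splits p).eq_prod_roots, eval₂_mul, eval₂_C, eval₂_multiset_prod,
    Multiset.map_map]
  by_cases hp : p.leadingCoeff = 0
  · rw [hp, map_zero, zero_mul, ← map_zero (const W), divOf_const, map_zero]
  have key : ∀ s : Multiset F, (s.map (eval₂ (const W) (xFun W) ∘ fun c => X - C c)).prod ≠ 0 ∧
      deg (divOf (s.map (eval₂ (const W) (xFun W) ∘ fun c => X - C c)).prod) = 0 := by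
    intro s
    induction s using Multiset.induction with
    | empty =>
      rw [Multiset.map_zero, Multiset.prod_zero, ← map_one (const W), divOf_const]
      exact ⟨by simp, map_zero _⟩
    | cons c s ih =>
      have h0 : xFun W - const W c ≠ 0 := sub_ne_zero.mpr (xFun_ne_const c)
      simp only [Multiset.map_cons, Multiset.prod_cons, Function.comp_apply, eval₂_sub, eval₂_X,
        eval₂_C] at ih ⊢
      refine ⟨mul_ne_zero h0 ih.1, ?_⟩
      rw [divOf_mul h0 ih.1, map_add, deg_divOf_xFun_sub, ih.2, add_zero]
  rw [divOf_mul ((_root_.map_ne_zero _).mpr hp) (key _).1, map_add, divOf_const, map_zero,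
    (key _).2, add_zero]

/-- Principal divisors have degree zero. -/
theorem deg_divOf (f : W.FunctionField) : deg (divOf f) = 0 := by
  by_cases hf : f = 0
  · rw [hf, ← map_zero (const W), divOf_const, map_zero]
  obtain ⟨a, b, hb, rfl⟩ := IsFractionRing.div_surjective (A := W.CoordinateRing) f
  have hb0 : b ≠ 0 := nonZeroDivisors.ne_zero hb
  have ha0 : a ≠ 0 := by rintro rfl; simp at hf
  have key : ∀ r : W.CoordinateRing, r ≠ 0 → deg (divOf (algebraMap _ W.FunctionField r)) = 0 := by
    intro r hr
    obtain ⟨p, -, hp⟩ := exists_mul_negHom_eq hr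
    have h1 := deg_divOf_poly (W := W) p
    have hr' : algebraMap _ W.FunctionField r ≠ 0 := by
      rwa [Ne, map_eq_zero_iff _ (IsFractionRing.injective _ _)]
    -- Negation preserves degrees, so the divisor of the norm has twice the degree of div r.
    rw [← hp, divOf_mul hr' ((_root_.map_ne_zero _).mpr hr'), divOf_negHom, map_add,
      deg_mapDomain] at h1
    omega
  rw [divOf_div, map_sub, key a ha0, key b hb0, sub_zero]
  all_goals rwa [Ne, map_eq_zero_iff _ (IsFractionRing.injective _ _)]

/-- A rational function without poles is constant. -/
theorem exists_eq_const (h : ∀ P, 0 ≤ ord P f) : ∃ c, f = const W c := by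
  -- If f were not constant, f - f(O) would have a zero at O and no poles, hence a divisor of
  -- positive degree.
  refine ⟨value f 0, ?_⟩
  by_contra hne
  have h0 : f - const W (value f 0) ≠ 0 := sub_ne_zero.mpr hne
  have h1 : ∀ P, 0 ≤ ord P (f - const W (value f 0)) := fun P =>
    ((isRegularAt_iff.mpr (h P)).hasValueAt.sub (HasValueAt.const P _)).isRegularAt.ord_nonneg
  have h2 : 0 < ord 0 (f - const W (value f 0)) := HasValueAt.ord_pos
    (((isRegularAt_iff.mpr (h 0)).hasValueAt.sub (HasValueAt.const 0 _)).congr (sub_self _)) h0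
  have h3 := deg_divOf (f - const W (value f 0))
  rw [deg_eq_sum] at h3
  refine h3.not_gt (Finset.sum_pos' (fun P _ => h1 P) ⟨0, ?_, h2⟩)
  rw [Finsupp.mem_support_iff]
  exact h2.ne'

lemma exists_const_mul_of_divOf_eq (hf : f ≠ 0) (hg : g ≠ 0) (h : divOf f = divOf g) :
    ∃ c, c ≠ 0 ∧ f = const W c * g := by
  obtain ⟨c, hc⟩ := exists_eq_const (f := f / g) (fun P => by
    rw [ord_div hf hg, ← divOf_apply, ← divOf_apply, h, sub_self])
  refine ⟨c, ?_, by rw [← hc]; field_simp⟩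
  rintro rfl
  rw [map_zero] at hc
  exact div_ne_zero hf hg hc

end Divisors

end WeilPairing

namespace WeilPairing

variable {F : Type*} [Field F] {W : Affine F}

/-! ### Leading coefficients at infinity -/

section LeadingCoeff

variable {f g : W.FunctionField} {a b : F}

lemma hasLeadingCoeff_iff (hf : f ≠ 0) : HasLeadingCoeff f a ↔
    HasValueAt ((xFun W / yFun W) ^ (-ord 0 f) * f) 0 a := by
  constructor
  · rintro ⟨k, hk, h⟩
    rwa [hk.ord_eq]
  · exact fun h => ⟨_, hasOrderAt_ord hf 0, h⟩

lemma HasLeadingCoeff.ne_zero (h : HasLeadingCoeff f a) : f ≠ 0 := h.choose_spec.1.ne_zero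

lemma HasLeadingCoeff.hasValueAt (h : HasLeadingCoeff f a) :
    HasValueAt ((xFun W / yFun W) ^ (-ord 0 f) * f) 0 a := (hasLeadingCoeff_iff h.ne_zero).mp h

lemma chart_zero_ne_zero : xFun W / yFun W ≠ 0 := div_ne_zero xFun_ne_zero yFun_ne_zero

lemma exists_hasLeadingCoeff (hf : f ≠ 0) : ∃ c, c ≠ 0 ∧ HasLeadingCoeff f c := by
  have h0 := zpow_ne_zero (-ord 0 f) (chart_zero_ne_zero (W := W))
  obtain ⟨c, hc, h⟩ := (isUnitAt_iff (P := 0) (mul_ne_zero h0 hf)).mpr (by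
    rw [ord_mul h0 hf, ord_zpow, ord_zero_chart]; ring)
  exact ⟨c, hc, (hasLeadingCoeff_iff hf).mpr h⟩

lemma HasLeadingCoeff.unique (hf : HasLeadingCoeff f a) (hg : HasLeadingCoeff f b) : a = b :=
  hf.hasValueAt.unique hg.hasValueAt

lemma HasLeadingCoeff.val_ne_zero (hf : HasLeadingCoeff f a) : a ≠ 0 := by
  obtain ⟨c, hc, h⟩ := exists_hasLeadingCoeff hf.ne_zero
  rwa [hf.unique h]

lemma HasLeadingCoeff.mul (hf : HasLeadingCoeff f a) (hg : HasLeadingCoeff g b) :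
    HasLeadingCoeff (f * g) (a * b) := by
  refine (hasLeadingCoeff_iff (mul_ne_zero hf.ne_zero hg.ne_zero)).mpr ?_
  rw [ord_mul hf.ne_zero hg.ne_zero, neg_add, zpow_add₀ chart_zero_ne_zero,
    mul_mul_mul_comm]
  exact hf.hasValueAt.mul hg.hasValueAt

lemma HasLeadingCoeff.inv (hf : HasLeadingCoeff f a) : HasLeadingCoeff f⁻¹ a⁻¹ := by
  refine (hasLeadingCoeff_iff (inv_ne_zero hf.ne_zero)).mpr ?_
  rw [ord_inv, neg_neg]
  have := hf.hasValueAt.inv hf.val_ne_zero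
  rwa [mul_inv, ← zpow_neg, neg_neg] at this

lemma hasLeadingCoeff_of_hasValueAt (h : HasValueAt f 0 a) (ha : a ≠ 0) :
    HasLeadingCoeff f a :=
  (hasLeadingCoeff_iff (h.ne_zero ha)).mpr (by rwa [h.ord_eq ha, neg_zero, zpow_zero, one_mul])

lemma HasLeadingCoeff.hasValueAt_of_ord (h : HasLeadingCoeff f a) (hf : ord 0 f = 0) :
    HasValueAt f 0 a := by
  have := h.hasValueAt
  rwa [hf, neg_zero, zpow_zero, one_mul] at this

lemma hasLeadingCoeff_const (ha : a ≠ 0) : HasLeadingCoeff (const W a) a :=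
  hasLeadingCoeff_of_hasValueAt (HasValueAt.const 0 a) ha

lemma IsMonic.ne_zero (hf : IsMonic f) : f ≠ 0 := HasLeadingCoeff.ne_zero hf

lemma exists_eq_const_mul_isMonic (hf : f ≠ 0) : ∃ (c : F) (g : W.FunctionField), c ≠ 0 ∧
    IsMonic g ∧ f = const W c * g := by
  obtain ⟨c, hc, h⟩ := exists_hasLeadingCoeff hf
  have h0 : const W c ≠ 0 := (_root_.map_ne_zero _).mpr hc
  refine ⟨c, const W c⁻¹ * f, hc, ?_, by rw [map_inv₀]; field_simp⟩
  have := (hasLeadingCoeff_const (W := W) (inv_ne_zero hc)).mul h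
  rwa [inv_mul_cancel₀ hc] at this

end LeadingCoeff

/-! ### Lines -/

section Lines

variable (W) in
/-- The linear function `Y - a X - b`. -/
noncomputable def slant (a b : F) : W.FunctionField := yFun W - const W a * xFun W - const W b

lemma hasValueAt_slant (a b : F) {x y : F} (h : W.Nonsingular x y) :
    HasValueAt (slant W a b) (.some x y h) (y - a * x - b) :=
  ((hasValueAt_yFun h).sub ((HasValueAt.const _ a).mul (hasValueAt_xFun h))).sub
    (HasValueAt.const _ b)

lemma zpow_mul_of_eq {K : Type*} [Field K] {z f u : K} (hz : z ≠ 0) {m : ℤ} (k : ℤ)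
    (h : f = z ^ m * u) : z ^ k * f = z ^ (k + m) * u := by
  rw [h, ← mul_assoc, ← zpow_add₀ hz]

lemma slant_zero (a b : F) : ord 0 (slant W a b) = -3 ∧ IsMonic (slant W a b) := by
  obtain ⟨hz, u, hu, hx, hy⟩ := isUniformizerAt_zero (W := W)
  have h0 := chart_zero_ne_zero (W := W)
  have hc := HasValueAt.const (0 : W.Point)
  have hx' : (xFun W / yFun W) ^ (3 : ℤ) * xFun W = (xFun W / yFun W) * u := by
    rw [zpow_mul_of_eq h0 3 hx]; norm_num
  have hy' : (xFun W / yFun W) ^ (3 : ℤ) * yFun W = u := by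
    rw [zpow_mul_of_eq h0 3 hy]; norm_num
  have hval : HasValueAt ((xFun W / yFun W) ^ (3 : ℤ) * slant W a b) 0 1 := by
    have : (xFun W / yFun W) ^ (3 : ℤ) * slant W a b =
        u - const W a * ((xFun W / yFun W) * u) - const W b * (xFun W / yFun W) ^ 3 := by
      rw [slant, mul_sub, mul_sub, hy', ← hx']
      norm_cast
      ring
    rw [this]
    exact ((hu.sub ((hc a).mul (hz.1.mul hu))).sub ((hc b).mul (hz.1.pow 3))).congr (by ring)
  have hord : HasOrderAt (slant W a b) 0 (-3) := by
    refine (hasOrderAt_iff hz).mpr ⟨_, ⟨1, one_ne_zero, hval⟩, ?_⟩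
    rw [← mul_assoc, ← zpow_add₀ h0]
    norm_num
  exact ⟨hord.ord_eq, -3, hord, by simpa using hval⟩

lemma slant_ne_zero (a b : F) : slant W a b ≠ 0 := (slant_zero a b).2.ne_zero

lemma isMonic_xFun_sub (c : F) : IsMonic (xFun W - const W c) := by
  obtain ⟨hz, u, hu, hx, hy⟩ := isUniformizerAt_zero (W := W)
  have h0 := chart_zero_ne_zero (W := W)
  have hval : HasValueAt ((xFun W / yFun W) ^ (2 : ℤ) * (xFun W - const W c)) 0 1 := by
    have : (xFun W / yFun W) ^ (2 : ℤ) * (xFun W - const W c) =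
        u - const W c * (xFun W / yFun W) ^ 2 := by
      have hx' : (xFun W / yFun W) ^ (2 : ℤ) * xFun W = u := by
        rw [zpow_mul_of_eq h0 2 hx]; norm_num
      rw [mul_sub, hx']
      norm_cast
      ring
    rw [this]
    exact (hu.sub ((HasValueAt.const _ c).mul (hz.1.pow 2))).congr (by ring)
  have hord : HasOrderAt (xFun W - const W c) 0 (-2) := by
    refine (hasOrderAt_iff hz).mpr ⟨_, ⟨1, one_ne_zero, hval⟩, ?_⟩
    rw [← mul_assoc, ← zpow_add₀ h0]
    norm_num
  exact ⟨-2, hord, by simpa using hval⟩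

/-- `x₁, x₂, x₃` are the `x`-coordinates of the intersection points of the line `Y = a X + b` with
the curve. -/
def IsIntersection (W : Affine F) (a b x₁ x₂ x₃ : F) : Prop :=
  W.polynomial.eval (C a * X + C b) = -((X - C x₁) * (X - C x₂) * (X - C x₃))

variable {a b x₁ x₂ x₃ : F}

lemma IsIntersection.eval (h : IsIntersection W a b x₁ x₂ x₃) (t : F) :
    W.polynomial.evalEval t (a * t + b) = -((t - x₁) * (t - x₂) * (t - x₃)) := by
  have := congrArg (Polynomial.eval t) h
  simp only [eval_neg, eval_mul, eval_sub, eval_X, eval_C] at this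
  rw [← this, Affine.evalEval_polynomial, Affine.polynomial]
  simp
  ring

variable [IsAlgClosed F] [W.IsElliptic]

omit [W.IsElliptic] in
variable (W a b) in
lemma exists_isIntersection : ∃ x₁ x₂ x₃, IsIntersection W a b x₁ x₂ x₃ := by
  set p : F[X] := -W.polynomial.eval (C a * X + C b) with hp
  have hp' : p = C 1 * X ^ 3 + C (W.a₂ - a ^ 2 - W.a₁ * a) * X ^ 2 +
      C (W.a₄ - 2 * a * b - W.a₁ * b - W.a₃ * a) * X + C (W.a₆ - b ^ 2 - W.a₃ * b) := by
    rw [hp, Affine.polynomial]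
    simp only [eval_sub, eval_add, eval_mul, eval_pow, eval_X, eval_C, map_sub, map_mul, map_add,
      map_pow, map_one, map_ofNat]
    ring
  have hdeg : p.natDegree = 3 := by rw [hp']; exact natDegree_cubic one_ne_zero
  have hlc : p.leadingCoeff = 1 := by rw [hp']; exact leadingCoeff_cubic one_ne_zero
  have hs := (IsAlgClosed.splits p)
  have hcard : Multiset.card p.roots = 3 := by rw [← hs.natDegree_eq_card_roots, hdeg]
  obtain ⟨x₁, x₂, x₃, hx⟩ := Multiset.card_eq_three.mp hcard
  refine ⟨x₁, x₂, x₃, ?_⟩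
  have := hs.eq_prod_roots
  rw [hlc, hx] at this
  simp at this
  rw [IsIntersection, ← neg_eq_iff_eq_neg, ← hp, this]
  ring

omit [IsAlgClosed F] in
lemma IsIntersection.nonsingular (h : IsIntersection W a b x₁ x₂ x₃) {t : F}
    (ht : t = x₁ ∨ t = x₂ ∨ t = x₃) : W.Nonsingular t (a * t + b) := by
  refine Affine.equation_iff_nonsingular.mp ?_
  rw [Affine.Equation, h.eval]
  rcases ht with rfl | rfl | rfl <;> ring

omit [W.IsElliptic] in
-- The left side is the norm to F(x) of Y - aX - b, that is, the Weierstrass polynomial with aX + b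
-- substituted for Y.
lemma IsIntersection.slant_mul (h : IsIntersection W a b x₁ x₂ x₃) :
    slant W a b * negHom W (slant W a b) =
      -((xFun W - const W x₁) * (xFun W - const W x₂) * (xFun W - const W x₃)) := by
  have h1 := congrArg (Polynomial.eval₂ (const W) (xFun W)) h
  simp only [eval₂_neg, eval₂_mul, eval₂_sub, eval₂_X, eval₂_C] at h1
  rw [← h1]
  simp only [slant, Affine.polynomial, map_sub, map_mul, negHom_yFun, map_const, negHom_xFun, eval_sub, eval_add, eval_mul,
    eval_pow, eval_X, eval_C, eval₂_sub, eval₂_add, eval₂_mul, eval₂_pow, eval₂_X, eval₂_C]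
  linear_combination -xFun_yFun_equation (W := W)

/-- The norm determines only the sum of the orders at P and -P. These separate: if P ≠ -P is on the
line, then -P is not, as the line is not vertical; and if P = -P, the sum is twice the order at P.
-/
lemma IsIntersection.divOf_slant (h : IsIntersection W a b x₁ x₂ x₃) :
    divOf (slant W a b) = pt (.some x₁ (a * x₁ + b) (h.nonsingular (.inl rfl))) +
      pt (.some x₂ (a * x₂ + b) (h.nonsingular (.inr (.inl rfl)))) +
      pt (.some x₃ (a * x₃ + b) (h.nonsingular (.inr (.inr rfl)))) - (3 : ℤ) • pt 0 := by
  classical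
  set P₁ : W.Point := .some x₁ (a * x₁ + b) (h.nonsingular (.inl rfl)) with hP₁
  set P₂ : W.Point := .some x₂ (a * x₂ + b) (h.nonsingular (.inr (.inl rfl))) with hP₂
  set P₃ : W.Point := .some x₃ (a * x₃ + b) (h.nonsingular (.inr (.inr rfl))) with hP₃
  have hs := slant_ne_zero (W := W) a b
  have hs' := (_root_.map_ne_zero (negHom W)).mpr hs
  have hx := fun c => sub_ne_zero.mpr (xFun_ne_const (W := W) c)
  have hsum : ∀ P, ord P (slant W a b) + ord (-P) (slant W a b) =
      (pt P₁ P + pt (-P₁) P - 2 * pt 0 P) + (pt P₂ P + pt (-P₂) P - 2 * pt 0 P) +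
      (pt P₃ P + pt (-P₃) P - 2 * pt 0 P) := by
    intro P
    rw [← ord_negHom, ← ord_mul hs hs', h.slant_mul, ord_neg,
      ord_mul (mul_ne_zero (hx _) (hx _)) (hx _), ord_mul (hx _) (hx _), ← divOf_apply,
      ← divOf_apply, ← divOf_apply, divOf_xFun_sub (h.nonsingular (.inl rfl)),
      divOf_xFun_sub (h.nonsingular (.inr (.inl rfl))),
      divOf_xFun_sub (h.nonsingular (.inr (.inr rfl)))]
    simp only [Finsupp.add_apply, Finsupp.sub_apply, Finsupp.smul_apply, smul_eq_mul]
    rfl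
  ext P
  match P with
  | 0 =>
    rw [divOf_apply, (slant_zero a b).1]
    simp only [Finsupp.add_apply, Finsupp.sub_apply, Finsupp.smul_apply, pt, Finsupp.single_apply]
    rw [if_neg (Affine.Point.some_ne_zero _), if_neg (Affine.Point.some_ne_zero _),
      if_neg (Affine.Point.some_ne_zero _)]
    simp
  | .some x y hxy =>
    have hv := hasValueAt_slant a b hxy
    have hv' : HasValueAt (slant W a b) (-.some x y hxy) (W.negY x y - a * x - b) :=
      hasValueAt_slant a b _
    have hneg := neg_eq_self_iff hxy
    have h0 : pt (0 : W.Point) (.some x y hxy) = 0 := by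
      rw [pt, Finsupp.single_apply, if_neg (Affine.Point.some_ne_zero hxy).symm]
    have hpt : ∀ t (ht : W.Nonsingular t (a * t + b)), y - a * x - b ≠ 0 →
        pt (.some t (a * t + b) ht : W.Point) (.some x y hxy) = 0 := by
      intro t ht hne
      rw [pt, Finsupp.single_apply, if_neg]
      rw [Affine.Point.some.injEq]
      rintro ⟨rfl, rfl⟩
      exact hne (by ring)
    have hpt' : ∀ t (ht : W.Nonsingular t (a * t + b)), W.negY x y - a * x - b ≠ 0 →
        pt (-.some t (a * t + b) ht : W.Point) (.some x y hxy) = 0 := by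
      intro t ht hne
      rw [pt, Finsupp.single_apply, if_neg]
      rw [neg_eq_iff_eq_neg, Affine.Point.neg_some, Affine.Point.some.injEq]
      rintro ⟨rfl, h2⟩
      exact hne (by rw [← h2]; ring)
    have hself : ∀ R : W.Point, -(.some x y hxy : W.Point) = .some x y hxy →
        pt (-R) (.some x y hxy) = pt R (.some x y hxy) := by
      intro R hR
      rw [pt, pt, Finsupp.single_apply, Finsupp.single_apply]
      refine if_congr ?_ rfl rfl
      rw [neg_eq_iff_eq_neg, hR]
    have hsum' := hsum (.some x y hxy)
    simp only [divOf_apply, Finsupp.add_apply, Finsupp.sub_apply, Finsupp.smul_apply, h0,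
      smul_zero, mul_zero, sub_zero] at hsum' ⊢
    by_cases hy : y - a * x - b = 0
    · by_cases hP : -(.some x y hxy : W.Point) = .some x y hxy
      · rw [hself P₁ hP, hself P₂ hP, hself P₃ hP, hP] at hsum'
        omega
      · have hy' : W.negY x y - a * x - b ≠ 0 := by
          intro hy'
          refine hP (hneg.mpr ?_)
          rw [Affine.negY] at hy'
          linear_combination hy - hy'
        rw [hv'.ord_eq hy', hpt' _ _ hy', hpt' _ _ hy', hpt' _ _ hy'] at hsum'
        omega
    · rw [hv.ord_eq hy, hpt _ _ hy, hpt _ _ hy, hpt _ _ hy]; rfl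

end Lines

end WeilPairing

namespace WeilPairing

variable {F : Type*} [Field F] {W : Affine F}

/-! ### Principal divisors -/

section Principal

variable [IsAlgClosed F] [W.IsElliptic]

/-- The functions defining the non-vertical and the vertical lines. -/
def IsLine (u : W.FunctionField) : Prop :=
  (∃ a b, u = slant W a b) ∨ ∃ c, u = xFun W - const W c

omit [IsAlgClosed F] [W.IsElliptic] in
lemma IsLine.isMonic {u : W.FunctionField} (hu : IsLine u) : IsMonic u := by
  rcases hu with ⟨a, b, rfl⟩ | ⟨c, rfl⟩
  · exact (slant_zero a b).2
  · exact isMonic_xFun_sub c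

/-- The group generated by the divisors of the lines that do not meet `Z`. -/
noncomputable def lineDivisors (Z : Set W.Point) : AddSubgroup (Divisor W) :=
  AddSubgroup.closure {D | ∃ u, IsLine u ∧ (∀ P ∈ Z, ord P u = 0) ∧ D = divOf u}

lemma exists_divOf_eq_of_mem_lineDivisors {Z : Set W.Point} {D : Divisor W}
    (hD : D ∈ lineDivisors Z) : ∃ f : W.FunctionField, f ≠ 0 ∧ divOf f = D := by
  induction hD using AddSubgroup.closure_induction with
  | mem D h =>
    obtain ⟨u, hu, -, rfl⟩ := h
    exact ⟨u, hu.isMonic.ne_zero, rfl⟩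
  | zero => exact ⟨1, one_ne_zero, by rw [← map_one (const W), divOf_const]⟩
  | add D D' _ _ h h' =>
    obtain ⟨f, hf, rfl⟩ := h
    obtain ⟨g, hg, rfl⟩ := h'
    exact ⟨f * g, mul_ne_zero hf hg, divOf_mul hf hg⟩
  | neg D _ h =>
    obtain ⟨f, hf, rfl⟩ := h
    exact ⟨f⁻¹, inv_ne_zero hf, divOf_inv⟩

omit [IsAlgClosed F] [W.IsElliptic] in
lemma pt_apply_of_ne {P Q : W.Point} (h : P ≠ Q) : pt P Q = 0 := by
  classical rw [pt, Finsupp.single_apply, if_neg h]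

lemma pt_add_pt_neg_mem {Z : Set W.Point} (h0 : 0 ∉ Z) {A : W.Point} (hA : A ∉ Z)
    (hA' : -A ∉ Z) : pt A + pt (-A) - (2 : ℤ) • pt 0 ∈ lineDivisors Z := by
  match A, hA, hA' with
  | 0, _, _ =>
    have : pt 0 + pt (-0) - (2 : ℤ) • pt (0 : W.Point) = 0 := by rw [two_smul]; exact sub_self _
    rw [this]
    exact zero_mem _
  | .some x y h, hA, hA' =>
    refine AddSubgroup.subset_closure ⟨xFun W - const W x, .inr ⟨x, rfl⟩, fun P hP => ?_,
      (divOf_xFun_sub h).symm⟩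
    rw [← divOf_apply, divOf_xFun_sub h]
    simp only [Finsupp.add_apply, Finsupp.sub_apply, Finsupp.smul_apply]
    rw [pt_apply_of_ne (by rintro rfl; exact hA hP), pt_apply_of_ne (by rintro rfl; exact hA' hP),
      pt_apply_of_ne (by rintro rfl; exact h0 hP)]
    rfl

variable [DecidableEq F]

omit [IsAlgClosed F] in
lemma exists_isIntersection_add {A E : W.Point} (hA : A ≠ 0) (hE : E ≠ 0) (hAE : A + E ≠ 0) :
    ∃ a b x₁ x₂ x₃, ∃ h : IsIntersection W a b x₁ x₂ x₃,
      A = .some x₁ (a * x₁ + b) (h.nonsingular (.inl rfl)) ∧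
      E = .some x₂ (a * x₂ + b) (h.nonsingular (.inr (.inl rfl))) ∧
      -(A + E) = .some x₃ (a * x₃ + b) (h.nonsingular (.inr (.inr rfl))) := by
  match A, E, hA, hE, hAE with
  | .some x₁ y₁ h₁, .some x₂ y₂ h₂, _, _, hAE =>
    have hxy : ¬(x₁ = x₂ ∧ y₁ = W.negY x₂ y₂) := fun h => hAE (Affine.Point.add_of_Y_eq h.1 h.2)
    set s := W.slope x₁ x₂ y₁ y₂ with hs
    have h := Affine.addPolynomial_slope h₁.1 h₂.1 hxy
    rw [← hs, Affine.addPolynomial, Affine.linePolynomial] at h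
    have h' : IsIntersection W s (y₁ - s * x₁) x₁ x₂ (W.addX x₁ x₂ s) := by
      rw [IsIntersection, ← h]
      congr 1
      simp only [map_sub, map_mul]
      ring
    refine ⟨s, y₁ - s * x₁, x₁, x₂, W.addX x₁ x₂ s, h', ?_, ?_, ?_⟩
    · rw [Affine.Point.some.injEq]
      exact ⟨rfl, by ring⟩
    · rw [Affine.Point.some.injEq]
      refine ⟨rfl, ?_⟩
      by_cases hx : x₁ = x₂
      · subst hx
        rw [← Affine.Y_eq_of_Y_ne h₁.1 h₂.1 rfl (fun h => hxy ⟨rfl, h⟩)]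
        ring
      · rw [hs, Affine.slope_of_X_ne hx]
        have := sub_ne_zero.mpr hx
        field_simp
        ring
    · rw [Affine.Point.add_some hxy, Affine.Point.neg_some, Affine.Point.some.injEq]
      refine ⟨rfl, ?_⟩
      rw [← hs, Affine.addY, Affine.negAddY, Affine.negY_negY]
      ring

/-- This is the divisor of the line through A and E divided by the vertical line through A + E. The
hypotheses keep both lines off Z; O must be outside Z because it is a pole of every line. -/
lemma pt_add_pt_sub_mem {Z : Set W.Point} (h0 : 0 ∉ Z) {A E : W.Point} (hA : A ∉ Z) (hE : E ∉ Z)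
    (hE0 : E ≠ 0) (hAE0 : A + E ≠ 0) (hAE : A + E ∉ Z) (hAE' : -(A + E) ∉ Z) :
    pt A + pt E - pt (A + E) - pt 0 ∈ lineDivisors Z := by
  by_cases hA0 : A = 0
  · rw [hA0, zero_add]
    have : pt 0 + pt E - pt E - pt (0 : W.Point) = 0 := by abel
    rw [this]
    exact zero_mem _
  obtain ⟨a, b, x₁, x₂, x₃, h, h₁, h₂, h₃⟩ := exists_isIntersection_add hA0 hE0 hAE0
  have hd := h.divOf_slant
  rw [← h₁, ← h₂, ← h₃] at hd
  have hm : divOf (slant W a b) ∈ lineDivisors Z := by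
    refine AddSubgroup.subset_closure ⟨slant W a b, .inl ⟨a, b, rfl⟩, fun P hP => ?_, rfl⟩
    rw [← divOf_apply, hd]
    simp only [Finsupp.add_apply, Finsupp.sub_apply, Finsupp.smul_apply]
    rw [pt_apply_of_ne (by rintro rfl; exact hA hP), pt_apply_of_ne (by rintro rfl; exact hE hP),
      pt_apply_of_ne (by rintro rfl; exact hAE' hP), pt_apply_of_ne (by rintro rfl; exact h0 hP)]
    rfl
  rw [hd] at hm
  convert sub_mem hm (pt_add_pt_neg_mem h0 hAE hAE') using 1
  module

omit [DecidableEq F] in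
instance infinite_point : Infinite W.Point := by
  have hF : Infinite F := IsAlgClosed.instInfinite
  refine Infinite.of_injective (fun x : F => (.some x _ (exists_point_of_x (W := W) x).choose_spec :
    W.Point)) fun x x' h => ?_
  exact (Affine.Point.some.inj h).1

open Filter in
/-- Up to divisors of lines that avoid `Z`, a divisor is determined by its degree and sum. -/
lemma eventually_mem_lineDivisors {Z : Set W.Point} (hZ : Z.Finite) (h0 : 0 ∉ Z) {D : Divisor W}
    (hD : D ∈ AddSubgroup.closure (pt '' Zᶜ)) : ∀ᶠ E in cofinite,
      D - pt (E + pointSum D) + pt E - deg D • pt 0 ∈ lineDivisors Z := by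
  have hadd : ∀ A : W.Point, Tendsto (fun E => E + A) cofinite cofinite := fun A =>
    (add_left_injective A).tendsto_cofinite
  induction hD using AddSubgroup.closure_induction with
  | mem D h =>
    obtain ⟨A, hA, rfl⟩ := h
    have hne : ∀ᶠ E in cofinite, E ≠ (0 : W.Point) := (Set.finite_singleton 0).compl_mem_cofinite
    have hnZ : ∀ᶠ E in cofinite, E ∉ Z := hZ.compl_mem_cofinite
    have hneg : Tendsto (fun E : W.Point => -E) cofinite cofinite :=
      neg_injective.tendsto_cofinite
    filter_upwards [hne, hnZ, (hadd A).eventually hne, (hadd A).eventually hnZ,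
      (hneg.comp (hadd A)).eventually hnZ] with E h1 h2 h3 h4 h5
    rw [Function.comp_apply] at h5
    have := pt_add_pt_sub_mem h0 hA h2 h1 (add_comm E A ▸ h3) (add_comm E A ▸ h4)
      (add_comm E A ▸ h5)
    rw [pointSum_pt, deg_pt, one_smul]
    convert this using 1
    rw [add_comm E A]
    abel
  | zero =>
    refine .of_forall fun E => ?_
    rw [map_zero, map_zero, zero_smul, add_zero, zero_sub, neg_add_cancel, sub_zero]
    exact zero_mem _
  | add D D' _ _ h h' =>
    -- E is a running partial sum: adding the points of D moves it to E + ΣD, and D' continues from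
    -- there. A generic start keeps all intermediate points and their negatives outside Z.
    filter_upwards [h, (hadd (pointSum D)).eventually h'] with E h1 h2
    convert add_mem h1 h2 using 1
    rw [map_add, map_add, add_smul, add_assoc E]
    abel
  | neg D _ h =>
    filter_upwards [(hadd (-pointSum D)).eventually h] with E h1
    convert neg_mem h1 using 1
    rw [map_neg, map_neg, neg_smul, neg_add_cancel_right]
    abel

omit [IsAlgClosed F] [W.IsElliptic] [DecidableEq F] in
lemma mem_closure_pt {Z : Set W.Point} {D : Divisor W} (h : ∀ P ∈ Z, D P = 0) :
    D ∈ AddSubgroup.closure (pt '' Zᶜ) := by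
  rw [← D.sum_single]
  refine sum_mem fun P hP => ?_
  have : Finsupp.single P (D P) = D P • pt P := by simp [pt]
  rw [this]
  refine zsmul_mem (AddSubgroup.subset_closure (Set.mem_image_of_mem _ fun hPZ => ?_)) _
  exact Finsupp.mem_support_iff.mp hP (h P hPZ)

/-- When the sum is zero the two auxiliary points coincide and cancel. This is the moving lemma
behind reciprocity: a divisor that avoids Z is built from lines that all avoid Z. -/
lemma mem_lineDivisors {Z : Set W.Point} (hZ : Z.Finite) (h0 : 0 ∉ Z) {D : Divisor W}
    (h : ∀ P ∈ Z, D P = 0) (hdeg : deg D = 0) (hsum : pointSum D = 0) : D ∈ lineDivisors Z := by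
  obtain ⟨E, hE⟩ := (eventually_mem_lineDivisors hZ h0 (mem_closure_pt h)).exists
  rwa [hdeg, hsum, add_zero, zero_smul, sub_zero, sub_add_cancel] at hE

/-- A divisor of degree and sum zero is principal. -/
theorem exists_divOf_eq {D : Divisor W} (hdeg : deg D = 0) (hsum : pointSum D = 0) :
    ∃ f : W.FunctionField, f ≠ 0 ∧ divOf f = D :=
  exists_divOf_eq_of_mem_lineDivisors
    (mem_lineDivisors (Set.finite_empty (α := W.Point)) (by simp) (by simp) hdeg hsum)

omit [DecidableEq F] in
-- The Nullstellensatz: the residue field is finite over the algebraically closed field F, hence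
-- equal to F, and x, y are the classes of the coordinates.
lemma exists_point_of_isMaximal (m : Ideal W.CoordinateRing) [hm : m.IsMaximal] :
    ∃ x y, ∃ h : W.Nonsingular x y, ∀ r ∈ m,
      HasValueAt (algebraMap _ W.FunctionField r) (.some x y h) 0 := by
  have hft : Algebra.FiniteType F W.CoordinateRing :=
    Algebra.FiniteType.trans (S := F[X]) inferInstance inferInstance
  let := Ideal.Quotient.field m
  have := finite_of_finite_type_of_isJacobsonRing F (W.CoordinateRing ⧸ m)
  have hb := IsAlgClosed.algebraMap_bijective_of_isIntegral (k := F) (K := W.CoordinateRing ⧸ m)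
  obtain ⟨x, hx⟩ := hb.2 (Ideal.Quotient.mk m (Affine.CoordinateRing.mk W (C X)))
  obtain ⟨y, hy⟩ := hb.2 (Ideal.Quotient.mk m (Affine.CoordinateRing.mk W Y))
  have key : ∀ A : F[X][Y], algebraMap F (W.CoordinateRing ⧸ m) (A.evalEval x y) =
      Ideal.Quotient.mk m (Affine.CoordinateRing.mk W A) := by
    have : (algebraMap F (W.CoordinateRing ⧸ m)).comp (evalEvalRingHom x y) =
        (Ideal.Quotient.mk m).comp (Affine.CoordinateRing.mk W) := by
      refine Polynomial.ringHom_ext' (Polynomial.ringHom_ext' ?_ ?_) ?_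
      · ext c
        simp
        rfl
      · simpa [evalEval_C] using hx
      · simpa using hy
    exact fun A => congrArg (fun φ => φ A) this
  have h : W.Nonsingular x y := by
    refine Affine.equation_iff_nonsingular.mp (hb.1 ?_)
    rw [key, map_zero]
    have : Affine.CoordinateRing.mk W W.polynomial = 0 := AdjoinRoot.mk_self
    rw [this, map_zero]
  refine ⟨x, y, h, fun r hr => ?_⟩
  obtain ⟨A, rfl⟩ := AdjoinRoot.mk_surjective r
  refine (hasValueAt_mk h A).congr (hb.1 ?_)
  rw [key, map_zero]
  exact Ideal.Quotient.eq_zero_iff_mem.mpr hr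

omit [DecidableEq F] in
/-- A function that is regular at all affine points is a polynomial in the coordinates. -/
lemma exists_algebraMap_eq {f : W.FunctionField} (hf : ∀ P ≠ 0, 0 ≤ ord P f) :
    ∃ r, f = algebraMap W.CoordinateRing W.FunctionField r := by
  -- The ideal of denominators of f. If it were proper, all its elements would vanish at some affine
  -- point; but regularity of f there provides a denominator that does not.
  let I : Ideal W.CoordinateRing :=
    { carrier := {r | ∃ s, algebraMap _ W.FunctionField r * f = algebraMap W.CoordinateRing _ s}
      add_mem' := by
        rintro _ _ ⟨s, hs⟩ ⟨s', hs'⟩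
        exact ⟨s + s', by rw [map_add, map_add, add_mul, hs, hs']⟩
      zero_mem' := ⟨0, by simp⟩
      smul_mem' := by
        rintro c _ ⟨s, hs⟩
        exact ⟨c * s, by rw [smul_eq_mul, map_mul, map_mul, mul_assoc, hs]⟩ }
  by_cases hI : I = ⊤
  · obtain ⟨s, hs⟩ : (1 : W.CoordinateRing) ∈ I := hI ▸ Submodule.mem_top
    exact ⟨s, by rw [← hs, map_one, one_mul]⟩
  obtain ⟨m, hm, hIm⟩ := Ideal.exists_le_maximal I hI
  obtain ⟨x, y, h, hP⟩ := exists_point_of_isMaximal m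
  obtain ⟨c, hc⟩ := isRegularAt_of_ord_nonneg (hf _ (Affine.Point.some_ne_zero h))
  obtain ⟨A, B, hB, hAB, -⟩ := hasValueAt_iff.mp hc
  rw [← algebraMap_shiftHom, ← algebraMap_shiftHom] at hAB
  have h1 := hP _ (hIm (show shiftHom W x y B ∈ I from ⟨_, by rw [mul_comm]; exact hAB⟩))
  rw [algebraMap_shiftHom h] at h1
  exact absurd ((HasValueAt.inChart _ B).unique h1) hB

/-- The sum of a principal divisor is zero. -/
theorem pointSum_divOf (f : W.FunctionField) : pointSum (divOf f) = 0 := by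
  by_cases hf : f = 0
  · rw [hf, ← map_zero (const W), divOf_const, map_zero]
  by_contra hS
  set S := pointSum (divOf f)
  -- If the sum S were not O, division by g would leave a function with divisor [S] - [O]. Such a
  -- function is a polynomial in x, y with a simple pole at O, but no norm from the coordinate ring
  -- has degree 1.
  obtain ⟨g, hg, hgD⟩ := exists_divOf_eq (D := divOf f - pt S + pt 0)
    (by rw [map_add, map_sub, deg_divOf, deg_pt, deg_pt]; rfl)
    (by rw [map_add, map_sub, pointSum_pt, pointSum_pt, sub_self, zero_add])
  have hd : divOf (f / g) = pt S - pt 0 := by rw [divOf_div hf hg, hgD]; abel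
  obtain ⟨r, hr⟩ := exists_algebraMap_eq (f := f / g) (fun P hP => by
    rw [← divOf_apply, hd, Finsupp.sub_apply, pt_apply_of_ne hP.symm, sub_zero, pt,
      Finsupp.single_apply]
    split_ifs <;> norm_num)
  have hr0 : r ≠ 0 := by
    rintro rfl
    rw [map_zero] at hr
    exact div_ne_zero hf hg hr
  have h1 := (HasOrderAt.algebraMap_zero hr0).ord_eq
  rw [← hr, ← divOf_apply, hd, Finsupp.sub_apply, pt_apply_of_ne hS, pt,
    Finsupp.single_eq_same] at h1
  exact Affine.CoordinateRing.natDegree_norm_ne_one r (by omega)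

end Principal

end WeilPairing

namespace WeilPairing

variable {F : Type*} [Field F] {W : Affine F}

/-! ### Reciprocity -/

section Evaluation

/-- A multiplicative variant of evaluation: the value of `f` at `P` if `P` is an affine point that
is neither a zero nor a pole, the leading coefficient if `P` is the point at infinity. -/
noncomputable def unitVal (f : W.FunctionField) (P : W.Point) : F :=
  open Classical in
  -- The default 1, rather than 0, makes all these values non-zero, so that `pairing f` is a
  -- homomorphism on all divisors without any condition on supports.
  if h : ∃ c, c ≠ 0 ∧ ((P = 0 ∧ HasLeadingCoeff f c) ∨ HasValueAt f P c) then h.choose else 1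

/-- The product of the values of `f` over the points of a divisor. -/
noncomputable def pairing (f : W.FunctionField) (D : Divisor W) : F :=
  D.prod fun P k => unitVal f P ^ k

variable {f g : W.FunctionField} {P : W.Point} {a b : F}

lemma unitVal_ne_zero (f : W.FunctionField) (P : W.Point) : unitVal f P ≠ 0 := by
  rw [unitVal]
  split_ifs with h
  · exact h.choose_spec.1
  · exact one_ne_zero

lemma HasValueAt.unitVal_eq (h : HasValueAt f P a) (ha : a ≠ 0) : unitVal f P = a := by
  have h' : ∃ c, c ≠ 0 ∧ ((P = 0 ∧ HasLeadingCoeff f c) ∨ HasValueAt f P c) := ⟨a, ha, .inr h⟩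
  rw [unitVal, dif_pos h']
  rcases h'.choose_spec.2 with ⟨rfl, h1⟩ | h1
  · exact h1.unique (hasLeadingCoeff_of_hasValueAt h ha)
  · exact h1.unique h

lemma HasLeadingCoeff.unitVal_eq (h : HasLeadingCoeff f a) : unitVal f 0 = a := by
  have h' : ∃ c, c ≠ 0 ∧ (((0 : W.Point) = 0 ∧ HasLeadingCoeff f c) ∨ HasValueAt f 0 c) :=
    ⟨a, h.val_ne_zero, .inl ⟨rfl, h⟩⟩
  rw [unitVal, dif_pos h']
  rcases h'.choose_spec.2 with ⟨-, h1⟩ | h1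
  · exact h1.unique h
  · exact (hasLeadingCoeff_of_hasValueAt h1 h'.choose_spec.1).unique h

lemma hasLeadingCoeff_unitVal (hf : f ≠ 0) : HasLeadingCoeff f (unitVal f 0) := by
  obtain ⟨c, -, h⟩ := exists_hasLeadingCoeff hf
  rwa [h.unitVal_eq]

lemma IsMonic.unitVal_eq (h : IsMonic f) : unitVal f 0 = 1 := HasLeadingCoeff.unitVal_eq h

lemma unitVal_const (ha : a ≠ 0) : unitVal (const W a) P = a := (HasValueAt.const P a).unitVal_eq ha

lemma hasValueAt_unitVal (hf : f ≠ 0) (h : ord P f = 0) : HasValueAt f P (unitVal f P) := by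
  obtain ⟨c, hc, hv⟩ := (isUnitAt_iff hf).mpr h
  rwa [hv.unitVal_eq hc]

lemma unitVal_eq_value (hf : f ≠ 0) (h : ord P f = 0) : unitVal f P = value f P :=
  (value_eq (hasValueAt_unitVal hf h)).symm

/-- Leading coefficients are multiplicative whatever the orders at O are; therefore only affine
points need a condition. -/
lemma unitVal_mul (hf : f ≠ 0) (hg : g ≠ 0) (hf' : P ≠ 0 → ord P f = 0)
    (hg' : P ≠ 0 → ord P g = 0) : unitVal (f * g) P = unitVal f P * unitVal g P := by
  by_cases hP : P = 0
  · subst hP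
    exact ((hasLeadingCoeff_unitVal hf).mul (hasLeadingCoeff_unitVal hg)).unitVal_eq
  · exact ((hasValueAt_unitVal hf (hf' hP)).mul (hasValueAt_unitVal hg (hg' hP))).unitVal_eq
      (mul_ne_zero (unitVal_ne_zero f P) (unitVal_ne_zero g P))

lemma unitVal_inv (hf : f ≠ 0) (hf' : P ≠ 0 → ord P f = 0) :
    unitVal f⁻¹ P = (unitVal f P)⁻¹ := by
  by_cases hP : P = 0
  · subst hP
    exact (hasLeadingCoeff_unitVal hf).inv.unitVal_eq
  · exact ((hasValueAt_unitVal hf (hf' hP)).inv (unitVal_ne_zero f P)).unitVal_eq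
      (inv_ne_zero (unitVal_ne_zero f P))

lemma pairing_zero (f : W.FunctionField) : pairing f 0 = 1 := Finsupp.prod_zero_index

lemma pairing_add (f : W.FunctionField) (D D' : Divisor W) :
    pairing f (D + D') = pairing f D * pairing f D' := by
  classical
  exact Finsupp.prod_add_index (fun _ _ => zpow_zero _)
    fun P _ k l => zpow_add₀ (unitVal_ne_zero f P) k l

lemma pairing_pt (f : W.FunctionField) (P : W.Point) : pairing f (pt P) = unitVal f P := by
  rw [pairing, pt, Finsupp.prod_single_index (zpow_zero _), zpow_one]

lemma pairing_ne_zero (f : W.FunctionField) (D : Divisor W) : pairing f D ≠ 0 :=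
  Finset.prod_ne_zero_iff.mpr fun P _ => zpow_ne_zero _ (unitVal_ne_zero f P)

lemma pairing_neg (f : W.FunctionField) (D : Divisor W) : pairing f (-D) = (pairing f D)⁻¹ := by
  refine eq_inv_of_mul_eq_one_left ?_
  rw [← pairing_add, neg_add_cancel, pairing_zero]

lemma pairing_sub (f : W.FunctionField) (D D' : Divisor W) :
    pairing f (D - D') = pairing f D / pairing f D' := by
  rw [sub_eq_add_neg, pairing_add, pairing_neg, div_eq_mul_inv]

lemma pairing_nsmul (f : W.FunctionField) (n : ℕ) (D : Divisor W) :
    pairing f (n • D) = pairing f D ^ n := by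
  induction n with
  | zero => rw [zero_smul, pairing_zero, pow_zero]
  | succ n ih => rw [succ_nsmul, pairing_add, ih, pow_succ]

lemma pairing_zsmul (f : W.FunctionField) (n : ℤ) (D : Divisor W) :
    pairing f (n • D) = pairing f D ^ n := by
  cases n with
  | ofNat n => simpa using pairing_nsmul f n D
  | negSucc n => rw [negSucc_zsmul, pairing_neg, pairing_nsmul, zpow_negSucc]

lemma pairing_const (ha : a ≠ 0) (D : Divisor W) : pairing (const W a) D = a ^ deg D := by
  induction D using Finsupp.induction_linear with
  | zero => rw [pairing_zero, map_zero, zpow_zero]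
  | add D D' h h' => rw [pairing_add, h, h', map_add, zpow_add₀ ha]
  | single P k =>
    have : Finsupp.single P k = k • pt P := by simp [pt]
    rw [this, pairing_zsmul, pairing_pt, unitVal_const ha, map_zsmul, deg_pt, smul_eq_mul, mul_one]

lemma pairing_mul {D : Divisor W} (hf : f ≠ 0) (hg : g ≠ 0)
    (hf' : ∀ P ≠ 0, D P ≠ 0 → ord P f = 0) (hg' : ∀ P ≠ 0, D P ≠ 0 → ord P g = 0) :
    pairing (f * g) D = pairing f D * pairing g D := by
  rw [pairing, pairing, pairing, Finsupp.prod, Finsupp.prod, Finsupp.prod, ← Finset.prod_mul_distrib]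
  refine Finset.prod_congr rfl fun P hP => ?_
  have := Finsupp.mem_support_iff.mp hP
  rw [unitVal_mul hf hg (fun h0 => hf' P h0 this) (fun h0 => hg' P h0 this), mul_zpow]

lemma pairing_inv {D : Divisor W} (hf : f ≠ 0) (hf' : ∀ P ≠ 0, D P ≠ 0 → ord P f = 0) :
    pairing f⁻¹ D = (pairing f D)⁻¹ := by
  rw [pairing, pairing, Finsupp.prod, Finsupp.prod, ← Finset.prod_inv_distrib]
  refine Finset.prod_congr rfl fun P hP => ?_
  rw [unitVal_inv hf (fun h0 => hf' P h0 (Finsupp.mem_support_iff.mp hP)), inv_zpow]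

lemma pairing_pow {D : Divisor W} (hf : f ≠ 0) (hf' : ∀ P ≠ 0, D P ≠ 0 → ord P f = 0) (n : ℕ) :
    pairing (f ^ n) D = pairing f D ^ n := by
  induction n with
  | zero => rw [pow_zero, pow_zero, ← map_one (const W), pairing_const one_ne_zero, one_zpow]
  | succ n ih =>
    rw [pow_succ, pow_succ, pairing_mul (pow_ne_zero n hf) hf (fun P h0 h => ?_) hf', ih]
    rw [ord_pow, hf' P h0 h, mul_zero]

lemma pairing_eq_valueDiv {D : Divisor W} (hf : f ≠ 0) (h : ∀ P, D P ≠ 0 → ord P f = 0) :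
    pairing f D = valueDiv f D :=
  Finset.prod_congr rfl fun P hP => by
    simp only [unitVal_eq_value hf (h P (Finsupp.mem_support_iff.mp hP))]

end Evaluation

/-! ### Weil reciprocity for functions that may meet at infinity. -/

section Reciprocity

variable [IsAlgClosed F] [W.IsElliptic]

/-- The reciprocity law for `f` and `g`, with the sign of the tame symbol at infinity. -/
def Reciprocal (f g : W.FunctionField) : Prop :=
  pairing f (divOf g) = (-1) ^ (ord 0 f * ord 0 g) * pairing g (divOf f)

variable {f f' g : W.FunctionField}

omit [IsAlgClosed F] in
lemma neg_one_zpow_mul_self (k : ℤ) : (-1 : F) ^ k * (-1) ^ k = 1 := by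
  rw [← mul_zpow]; simp

lemma Reciprocal.symm (h : Reciprocal f g) : Reciprocal g f := by
  rw [Reciprocal] at h ⊢
  rw [h, ← mul_assoc, mul_comm (ord 0 g), neg_one_zpow_mul_self, one_mul]

lemma reciprocal_one (g : W.FunctionField) : Reciprocal 1 g := by
  rw [Reciprocal, ord_one, zero_mul, zpow_zero, one_mul, ← map_one (const W), divOf_const,
    pairing_const one_ne_zero, one_zpow, pairing_zero]

lemma Reciprocal.mul (hf : f ≠ 0) (hf' : f' ≠ 0) (h : Reciprocal f g) (h' : Reciprocal f' g)
    (hfg : ∀ P ≠ 0, ord P g ≠ 0 → ord P f = 0) (hfg' : ∀ P ≠ 0, ord P g ≠ 0 → ord P f' = 0) :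
    Reciprocal (f * f') g := by
  rw [Reciprocal] at h h' ⊢
  rw [pairing_mul hf hf' hfg hfg', h, h', divOf_mul hf hf', pairing_add, ord_mul hf hf', add_mul,
    zpow_add₀ (neg_ne_zero.mpr one_ne_zero)]
  ring

lemma Reciprocal.inv (hf : f ≠ 0) (h : Reciprocal f g)
    (hfg : ∀ P ≠ 0, ord P g ≠ 0 → ord P f = 0) : Reciprocal f⁻¹ g := by
  rw [Reciprocal] at h ⊢
  rw [pairing_inv hf hfg, h, divOf_inv, pairing_neg, ord_inv, neg_mul, zpow_neg, mul_inv]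

lemma reciprocal_const {c : F} (hc : c ≠ 0) (g : W.FunctionField) : Reciprocal (const W c) g := by
  rw [Reciprocal, ord_const, zero_mul, zpow_zero, one_mul, divOf_const, pairing_zero,
    pairing_const hc, deg_divOf, zpow_zero]

/-- The triple pole at O contributes the leading coefficient of f, which is 1. Only the three affine
intersection points remain, and `φ` gives f as a function of their abscissas. -/
lemma IsIntersection.pairing_divOf_slant {a b x₁ x₂ x₃ : F} (h : IsIntersection W a b x₁ x₂ x₃)
    (hf : IsMonic f) {φ : F → F} (hφ : ∀ t (ht : W.Nonsingular t (a * t + b)),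
      HasValueAt f (.some t _ ht) (φ t))
    (hfg : ∀ P ≠ 0, ord P (slant W a b) ≠ 0 → ord P f = 0) :
    pairing f (divOf (slant W a b)) = φ x₁ * φ x₂ * φ x₃ := by
  have key : ∀ t (ht : t = x₁ ∨ t = x₂ ∨ t = x₃),
      unitVal f (.some t _ (h.nonsingular ht)) = φ t := by
    intro t ht
    have h0 : (.some t _ (h.nonsingular ht) : W.Point) ≠ 0 := Affine.Point.some_ne_zero _
    have hs : ord (.some t _ (h.nonsingular ht)) (slant W a b) ≠ 0 :=
      (HasValueAt.ord_pos ((hasValueAt_slant a b _).congr (by ring)) (slant_ne_zero a b)).ne'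
    have hu := hasValueAt_unitVal hf.ne_zero (hfg _ h0 hs)
    exact hu.unique (hφ t _)
  rw [h.divOf_slant, pairing_sub, pairing_add, pairing_add, pairing_pt, pairing_pt, pairing_pt,
    key, key, key, pairing_zsmul, pairing_pt, hf.unitVal_eq, one_zpow, div_one]
  all_goals simp

lemma pairing_divOf_xFun_sub {c y : F} (h : W.Nonsingular c y) (hf : IsMonic f) {a b : F}
    (ha : HasValueAt f (.some c y h) a) (hb : HasValueAt f (-.some c y h) b)
    (hfg : ∀ P ≠ 0, ord P (xFun W - const W c) ≠ 0 → ord P f = 0) :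
    pairing f (divOf (xFun W - const W c)) = a * b := by
  have key : ∀ y' (h' : W.Nonsingular c y') (a' : F), HasValueAt f (.some c y' h') a' →
      unitVal f (.some c y' h') = a' := by
    intro y' h' a' ha'
    have h0 : (.some c y' h' : W.Point) ≠ 0 := Affine.Point.some_ne_zero _
    have hs : ord (.some c y' h' : W.Point) (xFun W - const W c) ≠ 0 :=
      (HasValueAt.ord_pos (((hasValueAt_xFun h').sub (HasValueAt.const _ c)).congr (sub_self c))
        (isMonic_xFun_sub c).ne_zero).ne'
    exact (hasValueAt_unitVal hf.ne_zero (hfg _ h0 hs)).unique ha'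
  rw [divOf_xFun_sub h, pairing_sub, pairing_add, pairing_pt, pairing_pt, key _ _ _ ha,
    pairing_zsmul, pairing_pt, hf.unitVal_eq, one_zpow, div_one, Affine.Point.neg_some,
    key _ _ _ hb]

lemma ord_xFun_sub_zero (c : F) : ord 0 (xFun W - const W c) = -2 := by
  obtain ⟨y, h⟩ := exists_point_of_x (W := W) c
  have h0 : -(.some c y h : W.Point) ≠ 0 := Affine.Point.some_ne_zero _
  rw [← divOf_apply, divOf_xFun_sub h, Finsupp.sub_apply, Finsupp.add_apply, Finsupp.smul_apply,
    pt_apply_of_ne (Affine.Point.some_ne_zero _), pt_apply_of_ne h0, pt, Finsupp.single_eq_same]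
  rfl

/-- On one line the function of the other is linear in the abscissa. Evaluating the two cubics at
the abscissa where the lines cross gives the same value, since both are the Weierstrass polynomial
at the crossing point. Exchanging a, b with a', b' in a product of three factors gives the sign
(-1)³ = (-1)⁹. Parallel lines, which do not cross, are immediate. -/
lemma reciprocal_slant_slant {a b a' b' : F}
    (h : ∀ P ≠ 0, ord P (slant W a b) = 0 ∨ ord P (slant W a' b') = 0) :
    Reciprocal (slant W a b) (slant W a' b') := by
  obtain ⟨x₁, x₂, x₃, hx⟩ := exists_isIntersection W a b
  obtain ⟨x₁', x₂', x₃', hx'⟩ := exists_isIntersection W a' b'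
  rw [Reciprocal, hx'.pairing_divOf_slant (slant_zero a b).2
    (φ := fun t => (a' - a) * t + (b' - b))
    (fun t ht => (hasValueAt_slant a b ht).congr (by ring)) (fun P h0 hP => (h P h0).resolve_right hP),
    hx.pairing_divOf_slant (slant_zero a' b').2 (φ := fun t => (a - a') * t + (b - b'))
    (fun t ht => (hasValueAt_slant a' b' ht).congr (by ring))
    (fun P h0 hP => (h P h0).resolve_left hP), (slant_zero a b).1, (slant_zero a' b').1]
  have hs : (-1 : F) ^ ((-3 : ℤ) * -3) = -1 := by norm_num
  rw [hs]
  by_cases hd : a' - a = 0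
  · rw [← sub_eq_zero.mp hd]
    have : a' = a := sub_eq_zero.mp hd
    simp only [this, sub_self]
    ring
  · have h1 := hx.eval (-(b' - b) / (a' - a))
    have h2 := hx'.eval (-(b' - b) / (a' - a))
    have h3 : a * (-(b' - b) / (a' - a)) + b = a' * (-(b' - b) / (a' - a)) + b' := by
      field_simp; ring
    rw [h3, h2] at h1
    have h4 : ∀ t, (-(b' - b) / (a' - a)) - t = -((a' - a) * t + (b' - b)) / (a' - a) := by
      intro t; field_simp; ring
    simp only [h4] at h1
    have h5 := pow_ne_zero 3 hd
    field_simp at h1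
    linear_combination h1

/-- Both sides equal the Weierstrass polynomial at (c, ac + b): once factored over the three
intersection points, once over the two points with abscissa c. -/
lemma reciprocal_vertical_slant {a b c : F}
    (h : ∀ P ≠ 0, ord P (xFun W - const W c) = 0 ∨ ord P (slant W a b) = 0) :
    Reciprocal (xFun W - const W c) (slant W a b) := by
  obtain ⟨x₁, x₂, x₃, hx⟩ := exists_isIntersection W a b
  obtain ⟨y, hy⟩ := exists_point_of_x (W := W) c
  rw [Reciprocal, hx.pairing_divOf_slant (isMonic_xFun_sub c) (φ := fun t => t - c)
    (fun t ht => (hasValueAt_xFun ht).sub (HasValueAt.const _ c))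
    (fun P h0 hP => (h P h0).resolve_right hP), pairing_divOf_xFun_sub hy (slant_zero a b).2
    (hasValueAt_slant a b _) (hasValueAt_slant a b _) (fun P h0 hP => (h P h0).resolve_left hP),
    (slant_zero a b).1, ord_xFun_sub_zero]
  have h1 := hx.eval c
  have h2 := (Affine.equation_iff ..).mp hy.1
  rw [Affine.evalEval_polynomial] at h1
  have hs : (-1 : F) ^ ((-2 : ℤ) * -3) = 1 := by norm_num
  rw [hs, Affine.negY]
  linear_combination -h1 + h2

lemma reciprocal_vertical_vertical {c c' : F}
    (h : ∀ P ≠ 0, ord P (xFun W - const W c) = 0 ∨ ord P (xFun W - const W c') = 0) :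
    Reciprocal (xFun W - const W c) (xFun W - const W c') := by
  obtain ⟨y, hy⟩ := exists_point_of_x (W := W) c
  obtain ⟨y', hy'⟩ := exists_point_of_x (W := W) c'
  rw [Reciprocal, pairing_divOf_xFun_sub hy' (isMonic_xFun_sub c)
    ((hasValueAt_xFun _).sub (HasValueAt.const _ c))
    ((hasValueAt_xFun _).sub (HasValueAt.const _ c)) (fun P h0 hP => (h P h0).resolve_right hP),
    pairing_divOf_xFun_sub hy (isMonic_xFun_sub c')
    ((hasValueAt_xFun _).sub (HasValueAt.const _ c'))
    ((hasValueAt_xFun _).sub (HasValueAt.const _ c')) (fun P h0 hP => (h P h0).resolve_left hP),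
    ord_xFun_sub_zero, ord_xFun_sub_zero]
  have hs : (-1 : F) ^ ((-2 : ℤ) * -2) = 1 := by norm_num
  rw [hs]
  ring

lemma reciprocal_of_isLine (hf : IsLine f) (hg : IsLine g) (h : ∀ P ≠ 0, ord P f = 0 ∨ ord P g = 0) :
    Reciprocal f g := by
  rcases hf with ⟨a, b, rfl⟩ | ⟨c, rfl⟩ <;> rcases hg with ⟨a', b', rfl⟩ | ⟨c', rfl⟩
  · exact reciprocal_slant_slant h
  · exact (reciprocal_vertical_slant fun P h0 => (h P h0).symm).symm
  · exact reciprocal_vertical_slant h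
  · exact reciprocal_vertical_vertical h

/-- The divisor of f is a combination of divisors of lines that avoid the affine zeros and poles of
g, and the law is multiplicative in f. The constant left over is harmless because div g has degree
0. -/
lemma reciprocal_of_forall_isLine (hf : f ≠ 0)
    (h : ∀ u, IsLine u → (∀ P ≠ 0, ord P g ≠ 0 → ord P u = 0) → Reciprocal u g)
    (hfg : ∀ P ≠ 0, ord P f = 0 ∨ ord P g = 0) : Reciprocal f g := by
  classical
  set Z : Set W.Point := {P | P ≠ 0 ∧ ord P g ≠ 0} with hZ
  have hfin : Z.Finite := (finite_support_ord g).subset fun P hP => hP.2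
  have key : ∀ D ∈ lineDivisors Z, ∃ f : W.FunctionField, f ≠ 0 ∧ divOf f = D ∧
      (∀ P ≠ 0, ord P g ≠ 0 → ord P f = 0) ∧ Reciprocal f g := by
    intro D hD
    induction hD using AddSubgroup.closure_induction with
    | mem D hu =>
      obtain ⟨u, hu, hu', rfl⟩ := hu
      have hu'' : ∀ P ≠ 0, ord P g ≠ 0 → ord P u = 0 := fun P h0 hP => hu' P ⟨h0, hP⟩
      exact ⟨u, hu.isMonic.ne_zero, rfl, hu'', h u hu hu''⟩
    | zero => exact ⟨1, one_ne_zero, by rw [← map_one (const W), divOf_const], by simp,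
        reciprocal_one g⟩
    | add D D' _ _ h1 h2 =>
      obtain ⟨f, hf, rfl, h3, h4⟩ := h1
      obtain ⟨f', hf', rfl, h3', h4'⟩ := h2
      refine ⟨f * f', mul_ne_zero hf hf', divOf_mul hf hf', fun P h0 hP => ?_,
        h4.mul hf hf' h4' h3 h3'⟩
      rw [ord_mul hf hf', h3 P h0 hP, h3' P h0 hP, add_zero]
    | neg D _ h1 =>
      obtain ⟨f, hf, rfl, h3, h4⟩ := h1
      refine ⟨f⁻¹, inv_ne_zero hf, divOf_inv, fun P h0 hP => ?_, h4.inv hf h3⟩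
      rw [ord_inv, h3 P h0 hP, neg_zero]
  obtain ⟨f₁, hf₁, hd, h1, h2⟩ := key (divOf f) (mem_lineDivisors hfin (fun h0 => h0.1 rfl)
    (fun P hP => (hfg P hP.1).resolve_right hP.2) (deg_divOf f) (pointSum_divOf f))
  obtain ⟨c, hc, rfl⟩ := exists_const_mul_of_divOf_eq hf hf₁ hd.symm
  exact (reciprocal_const hc g).mul ((_root_.map_ne_zero _).mpr hc) hf₁ h2
    (fun P _ _ => ord_const ..) h1

/-- Weil reciprocity, for functions without common affine zeros and poles. -/
theorem reciprocal (hf : f ≠ 0) (hg : g ≠ 0) (h : ∀ P ≠ 0, ord P f = 0 ∨ ord P g = 0) :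
    Reciprocal f g := by
  refine reciprocal_of_forall_isLine hf (fun u hu hug => ?_) h
  -- After f has been replaced by a line u, symmetry allows g to be replaced by lines v that avoid
  -- the affine zeros of u.
  refine (reciprocal_of_forall_isLine hg (fun v hv hvu => ?_) fun P h0 => ?_).symm
  · exact reciprocal_of_isLine hv hu fun P h0 => or_iff_not_imp_right.mpr (hvu P h0)
  · exact or_iff_not_imp_left.mpr (hug P h0)

/-- Weil reciprocity, for functions without common zeros and poles. -/
theorem pairing_divOf_comm (hf : f ≠ 0) (hg : g ≠ 0) (h : ∀ P, ord P f = 0 ∨ ord P g = 0) :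
    pairing f (divOf g) = pairing g (divOf f) := by
  have h1 := reciprocal hf hg fun P _ => h P
  rw [Reciprocal, mul_eq_zero.mpr (h 0), zpow_zero, one_mul] at h1
  exact h1

end Reciprocity

end WeilPairing

namespace WeilPairing

variable {F : Type*} [Field F] {W : Affine F}

/-! ### Points over the function field -/

section GenericPoint

noncomputable instance : DecidableEq W.FunctionField := Classical.decEq _

variable (W) in
/-- The points over the function field. -/
abbrev FPoint : Type _ := (W.baseChange W.FunctionField).Point

lemma equation_baseChange_iff {a b : W.FunctionField} :
    (W.baseChange W.FunctionField).Equation a b ↔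
      b ^ 2 + const W W.a₁ * a * b + const W W.a₃ * b =
        a ^ 3 + const W W.a₂ * a ^ 2 + const W W.a₄ * a + const W W.a₆ :=
  Affine.equation_iff ..

/-- The inclusion of the points over `F` into the points over the function field. -/
noncomputable def constPoint [DecidableEq F] : W.Point →+ FPoint W :=
  (Affine.Point.map (W' := W) (Algebra.ofId F W.FunctionField) : (W.baseChange F).Point →+ FPoint W)

/-- The action of an endomorphism of the function field on the points over the function field. -/
noncomputable def mapPoint (σ : W.FunctionField →ₐ[F] W.FunctionField) : FPoint W →+ FPoint W :=
  Affine.Point.map (W' := W) σ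

lemma nonsingular_const {x y : F} (h : W.Nonsingular x y) :
    (W.baseChange W.FunctionField).Nonsingular (const W x) (const W y) :=
  (Affine.map_nonsingular W (algebraMap F W.FunctionField).injective x y).mpr h

lemma constPoint_some [DecidableEq F] {x y : F} (h : W.Nonsingular x y) :
    constPoint (.some x y h) = .some (const W x) (const W y) (nonsingular_const h) := rfl

lemma nonsingular_map (σ : W.FunctionField →ₐ[F] W.FunctionField) {a b : W.FunctionField}
    (h : (W.baseChange W.FunctionField).Nonsingular a b) :
    (W.baseChange W.FunctionField).Nonsingular (σ a) (σ b) :=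
  (Affine.baseChange_nonsingular W σ.injective a b).mpr h

lemma mapPoint_some (σ : W.FunctionField →ₐ[F] W.FunctionField) {a b : W.FunctionField}
    (h : (W.baseChange W.FunctionField).Nonsingular a b) :
    mapPoint σ (.some a b h) = .some (σ a) (σ b) (nonsingular_map σ h) := rfl

lemma mapPoint_constPoint [DecidableEq F] (σ : W.FunctionField →ₐ[F] W.FunctionField)
    (Q : W.Point) : mapPoint σ (constPoint Q) = constPoint Q := by
  match Q with
  | 0 => rw [map_zero, map_zero]
  | .some x y h =>
    rw [constPoint_some, mapPoint_some]
    simp only [map_const]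

lemma mapPoint_comp (σ τ : W.FunctionField →ₐ[F] W.FunctionField) (A : FPoint W) :
    mapPoint (σ.comp τ) A = mapPoint σ (mapPoint τ A) := by
  match A with
  | 0 => rw [map_zero, map_zero, map_zero]
  | .some a b h => rfl

variable [W.IsElliptic]

instance isElliptic_baseChange : (W.baseChange W.FunctionField).IsElliptic :=
  inferInstanceAs (WeierstrassCurve.map W (algebraMap F W.FunctionField)).IsElliptic

lemma nonsingular_generic : (W.baseChange W.FunctionField).Nonsingular (xFun W) (yFun W) :=
  Affine.equation_iff_nonsingular.mp (equation_baseChange_iff.mpr xFun_yFun_equation)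

variable (W) in
/-- The generic point. -/
noncomputable def generic : FPoint W := .some (xFun W) (yFun W) nonsingular_generic

lemma mapPoint_generic (σ : W.FunctionField →ₐ[F] W.FunctionField) :
    mapPoint σ (generic W) = .some (σ (xFun W)) (σ (yFun W)) (nonsingular_map σ nonsingular_generic) := rfl

lemma algHom_ext_generic {σ τ : W.FunctionField →ₐ[F] W.FunctionField}
    (h : mapPoint σ (generic W) = mapPoint τ (generic W)) : σ = τ := by
  rw [mapPoint_generic, mapPoint_generic, Affine.Point.some.injEq] at h
  exact algHom_ext h.1 h.2

variable [DecidableEq F]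

lemma generic_ne_constPoint (Q : W.Point) : generic W ≠ constPoint Q := by
  match Q with
  | 0 => rw [map_zero]; exact Affine.Point.some_ne_zero _
  | .some x y h =>
    rw [constPoint_some, generic, Ne, Affine.Point.some.injEq]
    exact fun h => xFun_ne_const x h.1

variable [IsAlgClosed F]

/-- A point over the function field is either constant or the image of the generic point. -/
lemma eq_constPoint_or_eq_mapPoint (A : FPoint W) :
    (∃ Q, A = constPoint Q) ∨ ∃ σ, A = mapPoint σ (generic W) := by
  match A with
  | 0 => exact .inl ⟨0, (map_zero _).symm⟩
  | .some a b h =>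
    have hE := equation_baseChange_iff.mp h.1
    by_cases ha : ∃ c, a = const W c
    · left
      obtain ⟨c, rfl⟩ := ha
      obtain ⟨y, hy⟩ := exists_point_of_x (W := W) c
      -- For a constant abscissa c the equation for b is a quadratic that already splits over F,
      -- with roots y and its conjugate.
      have hy' : b = const W y ∨ b = const W (W.negY c y) := by
        rw [← sub_eq_zero, ← sub_eq_zero (a := b) (b := const W (W.negY c y)), ← mul_eq_zero]
        have h2 := congrArg (const W) ((Affine.equation_iff ..).mp hy.1)
        simp only [map_add, map_mul, map_pow] at h2
        rw [Affine.negY]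
        simp only [map_sub, map_mul, map_neg]
        linear_combination hE - h2
      rcases hy' with rfl | rfl
      · exact ⟨.some c y hy, rfl⟩
      · exact ⟨-.some c y hy, rfl⟩
    · right
      push Not at ha
      obtain ⟨σ, rfl, rfl⟩ := exists_algHom ha hE
      exact ⟨σ, rfl⟩

lemma exists_mapPoint_eq {A : FPoint W} (hA : ∀ Q, A ≠ constPoint Q) :
    ∃ σ, mapPoint σ (generic W) = A := by
  rcases eq_constPoint_or_eq_mapPoint A with ⟨Q, hQ⟩ | ⟨σ, hσ⟩
  · exact absurd hQ (hA Q)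
  · exact ⟨σ, hσ.symm⟩

end GenericPoint

/-! ### Specialization -/

section Specialization

/-- `S` is the value at `P` of the rational map to the curve given by `A`. -/
def IsSpec (P : W.Point) : FPoint W → W.Point → Prop
  | .zero, S => S = 0
  | .some a b _, .zero => b ≠ 0 ∧ HasValueAt (a / b) P 0 ∧ HasValueAt (1 / b) P 0
  | .some a b _, .some x y _ => HasValueAt a P x ∧ HasValueAt b P y

lemma IsSpec.unique {P : W.Point} {A : FPoint W} {S S' : W.Point} (h : IsSpec P A S)
    (h' : IsSpec P A S') : S = S' := by
  have key : ∀ {b : W.FunctionField} {y : F}, HasValueAt b P y → b ≠ 0 →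
      HasValueAt (1 / b) P 0 → False := by
    intro b y hb hb0 hb'
    have h1 := hb.mul hb'
    rw [mul_one_div_cancel hb0, mul_zero] at h1
    exact one_ne_zero ((HasValueAt.one P).unique h1)
  match A, S, S', h, h' with
  | 0, _, _, h, h' => exact Eq.trans h (Eq.symm h')
  | .some a b _, 0, 0, _, _ => rfl
  | .some a b _, .some x y _, 0, h, h' => exact (key h.2 h'.1 h'.2.2).elim
  | .some a b _, 0, .some x y _, h, h' => exact (key h'.2 h.1 h.2.2).elim
  | .some a b _, .some x y hx, .some x' y' hx', h, h' =>
    obtain rfl := h.1.unique h'.1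
    obtain rfl := h.2.unique h'.2
    rfl

lemma isSpec_constPoint [DecidableEq F] (P Q : W.Point) : IsSpec P (constPoint Q) Q := by
  match Q with
  | 0 => rfl
  | .some x y h => exact ⟨HasValueAt.const P x, HasValueAt.const P y⟩

variable [W.IsElliptic]

lemma isSpec_generic (P : W.Point) : IsSpec P (generic W) P := by
  match P with
  | 0 => exact ⟨yFun_ne_zero, HasValueAt.chart_fst 0, HasValueAt.chart_snd 0⟩
  | .some x y h => exact ⟨hasValueAt_xFun h, hasValueAt_yFun h⟩

lemma IsSpec.map {σ : W.FunctionField →ₐ[F] W.FunctionField} {P S : W.Point} {A : FPoint W}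
    (h : IsSpec (pull σ P) A S) : IsSpec P (mapPoint σ A) S := by
  match A, S, h with
  | 0, _, h => exact h
  | .some a b _, 0, h =>
    refine ⟨(_root_.map_ne_zero σ).mpr h.1, ?_, ?_⟩
    · rw [← map_div₀]; exact h.2.1.map
    · have := h.2.2.map
      rwa [map_div₀, map_one] at this
  | .some a b _, .some x y _, h => exact ⟨h.1.map, h.2.map⟩

variable [IsAlgClosed F] [DecidableEq F]

lemma exists_isSpec (P : W.Point) (A : FPoint W) : ∃ S, IsSpec P A S := by
  rcases eq_constPoint_or_eq_mapPoint A with ⟨Q, rfl⟩ | ⟨σ, rfl⟩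
  · exact ⟨Q, isSpec_constPoint P Q⟩
  · exact ⟨_, (isSpec_generic (pull σ P)).map⟩

/-- The value at `P` of the rational map to the curve given by `A`. -/
noncomputable def spec (P : W.Point) (A : FPoint W) : W.Point := (exists_isSpec P A).choose

lemma isSpec_spec (P : W.Point) (A : FPoint W) : IsSpec P A (spec P A) :=
  (exists_isSpec P A).choose_spec

lemma IsSpec.spec_eq {P S : W.Point} {A : FPoint W} (h : IsSpec P A S) : spec P A = S :=
  (isSpec_spec P A).unique h

lemma spec_constPoint (P Q : W.Point) : spec P (constPoint Q) = Q := (isSpec_constPoint P Q).spec_eq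

lemma spec_generic (P : W.Point) : spec P (generic W) = P := (isSpec_generic P).spec_eq

lemma spec_mapPoint (σ : W.FunctionField →ₐ[F] W.FunctionField) (P : W.Point) (A : FPoint W) :
    spec P (mapPoint σ A) = spec (pull σ P) A := (isSpec_spec (pull σ P) A).map.spec_eq

lemma pull_eq_spec (σ : W.FunctionField →ₐ[F] W.FunctionField) (P : W.Point) :
    pull σ P = spec P (mapPoint σ (generic W)) := by rw [spec_mapPoint, spec_generic]

omit [W.IsElliptic] [IsAlgClosed F] in
-- When S and T are affine with S ≠ ±T, the denominator a - a' of the chord formulas does not vanish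
-- at P, so they can be evaluated term by term. The degenerate cases are deferred to `spec_add`,
-- which uses translations.
lemma IsSpec.add {P : W.Point} {A B : FPoint W} {S T : W.Point} (hA : IsSpec P A S)
    (hB : IsSpec P B T) (hS : S ≠ 0) (hT : T ≠ 0) (h : S ≠ T) (h' : S ≠ -T) :
    IsSpec P (A + B) (S + T) := by
  match A, B, S, T, hA, hB, hS, hT with
  | 0, _, _, _, hA, _, hS, _ => exact absurd hA hS
  | .some _ _ _, 0, _, _, _, hB, _, hT => exact absurd hB hT
  | .some a b hab, .some a' b' hab', .some x y hxy, .some x' y' hxy', hA, hB, _, _ =>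
    have hx : x ≠ x' := fun hx => (Affine.Point.X_eq_iff.mp hx).elim h h'
    have ha : a ≠ a' := by
      rintro rfl
      exact hx (hA.1.unique hB.1)
    have hc := HasValueAt.const P (W := W)
    have hs : HasValueAt ((b - b') / (a - a')) P ((y - y') / (x - x')) :=
      (hA.2.sub hB.2).div (hA.1.sub hB.1) (sub_ne_zero.mpr hx)
    rw [Affine.Point.add_of_X_ne ha, Affine.Point.add_of_X_ne hx]
    simp only [Affine.slope_of_X_ne ha, Affine.slope_of_X_ne hx, Affine.addX, Affine.addY,
      Affine.negAddY, Affine.negY]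
    have h1 := ((((hs.pow 2).add ((hc W.a₁).mul hs)).sub (hc W.a₂)).sub hA.1).sub hB.1
    exact ⟨h1, ((((hs.mul (h1.sub hA.1)).add hA.2).neg.sub ((hc W.a₁).mul h1)).sub (hc W.a₃))⟩

lemma spec_add_of_ne {P : W.Point} {A B : FPoint W} (hS : spec P A ≠ 0) (hT : spec P B ≠ 0)
    (h : spec P A ≠ spec P B) (h' : spec P A ≠ -spec P B) :
    spec P (A + B) = spec P A + spec P B :=
  ((isSpec_spec P A).add (isSpec_spec P B) hS hT h h').spec_eq

end Specialization

/-! ### Translations as automorphisms, and additivity of specialization. -/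

section Translation

variable [W.IsElliptic] [IsAlgClosed F] [DecidableEq F]

lemma exists_transHom (Q : W.Point) : ∃ σ, mapPoint σ (generic W) = generic W + constPoint Q := by
  refine exists_mapPoint_eq fun Q' h => generic_ne_constPoint (Q' - Q) ?_
  rw [map_sub, ← h, add_sub_cancel_right]

/-- The automorphism of the function field given by the translation by `Q`. -/
noncomputable def transHom (Q : W.Point) : W.FunctionField →ₐ[F] W.FunctionField :=
  (exists_transHom Q).choose

lemma mapPoint_transHom (Q : W.Point) :
    mapPoint (transHom Q) (generic W) = generic W + constPoint Q := (exists_transHom Q).choose_spec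

lemma transHom_comp (Q Q' : W.Point) : (transHom Q).comp (transHom Q') = transHom (Q + Q') := by
  refine algHom_ext_generic ?_
  rw [mapPoint_comp, mapPoint_transHom, map_add, mapPoint_transHom, mapPoint_constPoint,
    mapPoint_transHom, map_add, add_assoc]

lemma transHom_zero : transHom (0 : W.Point) = AlgHom.id F W.FunctionField := by
  refine algHom_ext_generic ?_
  rw [mapPoint_transHom, map_zero, add_zero]
  rfl

lemma transHom_neg_comp (Q : W.Point) :
    (transHom Q).comp (transHom (-Q)) = AlgHom.id F W.FunctionField := by
  rw [transHom_comp, add_neg_cancel, transHom_zero]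

lemma transHom_comp_neg (Q : W.Point) :
    (transHom (-Q)).comp (transHom Q) = AlgHom.id F W.FunctionField := by
  rw [transHom_comp, neg_add_cancel, transHom_zero]

lemma ram_transHom (Q P : W.Point) : ram (transHom Q) P = 1 :=
  ram_eq_one_of_comp (transHom_neg_comp Q) P

lemma pull_transHom_pull (Q P : W.Point) :
    pull (transHom Q) (pull (transHom (-Q)) P) = P := by
  rw [← pull_comp, transHom_comp_neg, pull_id]

open Filter in
lemma eventually_pull_transHom (Q : W.Point) :
    ∀ᶠ R in cofinite, pull (transHom Q) R = R + Q := by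
  by_cases hQ : Q = 0
  · exact .of_forall fun R => by rw [hQ, transHom_zero, pull_id, add_zero]
  filter_upwards [(Set.finite_singleton (0 : W.Point)).compl_mem_cofinite,
    (Set.finite_singleton Q).compl_mem_cofinite, (Set.finite_singleton (-Q)).compl_mem_cofinite]
    with R h0 h1 h2
  rw [pull_eq_spec, mapPoint_transHom, spec_add_of_ne, spec_generic, spec_constPoint]
  · rwa [spec_generic]
  · rwa [spec_constPoint]
  · rwa [spec_generic, spec_constPoint]
  · rwa [spec_generic, spec_constPoint]

/-- The direct image of div f is the divisor of f translated by -Q, as translations are bijective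
and unramified; principal divisors have sum zero. -/
lemma pointSum_mapDomain_pull (Q : W.Point) {D : Divisor W} (hdeg : deg D = 0)
    (hsum : pointSum D = 0) : pointSum (D.mapDomain (pull (transHom Q))) = 0 := by
  obtain ⟨f, hf, rfl⟩ := exists_divOf_eq hdeg hsum
  have hinj : Function.Injective (pull (transHom Q)) := fun P P' h => by
    have e := fun P => pull_transHom_pull (-Q) P
    simp only [neg_neg] at e
    rw [← e P, h, e]
  have : (divOf f).mapDomain (pull (transHom Q)) = divOf (transHom (-Q) f) := by
    ext P
    conv_lhs => rw [← pull_transHom_pull Q P]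
    rw [Finsupp.mapDomain_apply hinj, divOf_apply, divOf_apply, ord_map, ram_transHom, one_mul]
  rw [this, pointSum_divOf]

/-- Let ψ be the induced map on points. It preserves principal divisors, and [A] + [B] - [A+B] - [O]
is principal, so ψ - ψ(O) is additive. Since ψ(R) = R + Q for all but finitely many R, taking B with
B and A + B both generic settles every A. Thus no addition formula is needed at the exceptional
points. -/
theorem pull_transHom (Q P : W.Point) : pull (transHom Q) P = P + Q := by
  have hev := eventually_pull_transHom Q
  have hsum : ∀ D : Divisor W, _ := fun D => pointSum_mapDomain_pull Q (D := D)
  generalize pull (transHom Q) = ψ at hev hsum ⊢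
  have key : ∀ A B, ψ A + ψ B = ψ (A + B) + ψ 0 := by
    intro A B
    have h := hsum (pt A + pt B - pt (A + B) - pt 0) (by simp) (by simp)
    simp only [pt, sub_eq_add_neg, ← Finsupp.single_neg, Finsupp.mapDomain_add,
      Finsupp.mapDomain_single, map_add] at h
    simp only [pointSum, Finsupp.liftAddHom_apply_single, zmultiplesHom_apply, one_smul,
      neg_smul] at h
    refine sub_eq_zero.mp (Eq.trans ?_ h)
    abel
  have hgen : ∀ A, ψ A = A + ψ 0 := by
    intro A
    obtain ⟨B, h1, h2⟩ := (hev.and (((add_right_injective A).tendsto_cofinite).eventually hev)).exists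
    have := key A B
    rw [h1, h2] at this
    refine sub_eq_zero.mp (Eq.trans ?_ (sub_eq_zero.mpr this))
    abel
  obtain ⟨A, h1⟩ := hev.exists
  rw [hgen] at h1
  rw [hgen, add_left_cancel h1]

lemma ord_transHom (Q P : W.Point) (f : W.FunctionField) : ord P (transHom Q f) = ord (P + Q) f := by
  rw [ord_map, ram_transHom, one_mul, pull_transHom]

lemma isTranslate_transHom (Q : W.Point) (f : W.FunctionField) :
    IsTranslate Q f (transHom Q f) := fun R =>
  toMap_eq_toMap fun c => by rw [hasValueAt_map_iff, pull_transHom]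

lemma spec_add_constPoint (P Q : W.Point) (A : FPoint W) :
    spec P (A + constPoint Q) = spec P A + Q := by
  rcases eq_constPoint_or_eq_mapPoint A with ⟨Q', rfl⟩ | ⟨σ, rfl⟩
  · rw [← map_add, spec_constPoint, spec_constPoint]
  · have : mapPoint σ (generic W) + constPoint Q = mapPoint σ (generic W + constPoint Q) := by
      rw [map_add, mapPoint_constPoint]
    rw [this, ← mapPoint_transHom, spec_mapPoint, ← pull_eq_spec, pull_transHom, pull_eq_spec]

open Filter in
/-- Specialization is a homomorphism. -/
theorem spec_add (P : W.Point) (A B : FPoint W) : spec P (A + B) = spec P A + spec P B := by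
  have hne : ∀ R : W.Point, ∀ᶠ Q in cofinite, Q ≠ R := fun R =>
    (Set.finite_singleton R).compl_mem_cofinite
  -- Constant translations of A and B bring the two specializations into general position; they are
  -- removed again by `spec_add_constPoint`.
  obtain ⟨Q', hQ'⟩ := (hne (-spec P B)).exists
  set T := spec P B + Q' with hT
  obtain ⟨Q, h1, h2, h3⟩ := ((hne (-spec P A)).and ((hne (T - spec P A)).and
    (hne (-T - spec P A)))).exists
  have h := spec_add_of_ne (P := P) (A := A + constPoint Q) (B := B + constPoint Q')
  simp only [spec_add_constPoint] at h
  have h4 := h (fun h => h1 (eq_neg_of_add_eq_zero_right h))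
    (fun h => hQ' (eq_neg_of_add_eq_zero_right h)) (fun h => h2 (by rw [hT, ← h]; abel))
    (fun h => h3 (by rw [hT, ← h]; abel))
  rw [add_add_add_comm, ← map_add, spec_add_constPoint, add_add_add_comm] at h4
  exact add_right_cancel h4

/-- Specialization at `P`, as a homomorphism. -/
noncomputable def specHom (P : W.Point) : FPoint W →+ W.Point :=
  AddMonoidHom.mk' (spec P) (spec_add P)

lemma spec_nsmul (P : W.Point) (n : ℕ) (A : FPoint W) : spec P (n • A) = n • spec P A :=
  map_nsmul (specHom P) n A

end Translation

end WeilPairing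

namespace WeilPairing

variable {F : Type*} [Field F] {W : Affine F}

/-! ### The invariant derivation -/

section Derivation

/-- The partial derivative of the Weierstrass equation in `Y`. -/
noncomputable def psi (a b : W.FunctionField) : W.FunctionField :=
  2 * b + const W W.a₁ * a + const W W.a₃

/-- Minus the partial derivative of the Weierstrass equation in `X`. -/
noncomputable def chi (a b : W.FunctionField) : W.FunctionField :=
  3 * a ^ 2 + 2 * const W W.a₂ * a + const W W.a₄ - const W W.a₁ * b

open TrivSqZeroExt

variable (W) in
/-- The first order deformation of the generic point along the invariant vector field, on the
coordinate ring. -/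
noncomputable def flowRing : W.CoordinateRing →+* DualNumber W.FunctionField :=
  AdjoinRoot.lift (eval₂RingHom ((inlHom W.FunctionField W.FunctionField).comp (const W))
    (inl (xFun W) + inr (psi (xFun W) (yFun W)))) (inl (yFun W) + inr (chi (xFun W) (yFun W))) (by
    have h := xFun_yFun_equation (W := W)
    simp only [Affine.polynomial, eval₂_sub, eval₂_add, eval₂_mul, eval₂_pow, eval₂_X, eval₂_C,
      coe_eval₂RingHom]
    refine TrivSqZeroExt.ext ?_ ?_
    · simp
      linear_combination h
    -- The first order part is ψ·∂_X + χ·∂_Y applied to the Weierstrass polynomial, and (∂_X, ∂_Y)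
    -- of it is (-χ, ψ).
    · simp [pow_succ, psi, chi]
      ring)

lemma fst_flowRing (r : W.CoordinateRing) : (flowRing W r).fst = algebraMap _ W.FunctionField r := by
  have : ((fstHom W.FunctionField W.FunctionField W.FunctionField :
      DualNumber W.FunctionField →+* W.FunctionField).comp (flowRing W)).comp (Affine.CoordinateRing.mk W) =
      (algebraMap W.CoordinateRing W.FunctionField).comp (Affine.CoordinateRing.mk W) := by
    refine Polynomial.ringHom_ext' (Polynomial.ringHom_ext' ?_ ?_) ?_
    · ext c
      simp [flowRing, Affine.CoordinateRing.mk, -AdjoinRoot.mk_C]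
      rfl
    · simp [flowRing, Affine.CoordinateRing.mk, -AdjoinRoot.mk_C]
      rfl
    · simp [flowRing, Affine.CoordinateRing.mk, -AdjoinRoot.mk_C]
      rfl
  obtain ⟨A, rfl⟩ := AdjoinRoot.mk_surjective r
  exact congr($this A)

variable (W) in
/-- The first order deformation of the generic point along the invariant vector field. -/
noncomputable def flow : W.FunctionField →+* DualNumber W.FunctionField :=
  IsLocalization.lift (M := nonZeroDivisors W.CoordinateRing) (g := flowRing W) fun r => by
    rw [TrivSqZeroExt.isUnit_iff_isUnit_fst, fst_flowRing, isUnit_iff_ne_zero, Ne,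
      map_eq_zero_iff _ (IsFractionRing.injective _ _)]
    exact nonZeroDivisors.coe_ne_zero r

lemma flow_algebraMap (r : W.CoordinateRing) : flow W (algebraMap _ _ r) = flowRing W r :=
  IsLocalization.lift_eq _ r

lemma fst_flow (f : W.FunctionField) : (flow W f).fst = f := by
  have : (fstHom W.FunctionField W.FunctionField W.FunctionField :
      DualNumber W.FunctionField →+* W.FunctionField).comp (flow W) = RingHom.id _ := by
    refine IsLocalization.ringHom_ext (nonZeroDivisors W.CoordinateRing) ?_
    exact RingHom.ext fun r => (congrArg fst (flow_algebraMap r)).trans (fst_flowRing r)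
  exact congr($this f)

/-- The invariant derivation. -/
noncomputable def deriv (f : W.FunctionField) : W.FunctionField := (flow W f).snd

variable (f g : W.FunctionField)

lemma deriv_add : deriv (f + g) = deriv f + deriv g := by simp [deriv]

lemma deriv_sub : deriv (f - g) = deriv f - deriv g := by simp [deriv]

lemma deriv_neg : deriv (-f) = -deriv f := by simp [deriv]

lemma deriv_mul : deriv (f * g) = f * deriv g + g * deriv f := by simp [deriv, fst_flow, mul_comm]

lemma deriv_pow_two : deriv (f ^ 2) = 2 * f * deriv f := by rw [pow_two, deriv_mul]; ring

@[simp] lemma deriv_const (c : F) : deriv (const W c) = 0 := by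
  have : flow W (const W c) = inl (const W c) := by
    change flow W (algebraMap _ _ (Affine.CoordinateRing.mk W (C (C c)))) = _
    rw [flow_algebraMap]
    simp [flowRing, Affine.CoordinateRing.mk, AdjoinRoot.lift_mk, -AdjoinRoot.mk_C]
  rw [deriv, this, snd_inl]

lemma deriv_xFun : deriv (xFun W) = psi (xFun W) (yFun W) := by
  rw [deriv, xFun, flow_algebraMap]
  simp [flowRing, Affine.CoordinateRing.mk, -AdjoinRoot.mk_C]
  rfl

lemma deriv_yFun : deriv (yFun W) = chi (xFun W) (yFun W) := by
  rw [deriv, yFun, flow_algebraMap]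
  simp [flowRing, Affine.CoordinateRing.mk, -AdjoinRoot.mk_C]
  rfl

variable {f g}

lemma deriv_div (hg : g ≠ 0) : deriv (f / g) = (deriv f - f / g * deriv g) / g := by
  have h := deriv_mul (f / g) g
  rw [div_mul_cancel₀ f hg] at h
  rw [eq_div_iff hg]
  linear_combination -h

variable {P : W.Point}

lemma HasValueAt.psi {a b : F} (hf : HasValueAt f P a) (hg : HasValueAt g P b) :
    HasValueAt (psi f g) P (2 * b + W.a₁ * a + W.a₃) := by
  have hc := HasValueAt.const P (W := W)
  rw [WeilPairing.psi, ← map_ofNat (WeilPairing.const W) 2]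
  exact (((hc 2).mul hg).add ((hc W.a₁).mul hf)).add (hc W.a₃)

lemma HasValueAt.chi {a b : F} (hf : HasValueAt f P a) (hg : HasValueAt g P b) :
    HasValueAt (chi f g) P (3 * a ^ 2 + 2 * W.a₂ * a + W.a₄ - W.a₁ * b) := by
  have hc := HasValueAt.const P (W := W)
  rw [WeilPairing.chi, ← map_ofNat (WeilPairing.const W) 2, ← map_ofNat (WeilPairing.const W) 3]
  exact ((((hc 3).mul (hf.pow 2)).add (((hc 2).mul (hc W.a₂)).mul hf)).add (hc W.a₄)).sub
    ((hc W.a₁).mul hg)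

lemma deriv_inChartHom_isRegularAt (hP : P ≠ 0) (A : F[X][Y]) :
    IsRegularAt (deriv (inChartHom P A)) P := by
  match P, hP with
  | .some x y h, _ =>
    have hx := hasValueAt_xFun h
    have hy := hasValueAt_yFun h
    have h1 : IsRegularAt (deriv (chart (.some x y h)).1) (.some x y h) := by
      change IsRegularAt (deriv (xFun W - const W x)) _
      rw [deriv_sub, deriv_const, sub_zero, deriv_xFun]
      exact (hx.psi hy).isRegularAt
    have h2 : IsRegularAt (deriv (chart (.some x y h)).2) (.some x y h) := by
      change IsRegularAt (deriv (yFun W - const W y)) _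
      rw [deriv_sub, deriv_const, sub_zero, deriv_yFun]
      exact (hx.chi hy).isRegularAt
    have hmul : ∀ f g : W.FunctionField, IsRegularAt f (.some x y h) → IsRegularAt g (.some x y h) →
        IsRegularAt (deriv f) (.some x y h) → IsRegularAt (deriv g) (.some x y h) →
        IsRegularAt (deriv (f * g)) (.some x y h) := by
      intro f g hf hg hf' hg'
      rw [deriv_mul]
      exact (hf.mul hg').add (hg.mul hf')
    have hreg := fun A => (HasValueAt.inChart (.some x y h) A).isRegularAt
    have hC : ∀ p : F[X], IsRegularAt (deriv (inChartHom (.some x y h) (C p))) (.some x y h) := by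
      intro p
      induction p using Polynomial.induction_on with
      | C a => rw [inChartHom_CC, deriv_const]; exact (HasValueAt.zero _).isRegularAt
      | add p q hp hq => rw [C_add, map_add, deriv_add]; exact hp.add hq
      | monomial n a ih =>
        rw [pow_succ, ← mul_assoc, C_mul, map_mul]
        refine hmul _ _ (hreg _) (hreg _) ih ?_
        rw [inChartHom_CX]
        exact h1
    induction A using Polynomial.induction_on with
    | C p => exact hC p
    | add p q hp hq => rw [map_add, deriv_add]; exact hp.add hq
    | monomial n p ih =>
      rw [pow_succ, ← mul_assoc, map_mul]
      refine hmul _ _ (hreg _) (hreg _) ih ?_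
      rw [inChartHom_Y]
      exact h2

/-- The invariant derivation preserves regularity at affine points. -/
lemma IsRegularAt.deriv (hP : P ≠ 0) (hf : IsRegularAt f P) : IsRegularAt (deriv f) P := by
  obtain ⟨c, hc⟩ := hf
  obtain ⟨A, B, hB, h, -⟩ := hasValueAt_iff.mp hc
  have hBv := HasValueAt.inChart P B
  have hB0 := hBv.ne_zero hB
  rw [eq_div_of_mul_eq hB0 h, deriv_div hB0]
  obtain ⟨a, ha⟩ := deriv_inChartHom_isRegularAt hP A
  obtain ⟨b, hb⟩ := deriv_inChartHom_isRegularAt hP B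
  exact ((ha.sub (((HasValueAt.inChart P A).div hBv hB).mul hb)).div hBv hB).isRegularAt

/-- `l` is the multiplier of the invariant differential under the map to the curve given by `A`. -/
def IsMultiplier (l : W.FunctionField) : FPoint W → Prop
  | .zero => True
  | .some a b _ => deriv a = l * psi a b ∧ deriv b = l * chi a b

lemma isMultiplier_generic [W.IsElliptic] : IsMultiplier 1 (generic W) :=
  ⟨by rw [one_mul, deriv_xFun], by rw [one_mul, deriv_yFun]⟩

lemma isMultiplier_constPoint [DecidableEq F] (Q : W.Point) : IsMultiplier 0 (constPoint Q) := by
  match Q with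
  | 0 => trivial
  | .some x y h => exact ⟨(deriv_const x).trans (zero_mul _).symm, (deriv_const y).trans (zero_mul _).symm⟩

/-- The additivity of the invariant differential, checked on the chord formulas; the excluded cases
are exactly those in which the chord formulas do not apply. -/
lemma IsMultiplier.add {l m : W.FunctionField} {A B : FPoint W} (hA : IsMultiplier l A)
    (hB : IsMultiplier m B) (hA0 : A ≠ 0) (hB0 : B ≠ 0) (h : A ≠ B) (h' : A ≠ -B) :
    IsMultiplier (l + m) (A + B) := by
  match A, B, hA, hB, hA0, hB0 with
  | .some a b hab, .some a' b' hab', hA, hB, _, _ =>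
    have ha : a ≠ a' := fun hx => (Affine.Point.X_eq_iff.mp hx).elim h h'
    have ha0 := sub_ne_zero.mpr ha
    have hE := equation_baseChange_iff.mp hab.1
    have hE' := equation_baseChange_iff.mp hab'.1
    obtain ⟨hA1, hA2⟩ := hA
    obtain ⟨hB1, hB2⟩ := hB
    obtain ⟨s, hs⟩ : ∃ s, s = (b - b') / (a - a') := ⟨_, rfl⟩
    obtain ⟨x, hx⟩ : ∃ x, x = s ^ 2 + const W W.a₁ * s - const W W.a₂ - a - a' := ⟨_, rfl⟩
    obtain ⟨y, hy⟩ : ∃ y, y = -(s * (x - a) + b) - const W W.a₁ * x - const W W.a₃ := ⟨_, rfl⟩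
    have hs' : s * (a - a') = b - b' := by rw [hs, div_mul_cancel₀ _ ha0]
    -- Along the chord the Weierstrass polynomial is -(t - a)(t - a')(t - x). This identity and the
    -- next two are its derivatives at the roots a, a' and x, the last one transported by negation.
    have h1 : chi a b - s * psi a b = -((x - a) * (a - a')) := by
      refine mul_right_cancel₀ ha0 ?_
      obtain rfl : b' = b - s * (a - a') := by rw [hs']; ring
      rw [hx, chi, psi]
      linear_combination hE' - hE
    have h2 : chi a' b' - s * psi a' b' = (x - a') * (a - a') := by
      refine mul_right_cancel₀ ha0 ?_
      obtain rfl : b' = b - s * (a - a') := by rw [hs']; ring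
      rw [hx, chi, psi]
      linear_combination hE' - hE
    have h3 : chi x y = -(s + const W W.a₁) * psi x y + (x - a) * (x - a') := by
      rw [chi, psi] at h1 ⊢
      rw [hy]
      linear_combination h1 + 2 * (x - a) * hx
    have h4 : psi x y = -2 * s * (x - a) - 2 * b - const W W.a₁ * x - const W W.a₃ := by
      rw [psi, hy]; ring
    have hds : deriv s = -(l * (x - a)) - m * (x - a') := by
      refine mul_right_cancel₀ ha0 ?_
      have := congrArg deriv hs'
      rw [deriv_mul, deriv_sub, deriv_sub, hA1, hA2, hB1, hB2] at this
      linear_combination this + l * h1 - m * h2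
    have hdx : deriv x = (l + m) * psi x y := by
      rw [hx, deriv_sub, deriv_sub, deriv_sub, deriv_add, deriv_pow_two, deriv_mul, deriv_const,
        deriv_const, hds, hA1, hB1, ← hx, h4, psi, psi]
      linear_combination -2 * m * hs'
    have hdy : deriv y = (l + m) * chi x y := by
      rw [hy, deriv_sub, deriv_sub, deriv_neg, deriv_add, deriv_mul, deriv_mul, deriv_sub,
        deriv_const, deriv_const, hds, hdx, hA1, hA2, ← hy, h3]
      linear_combination -l * h1
    have key : (.some a b hab + .some a' b' hab' : FPoint W) = .some a b hab + .some a' b' hab' := rfl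
    conv_rhs at key => rw [Affine.Point.add_of_X_ne ha]
    rw [key]
    have hX : (W.baseChange W.FunctionField).addX a a'
        ((W.baseChange W.FunctionField).slope a a' b b') = x := by
      rw [Affine.slope_of_X_ne ha, ← hs, hx]; rfl
    have hY : (W.baseChange W.FunctionField).addY a a' b
        ((W.baseChange W.FunctionField).slope a a' b b') = y := by
      rw [Affine.addY, Affine.negAddY, hX, Affine.slope_of_X_ne ha, ← hs, hy]; rfl
    simp only [IsMultiplier, hX, hY]
    exact ⟨hdx, hdy⟩

end Derivation

end WeilPairing

namespace WeilPairing

variable {F : Type*} [Field F] {W : Affine F}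

/-! ### Heights of points over the function field -/

section Primitive

/-- The homogeneous coordinates `(u : v : w)` are regular and have no common zero at `P`. -/
def IsPrimitive (P : W.Point) (u v w : W.FunctionField) : Prop :=
  ∃ a b c, HasValueAt u P a ∧ HasValueAt v P b ∧ HasValueAt w P c ∧ ¬(a = 0 ∧ b = 0 ∧ c = 0)

variable {P : W.Point} {u v w l m : W.FunctionField}

lemma IsPrimitive.ord_le [W.IsElliptic] (hl : l ≠ 0) (hm : m ≠ 0)
    (h : IsPrimitive P (l * u) (l * v) (l * w)) (h' : IsPrimitive P (m * u) (m * v) (m * w)) :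
    ord P l ≤ ord P m := by
  have key : ∀ {u : W.FunctionField} {a b : F}, HasValueAt (l * u) P a → HasValueAt (m * u) P b →
      a ≠ 0 → ord P l ≤ ord P m := by
    intro u a b ha hb ha0
    have hu : u ≠ 0 := right_ne_zero_of_mul (ha.ne_zero ha0)
    have h1 := ha.ord_eq ha0
    have h2 := hb.isRegularAt.ord_nonneg
    rw [ord_mul hl hu] at h1
    rw [ord_mul hm hu] at h2
    omega
  obtain ⟨a, b, c, ha, hb, hc, h0⟩ := h
  obtain ⟨a', b', c', ha', hb', hc', -⟩ := h'
  by_cases ha0 : a = 0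
  · by_cases hb0 : b = 0
    · exact key hc hc' fun hc0 => h0 ⟨ha0, hb0, hc0⟩
    · exact key hb hb' hb0
  · exact key ha ha' ha0

/-- A scaling that makes homogeneous coordinates primitive at P is unique up to a local unit; its
order is the local height of the projective point. -/
lemma IsPrimitive.ord_eq [W.IsElliptic] (hl : l ≠ 0) (hm : m ≠ 0)
    (h : IsPrimitive P (l * u) (l * v) (l * w)) (h' : IsPrimitive P (m * u) (m * v) (m * w)) :
    ord P l = ord P m := le_antisymm (h.ord_le hl hm h') (h'.ord_le hm hl h)

/-- These quadratic forms take (x(A)x(B) : x(A)+x(B) : 1) to the same coordinates for A + B and A -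
B. They have no common zero because the discriminant is a unit, so they define a morphism and
exactly double local heights. -/
lemma addSubMap_ne_zero_of_ne_zero [W.IsElliptic] {s t u : F} (h : ¬(s = 0 ∧ t = 0 ∧ u = 0)) :
    ¬(s ^ 2 - W.b₄ * s * u - W.b₆ * t * u - W.b₈ * u ^ 2 = 0 ∧
      2 * t * s + W.b₂ * s * u + W.b₄ * t * u + W.b₆ * u ^ 2 = 0 ∧ t ^ 2 - 4 * s * u = 0) := by
  rintro ⟨h1, h2, h3⟩
  refine WeierstrassCurve.addSubMap_ne_zero W (x := ![s, t, u]) (fun h0 => h ?_) ?_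
  · exact ⟨congrFun h0 0, congrFun h0 1, congrFun h0 2⟩
  · ext i
    fin_cases i
    · simpa [WeierstrassCurve.addSubMap] using h1
    · simpa [WeierstrassCurve.addSubMap] using h2
    · simpa [WeierstrassCurve.addSubMap] using h3

lemma IsPrimitive.addSub [W.IsElliptic] {s t u : W.FunctionField} (h : IsPrimitive P s t u) :
    IsPrimitive P (s ^ 2 - const W W.b₄ * s * u - const W W.b₆ * t * u - const W W.b₈ * u ^ 2)
      (2 * t * s + const W W.b₂ * s * u + const W W.b₄ * t * u + const W W.b₆ * u ^ 2)
      (t ^ 2 - 4 * s * u) := by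
  obtain ⟨a, b, c, ha, hb, hc, h0⟩ := h
  have h := HasValueAt.const P (W := W)
  refine ⟨_, _, _, ((((ha.pow 2).sub (((h W.b₄).mul ha).mul hc)).sub
    (((h W.b₆).mul hb).mul hc)).sub ((h W.b₈).mul (hc.pow 2))), ?_, ?_,
    addSubMap_ne_zero_of_ne_zero (W := W) h0⟩
  · have := ((((((h 2).mul hb).mul ha).add (((h W.b₂).mul ha).mul hc)).add
      (((h W.b₄).mul hb).mul hc)).add ((h W.b₆).mul (hc.pow 2)))
    rwa [map_ofNat] at this
  · have := (hb.pow 2).sub (((h 4).mul ha).mul hc)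
    rwa [map_ofNat] at this

lemma exists_isPrimitive_pair [W.IsElliptic] (P : W.Point) (a : W.FunctionField) :
    ∃ l : W.FunctionField, l ≠ 0 ∧ ord P l = -min 0 (ord P a) ∧ ∃ c d, HasValueAt (l * a) P c ∧
      HasValueAt l P d ∧ ¬(c = 0 ∧ d = 0) := by
  by_cases ha : 0 ≤ ord P a
  · obtain ⟨c, hc⟩ := isRegularAt_iff.mpr ha
    refine ⟨1, one_ne_zero, by rw [ord_one, min_eq_left ha, neg_zero], c, 1, by rwa [one_mul],
      HasValueAt.one P, fun h => one_ne_zero h.2⟩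
  · have ha0 : a ≠ 0 := by rintro rfl; rw [ord_zero] at ha; exact ha le_rfl
    refine ⟨a⁻¹, inv_ne_zero ha0, by rw [ord_inv, min_eq_right (by omega)], 1, 0, ?_, ?_,
      fun h => one_ne_zero h.1⟩
    · rw [inv_mul_cancel₀ ha0]; exact HasValueAt.one P
    · exact hasValueAt_inv_of_not_isRegularAt (mt isRegularAt_iff.mp ha)

lemma isPrimitive_mul {a b : W.FunctionField} {c d c' d' : F} (hc : HasValueAt (l * a) P c)
    (hd : HasValueAt l P d) (h : ¬(c = 0 ∧ d = 0)) (hc' : HasValueAt (m * b) P c')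
    (hd' : HasValueAt m P d') (h' : ¬(c' = 0 ∧ d' = 0)) :
    IsPrimitive P (l * m * (a * b)) (l * m * (a + b)) (l * m * 1) := by
  have e1 : l * m * (a * b) = (l * a) * (m * b) := by ring
  have e2 : l * m * (a + b) = (l * a) * m + l * (m * b) := by ring
  rw [e1, e2, mul_one]
  refine ⟨_, _, _, hc.mul hc', (hc.mul hd').add (hd.mul hc'), hd.mul hd', ?_⟩
  rintro ⟨h1, h2, h3⟩
  grind

end Primitive

/-! ### The degree of the x-coordinate and the parallelogram law. -/

section Height

variable [IsAlgClosed F] [W.IsElliptic]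

/-- The negative of the divisor of poles of a function. -/
noncomputable def polar (a : W.FunctionField) : Divisor W :=
  (divOf a).mapRange (fun k => min 0 k) (min_self 0)

lemma polar_apply (a : W.FunctionField) (P : W.Point) : polar a P = min 0 (ord P a) := rfl

/-- The quadratic forms send (ab : a+b : 1) to m·(cd : c+d : 1) and preserve primitivity. Comparing
the primitive scalings at each point gives the identity; the term div m disappears in degrees. -/
lemma polar_addSub {a b c d m : W.FunctionField} (hm : m ≠ 0)
    (h1 : (a * b) ^ 2 - const W W.b₄ * (a * b) - const W W.b₆ * (a + b) - const W W.b₈ =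
      m * (c * d))
    (h2 : 2 * (a + b) * (a * b) + const W W.b₂ * (a * b) + const W W.b₄ * (a + b) + const W W.b₆ =
      m * (c + d))
    (h3 : (a + b) ^ 2 - 4 * (a * b) = m) :
    polar c + polar d = (2 : ℤ) • (polar a + polar b) - divOf m := by
  ext P
  obtain ⟨la, ha0, ha, _, _, ha1, ha2, ha3⟩ := exists_isPrimitive_pair P a
  obtain ⟨lb, hb0, hb, _, _, hb1, hb2, hb3⟩ := exists_isPrimitive_pair P b
  obtain ⟨lc, hc0, hc, _, _, hc1, hc2, hc3⟩ := exists_isPrimitive_pair P c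
  obtain ⟨ld, hd0, hd, _, _, hd1, hd2, hd3⟩ := exists_isPrimitive_pair P d
  have hp := (isPrimitive_mul ha1 ha2 ha3 hb1 hb2 hb3).addSub
  have hp' := isPrimitive_mul hc1 hc2 hc3 hd1 hd2 hd3
  have hl : la * lb ≠ 0 := mul_ne_zero ha0 hb0
  have hl' : lc * ld ≠ 0 := mul_ne_zero hc0 hd0
  have := IsPrimitive.ord_eq (P := P) (l := (la * lb) ^ 2 * m) (m := lc * ld) (u := c * d)
    (v := c + d) (w := 1) (mul_ne_zero (pow_ne_zero 2 hl) hm) hl' (by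
      convert hp using 1
      · linear_combination -(la * lb) ^ 2 * h1
      · linear_combination -(la * lb) ^ 2 * h2
      · linear_combination -(la * lb) ^ 2 * h3) hp'
  rw [ord_mul (pow_ne_zero 2 hl) hm, ord_pow, ord_mul ha0 hb0, ord_mul hc0 hd0, ha, hb, hc, hd]
    at this
  simp only [Finsupp.add_apply, Finsupp.sub_apply, Finsupp.smul_apply, smul_eq_mul, polar_apply,
    divOf_apply]
  push_cast at this
  linarith

/-- The case A = B of `polar_addSub`: now A - B = O has infinite abscissa, so the target coordinates
are m·(c : 1 : 0). -/
lemma polar_double {a c m : W.FunctionField} (hm : m ≠ 0)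
    (h1 : a ^ 4 - const W W.b₄ * a ^ 2 - 2 * const W W.b₆ * a - const W W.b₈ = m * c)
    (h2 : 4 * a ^ 3 + const W W.b₂ * a ^ 2 + 2 * const W W.b₄ * a + const W W.b₆ = m) :
    polar c = (4 : ℤ) • polar a - divOf m := by
  ext P
  obtain ⟨la, ha0, ha, _, _, ha1, ha2, ha3⟩ := exists_isPrimitive_pair P a
  obtain ⟨lc, hc0, hc, _, _, hc1, hc2, hc3⟩ := exists_isPrimitive_pair P c
  have hp := (isPrimitive_mul ha1 ha2 ha3 ha1 ha2 ha3).addSub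
  have hl : la * la ≠ 0 := mul_ne_zero ha0 ha0
  have hp' : IsPrimitive P (lc * c) (lc * 1) (lc * 0) := by
    rw [mul_one, mul_zero]
    exact ⟨_, _, _, hc1, hc2, HasValueAt.zero P, fun h => hc3 ⟨h.1, h.2.1⟩⟩
  have := IsPrimitive.ord_eq (P := P) (l := (la * la) ^ 2 * m) (m := lc)
    (mul_ne_zero (pow_ne_zero 2 hl) hm) hc0 (by
      convert hp using 1
      · linear_combination -(la * la) ^ 2 * h1
      · linear_combination -(la * la) ^ 2 * h2
      · ring) hp'
  rw [ord_mul (pow_ne_zero 2 hl) hm, ord_pow, ord_mul ha0 ha0, ha, hc] at this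
  simp only [Finsupp.sub_apply, Finsupp.smul_apply, smul_eq_mul, polar_apply, divOf_apply]
  push_cast at this
  linarith

/-- Minus the degree of the `x`-coordinate of a point over the function field. -/
noncomputable def degX : FPoint W → ℤ
  | .zero => 0
  | .some a _ _ => deg (polar a)

lemma degX_neg (A : FPoint W) : degX (-A) = degX A := by
  match A with
  | 0 => rfl
  | .some a b h => rfl

/-- The parallelogram law. -/
lemma degX_add_add_degX_sub {A B : FPoint W} (hA : A ≠ 0) (hB : B ≠ 0) (h : A ≠ B) (h' : A ≠ -B) :
    degX (A + B) + degX (A - B) = 2 * (degX A + degX B) := by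
  match A, B, hA, hB with
  | .some a y hay, .some b z hbz, _, _ =>
    have ha : a ≠ b := fun hx => (Affine.Point.X_eq_iff.mp hx).elim h h'
    have ha0 := sub_ne_zero.mpr ha
    have hE := equation_baseChange_iff.mp hay.1
    have hE' := equation_baseChange_iff.mp hbz.1
    -- The two curve equations are solved for a₆ and a₄. After substitution the required formulas
    -- become identities of rational functions in independent quantities.
    have ha6 : const W W.a₆ = y ^ 2 + const W W.a₁ * a * y + const W W.a₃ * y -
      (a ^ 3 + const W W.a₂ * a ^ 2 + const W W.a₄ * a) := by linear_combination -hE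
    have ha4 : const W W.a₄ = (y ^ 2 + const W W.a₁ * a * y + const W W.a₃ * y -
        (z ^ 2 + const W W.a₁ * b * z + const W W.a₃ * z) - (a ^ 3 - b ^ 3) -
        const W W.a₂ * (a ^ 2 - b ^ 2)) / (a - b) := by
      rw [eq_div_iff ha0]; linear_combination hE' - hE
    have hp := polar_addSub (W := W) (a := a) (b := b) (m := (a - b) ^ 2)
      (c := ((y - z) / (a - b)) ^ 2 + const W W.a₁ * ((y - z) / (a - b)) - const W W.a₂ - a - b)
      (d := ((y - (-z - const W W.a₁ * b - const W W.a₃)) / (a - b)) ^ 2 +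
        const W W.a₁ * ((y - (-z - const W W.a₁ * b - const W W.a₃)) / (a - b)) -
        const W W.a₂ - a - b) (pow_ne_zero 2 ha0) (by
          rw [WeierstrassCurve.b₄, WeierstrassCurve.b₆, WeierstrassCurve.b₈]
          simp only [map_add, map_sub, map_mul, map_pow, map_ofNat]
          rw [ha6, ha4]
          field_simp
          ring) (by
          rw [WeierstrassCurve.b₂, WeierstrassCurve.b₄, WeierstrassCurve.b₆]
          simp only [map_add, map_mul, map_pow, map_ofNat]
          rw [ha6, ha4]
          field_simp
          ring) (by ring)
    have hp' := congrArg deg hp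
    rw [map_add, map_sub, map_zsmul, map_add, deg_divOf, sub_zero, smul_eq_mul] at hp'
    rw [sub_eq_add_neg, Affine.Point.neg_some, Affine.Point.add_of_X_ne ha,
      Affine.Point.add_of_X_ne ha]
    simp only [Affine.slope_of_X_ne ha, Affine.addX, Affine.negY]
    exact hp'

lemma degX_double {A : FPoint W} (hA : A + A ≠ 0) : degX (A + A) = 4 * degX A := by
  match A, hA with
  | 0, hA => exact absurd (add_zero _) hA
  | .some a y h, hA =>
    have hy : y ≠ (W.baseChange W.FunctionField).negY a y := fun hy =>
      hA (Affine.Point.add_self_of_Y_eq hy)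
    have hE := equation_baseChange_iff.mp h.1
    have ha6 : const W W.a₆ = y ^ 2 + const W W.a₁ * a * y + const W W.a₃ * y -
      (a ^ 3 + const W W.a₂ * a ^ 2 + const W W.a₄ * a) := by linear_combination -hE
    have hy0 := sub_ne_zero.mpr hy
    have hpsi : y - (W.baseChange W.FunctionField).negY a y = psi a y := by
      rw [psi, Affine.negY]
      change _ - (_ - const W W.a₁ * _ - const W W.a₃) = _
      ring
    rw [hpsi] at hy0
    have hp := polar_double (W := W) (a := a) (m := psi a y ^ 2)
      (c := (chi a y / psi a y) ^ 2 + const W W.a₁ * (chi a y / psi a y) - const W W.a₂ - a - a)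
      (pow_ne_zero 2 hy0) (by
        rw [WeierstrassCurve.b₄, WeierstrassCurve.b₆, WeierstrassCurve.b₈]
        simp only [map_add, map_sub, map_mul, map_pow, map_ofNat]
        rw [ha6]
        field_simp
        rw [psi, chi]
        ring) (by
        rw [WeierstrassCurve.b₂, WeierstrassCurve.b₄, WeierstrassCurve.b₆]
        simp only [map_add, map_mul, map_pow, map_ofNat]
        rw [ha6, psi]
        ring)
    have hp' := congrArg deg hp
    rw [map_sub, map_zsmul, deg_divOf, sub_zero, smul_eq_mul] at hp'
    rw [Affine.Point.add_self_of_Y_ne hy]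
    simp only [Affine.slope_of_Y_ne rfl hy, Affine.addX, hpsi]
    exact hp'

end Height

/-! ### Degrees of the multiples of the generic point. -/

section Multiples

variable [W.IsElliptic]

/-- If 2 ≠ 0 this function is a multiple of a line, and if 2 = 0 ≠ a₁ it is a non-constant linear
function of x. In the remaining case it is the constant a₃, and a₁ = a₃ = 0 in characteristic 2
would make the discriminant vanish. -/
lemma psi_generic_ne_zero : psi (xFun W) (yFun W) ≠ 0 := by
  intro h
  rw [psi] at h
  have h2 : const W 2 = 2 := map_ofNat _ 2
  by_cases h0 : (2 : F) = 0
  · have e2 : (2 : W.FunctionField) = 0 := by rw [← h2, h0, map_zero]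
    rw [e2, zero_mul, zero_add] at h
    by_cases h1 : W.a₁ = 0
    · rw [h1, map_zero, zero_mul, zero_add, map_eq_zero] at h
      refine W.isUnit_Δ.ne_zero ?_
      rw [WeierstrassCurve.Δ, WeierstrassCurve.b₂, WeierstrassCurve.b₄, WeierstrassCurve.b₆,
        WeierstrassCurve.b₈, h1, h]
      have h4 : (4 : F) = 0 := by linear_combination 2 * h0
      simp [h0, h4]
    · refine xFun_ne_const (W := W) (-W.a₃ / W.a₁) ?_
      have h1' := (_root_.map_ne_zero (const W)).mpr h1
      rw [map_div₀, eq_div_iff h1', map_neg]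
      linear_combination h
  · have h0' : (2 : W.FunctionField) ≠ 0 := by rw [← h2]; exact (_root_.map_ne_zero _).mpr h0
    refine slant_ne_zero (W := W) (-W.a₁ / 2) (-W.a₃ / 2) ?_
    rw [slant, map_div₀, map_div₀, h2, map_neg, map_neg]
    field_simp
    linear_combination h

lemma two_nsmul_generic_ne_zero : generic W + generic W ≠ 0 := by
  have hy : yFun W ≠ (W.baseChange W.FunctionField).negY (xFun W) (yFun W) := by
    intro hy
    apply psi_generic_ne_zero (W := W)
    rw [Affine.negY] at hy
    change _ = _ - const W W.a₁ * _ - const W W.a₃ at hy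
    rw [psi]
    linear_combination hy
  rw [generic, Affine.Point.add_self_of_Y_ne hy]
  exact Affine.Point.some_ne_zero _

lemma generic_ne_zero : generic W ≠ 0 := Affine.Point.some_ne_zero _

variable [IsAlgClosed F]

lemma degX_generic : degX (generic W) = -2 := by
  have : polar (xFun W) = (-2 : ℤ) • pt 0 := by
    ext P
    rw [polar_apply, Finsupp.smul_apply]
    match P with
    | 0 => rw [ord_zero_xFun, pt, Finsupp.single_eq_same]; rfl
    | .some x y h =>
      rw [pt_apply_of_ne (Affine.Point.some_ne_zero h).symm, smul_zero, min_eq_left]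
      exact (hasValueAt_xFun h).isRegularAt.ord_nonneg
  change deg (polar (xFun W)) = -2
  rw [this, map_zsmul, deg_pt]; rfl

/-- The parallelogram law is a two-step recursion solved by multiples of k². Non-vanishing is
carried along because the law excludes degenerate sums. -/
lemma nsmul_generic (k : ℕ) : (k + 1) • generic W ≠ 0 ∧ (k + 2) • generic W ≠ 0 ∧
    degX ((k + 1) • generic W) = -2 * (k + 1) ^ 2 ∧
    degX ((k + 2) • generic W) = -2 * (k + 2) ^ 2 := by
  induction k with
  | zero =>
    have h1 : (0 + 1) • generic W = generic W := one_smul _ _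
    have h2 : (0 + 2) • generic W = generic W + generic W := two_smul _ _
    rw [h1, h2]
    refine ⟨generic_ne_zero, two_nsmul_generic_ne_zero, by rw [degX_generic]; rfl, ?_⟩
    rw [degX_double two_nsmul_generic_ne_zero, degX_generic]; rfl
  | succ k ih =>
    obtain ⟨h1, h2, h3, h4⟩ := ih
    set A := (k + 2) • generic W with hA
    have e1 : (k + 1 + 2) • generic W = A + generic W := by rw [hA, ← succ_nsmul]
    have e2 : (k + 1) • generic W = A - generic W := by
      rw [hA, eq_sub_iff_add_eq, ← succ_nsmul]
    rw [e2] at h1 h3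
    -- A = -G would give degree -2, but the induction hypothesis gives -2(k+2)².
    have h5 : A + generic W ≠ 0 := by
      intro h5
      rw [eq_neg_of_add_eq_zero_left h5, degX_neg, degX_generic] at h4
      have : (0 : ℤ) ≤ k := Int.natCast_nonneg k
      nlinarith
    have h6 := degX_add_add_degX_sub h2 generic_ne_zero (sub_ne_zero.mp h1)
      (fun h => h5 (by rw [h, neg_add_cancel]))
    rw [h3, h4, degX_generic] at h6
    rw [e1]
    refine ⟨h2, h5, ?_, ?_⟩
    · refine h4.trans ?_
      push_cast
      ring
    · push_cast; linarith

lemma nsmul_generic_ne_zero {k : ℕ} (hk : k ≠ 0) : k • generic W ≠ 0 := by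
  obtain ⟨j, rfl⟩ := Nat.exists_eq_succ_of_ne_zero hk
  exact (nsmul_generic j).1

lemma degX_nsmul_generic {k : ℕ} (hk : k ≠ 0) : degX (k • generic W) = -2 * (k : ℤ) ^ 2 := by
  obtain ⟨j, rfl⟩ := Nat.exists_eq_succ_of_ne_zero hk
  rw [(nsmul_generic j).2.2.1]
  push_cast; rfl

end Multiples

end WeilPairing

namespace WeilPairing

variable {F : Type*} [Field F] {W : Affine F}

/-! ### Multiplication by an integer -/

section Multiplication

variable [W.IsElliptic] [IsAlgClosed F] [DecidableEq F]

lemma constPoint_injective : Function.Injective (constPoint : W.Point → FPoint W) := fun P Q h => by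
  rw [← spec_constPoint 0 P, h, spec_constPoint]

/-- Specialization at O sends kG to O, so the only constant it could be is O, and kG ≠ 0 by the
degree computation. -/
lemma nsmul_generic_ne_constPoint {k : ℕ} (hk : k ≠ 0) (Q : W.Point) :
    k • generic W ≠ constPoint Q := by
  intro h
  have hQ : Q = 0 := by
    rw [← spec_constPoint 0 Q, ← h, spec_nsmul, spec_generic, smul_zero]
  rw [hQ, map_zero] at h
  exact nsmul_generic_ne_zero hk h

lemma exists_mulHom {k : ℕ} (hk : k ≠ 0) :
    ∃ σ : W.FunctionField →ₐ[F] W.FunctionField, mapPoint σ (generic W) = k • generic W :=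
  exists_mapPoint_eq (nsmul_generic_ne_constPoint hk)

variable (W) in
/-- The endomorphism of the function field given by the multiplication by `k`. -/
noncomputable def mulHom (k : ℕ) [NeZero k] : W.FunctionField →ₐ[F] W.FunctionField :=
  (exists_mulHom (NeZero.ne k)).choose

lemma mapPoint_mulHom (k : ℕ) [NeZero k] : mapPoint (mulHom W k) (generic W) = k • generic W :=
  (exists_mulHom (NeZero.ne k)).choose_spec

lemma pull_mulHom (k : ℕ) [NeZero k] (P : W.Point) : pull (mulHom W k) P = k • P := by
  rw [pull_eq_spec, mapPoint_mulHom, spec_nsmul, spec_generic]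

lemma transHom_comp_mulHom (k : ℕ) [NeZero k] (Q : W.Point) :
    (transHom Q).comp (mulHom W k) = (mulHom W k).comp (transHom (k • Q)) := by
  refine algHom_ext_generic ?_
  rw [mapPoint_comp, mapPoint_comp, mapPoint_mulHom, mapPoint_transHom, map_nsmul,
    mapPoint_transHom, map_add, mapPoint_mulHom, mapPoint_constPoint, map_nsmul, nsmul_add]

variable (W) in
-- If kG = (a, b), then kG specializes to O at every k-torsion point, so these points are among the
-- zeros of 1/b.
lemma finite_torsion {k : ℕ} (hk : k ≠ 0) : {P : W.Point | k • P = 0}.Finite := by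
  obtain ⟨A, hA⟩ : ∃ A, A = k • generic W := ⟨_, rfl⟩
  have h0 : A ≠ 0 := hA ▸ nsmul_generic_ne_zero hk
  have hs : ∀ P : W.Point, spec P A = k • P := fun P => by rw [hA, spec_nsmul, spec_generic]
  match A, h0, hs with
  | .some a b h, _, hs =>
    refine (finite_support_ord (1 / b)).subset fun P hP => ?_
    have h1 := isSpec_spec P (.some a b h)
    rw [hs, Set.mem_ofPred_eq.mp hP] at h1
    exact (h1.2.2.ord_pos (one_div_ne_zero h1.1)).ne'

/-- A constant point has multiplier 0. Adding Q ≠ O keeps kG + Q different from ±G, so the induction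
never meets the tangent case G + G. `isMultiplier_nsmul` removes Q afterwards. -/
lemma isMultiplier_nsmul_add (k : ℕ) {Q : W.Point} (hQ : Q ≠ 0) :
    IsMultiplier (k : W.FunctionField) (k • generic W + constPoint Q) := by
  have hne : ∀ k : ℕ, k • generic W + constPoint Q ≠ 0 := by
    intro k h
    by_cases hk : k = 0
    · rw [hk, zero_nsmul, zero_add, ← map_zero constPoint] at h
      exact hQ (constPoint_injective h)
    · rw [← sub_neg_eq_add, sub_eq_zero, ← map_neg] at h
      exact nsmul_generic_ne_constPoint hk _ h
  induction k with
  | zero => rw [Nat.cast_zero, zero_nsmul, zero_add]; exact isMultiplier_constPoint Q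
  | succ k ih =>
    have h := ih.add isMultiplier_generic (hne k) generic_ne_zero (fun h => ?_) (fun h => ?_)
    · rw [succ_nsmul, add_right_comm, Nat.cast_succ]
      exact h
    · obtain _ | k := k
      · rw [zero_nsmul, zero_add] at h
        exact generic_ne_constPoint Q h.symm
      · rw [succ_nsmul, add_right_comm, add_eq_right] at h
        exact hne k h
    · refine hne (k + 1) ?_
      rw [succ_nsmul, add_right_comm, h, neg_add_cancel]

lemma isMultiplier_nsmul {k : ℕ} (hk : k ≠ 0) :
    IsMultiplier (k : W.FunctionField) (k • generic W) := by
  obtain ⟨Q, hQ⟩ := exists_ne (0 : W.Point)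
  have h := (isMultiplier_nsmul_add k hQ).add (isMultiplier_constPoint (-Q)) (fun h => ?_)
    (fun h => ?_) (fun h => ?_) (fun h => ?_)
  · rwa [add_zero, map_neg, add_neg_cancel_right] at h
  · rw [← sub_neg_eq_add, sub_eq_zero, ← map_neg] at h
    exact nsmul_generic_ne_constPoint hk _ h
  · rw [← map_zero constPoint] at h
    exact hQ (neg_eq_zero.mp (constPoint_injective h))
  · rw [← eq_sub_iff_add_eq, ← map_sub] at h
    exact nsmul_generic_ne_constPoint hk _ h
  · rw [map_neg, neg_neg, add_eq_right] at h
    exact nsmul_generic_ne_zero hk h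

variable {n : ℕ} [NeZero n]

lemma deriv_mulHom_xFun : deriv (mulHom W n (xFun W)) =
    n * psi (mulHom W n (xFun W)) (mulHom W n (yFun W)) := by
  have h := isMultiplier_nsmul (W := W) (NeZero.ne n)
  rw [← mapPoint_mulHom] at h
  exact h.1

/-- Translations are unramified and [n] intertwines the translation by Q with the one by nQ, so the
ramification index is the same at all points. -/
lemma ram_mulHom_add (P Q : W.Point) : ram (mulHom W n) (P + Q) = ram (mulHom W n) P := by
  have h := congrArg (fun σ => ram σ P) (transHom_comp_mulHom n Q)
  simpa only [ram_comp, ram_transHom, one_mul, mul_one, pull_transHom] using h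

/-- The multiplication by `n` is unramified if `n` is not divisible by the characteristic. -/
lemma ram_mulHom (hn : (n : F) ≠ 0) (P : W.Point) : ram (mulHom W n) P = 1 := by
  -- It suffices to treat one point. If P₀ is not 2n-torsion, S = nP₀ is affine and not 2-torsion,
  -- hence x - x(S) is a uniformizer at S.
  obtain ⟨P₀, hP₀⟩ := (finite_torsion W (k := 2 * n) (by simp [NeZero.ne n])).exists_notMem
  rw [Set.mem_ofPred_eq, mul_smul, two_smul] at hP₀
  rw [← add_sub_cancel P₀ P, ram_mulHom_add]
  have hP0 : P₀ ≠ 0 := by rintro rfl; simp at hP₀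
  have hpull := pull_mulHom n P₀
  obtain ⟨S, hS⟩ : ∃ S, S = n • P₀ := ⟨_, rfl⟩
  rw [← hS] at hpull hP₀
  match S, hpull, hP₀ with
  | 0, _, h => exact absurd (add_zero 0) h
  | .some x y h, hpull, hP₀ =>
    have hne : 2 * y + W.a₁ * x + W.a₃ ≠ 0 := fun h0 =>
      hP₀ (by
        have h1 := (neg_eq_self_iff h).mpr h0
        nth_rw 1 [← h1]
        exact neg_add_cancel _)
    have hord : ord (.some x y h) (xFun W - const W x) = 1 := by
      have := (hasOrderAt_xFun_sub h).ord_eq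
      rwa [if_neg hne] at this
    have hram := ord_map (P := P₀) (mulHom W n) (xFun W - const W x)
    rw [hpull, hord, mul_one, map_sub, map_const] at hram
    by_contra hne1
    have hpos := ram_pos (mulHom W n) (P := P₀)
    obtain ⟨t, ht⟩ := exists_isUniformizerAt P₀
    have ht0 := ht.ne_zero
    have hx0 : mulHom W n (xFun W) - const W x ≠ 0 := by
      intro h0
      rw [h0, ord_zero] at hram
      omega
    -- Ramification would make x ∘ [n] - x(S) divisible by t², so its derivative would vanish at P₀.
    -- But that derivative has the value n(2y + a₁x + a₃) at S, which is non-zero.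
    set g := (mulHom W n (xFun W) - const W x) / t ^ 2 with hg
    have hgreg : IsRegularAt g P₀ := by
      rw [isRegularAt_iff, hg, ord_div hx0 (pow_ne_zero 2 ht0), ord_pow, ord_uniformizer ht, hram]
      push_cast
      omega
    have heq : mulHom W n (xFun W) - const W x = t * (t * g) := by rw [hg]; field_simp
    have hd := congrArg deriv heq
    rw [deriv_sub, deriv_const, sub_zero, deriv_mul, deriv_mulHom_xFun] at hd
    obtain ⟨c, hc⟩ := (ht.1.isRegularAt.mul hgreg).deriv hP0
    obtain ⟨d, hd'⟩ := ht.1.isRegularAt.deriv hP0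
    obtain ⟨e, he⟩ := hgreg
    have h1 := (ht.1.mul hc).add ((ht.1.mul he).mul hd')
    rw [← hd] at h1
    have h2 := (HasValueAt.const P₀ (n : F)).mul
      ((HasValueAt.map (σ := mulHom W n) (hpull ▸ hasValueAt_xFun h)).psi
      (HasValueAt.map (σ := mulHom W n) (hpull ▸ hasValueAt_yFun h)))
    rw [map_natCast] at h2
    have h3 := h2.unique h1
    simp [hn, hne] at h3

lemma ord_mulHom (hn : (n : F) ≠ 0) (P : W.Point) (f : W.FunctionField) :
    ord P (mulHom W n f) = ord (n • P) f := by
  rw [ord_map, ram_mulHom hn, one_mul, pull_mulHom]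

/-- There are `n ^ 2` points of order dividing `n`. -/
lemma card_torsion (hn : (n : F) ≠ 0) {T : Finset W.Point} (hT : ∀ R, R ∈ T ↔ n • R = 0) :
    T.card = n ^ 2 := by
  -- Since [n] is unramified, x ∘ [n] has a double pole at each n-torsion point and no others; its
  -- degree is known to be 2n².
  have hpolar : polar (mulHom W n (xFun W)) = (-2 : ℤ) • ∑ R ∈ T, pt R := by
    ext P
    rw [polar_apply, ord_mulHom hn, Finsupp.smul_apply, Finsupp.finsetSum_apply]
    by_cases hP : n • P = 0
    · rw [hP, ord_zero_xFun, Finset.sum_eq_single P, pt, Finsupp.single_eq_same]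
      · rfl
      · exact fun R _ hR => pt_apply_of_ne hR
      · exact fun h => absurd ((hT P).mpr hP) h
    · rw [Finset.sum_eq_zero, smul_zero, min_eq_left]
      · obtain ⟨S, hS⟩ : ∃ S, S = n • P := ⟨_, rfl⟩
        rw [← hS] at hP ⊢
        match S, hP with
        | .some x y h, _ => exact (hasValueAt_xFun h).isRegularAt.ord_nonneg
      · intro R hR
        refine pt_apply_of_ne ?_
        rintro rfl
        exact hP ((hT R).mp hR)
  have h1 := degX_nsmul_generic (W := W) (NeZero.ne n)
  rw [← mapPoint_mulHom] at h1
  have h2 : deg (polar (mulHom W n (xFun W))) = -2 * (n : ℤ) ^ 2 := h1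
  rw [hpolar, map_zsmul, map_sum] at h2
  simp only [deg_pt, Finset.sum_const, smul_eq_mul, nsmul_eq_mul, mul_one] at h2
  have h3 : (T.card : ℤ) = (n : ℤ) ^ 2 := by linarith
  exact_mod_cast h3

variable (n) in
/-- The group of points is divisible. -/
lemma exists_nsmul_eq (Q : W.Point) : ∃ P, n • P = Q := by
  match Q with
  | 0 => exact ⟨0, smul_zero n⟩
  | .some x y h =>
    have hx0 : mulHom W n (xFun W - const W x) ≠ 0 :=
      (_root_.map_ne_zero _).mpr (sub_ne_zero.mpr (xFun_ne_const x))
    -- Without a zero of (x - x(Q)) ∘ [n], its inverse would have no poles and so be constant. At a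
    -- zero P the point nP is Q or -Q.
    obtain ⟨P, hP⟩ : ∃ P, 0 < ord P (mulHom W n (xFun W - const W x)) := by
      by_contra! hP
      obtain ⟨c, hc⟩ := exists_eq_const (f := (mulHom W n (xFun W - const W x))⁻¹) (fun P => by
        rw [ord_inv]; linarith [hP P])
      rw [inv_eq_iff_eq_inv, ← map_inv₀] at hc
      have := (mulHom W n).injective (hc.trans (map_const _ _).symm)
      rw [sub_eq_iff_eq_add, ← map_add] at this
      exact xFun_ne_const _ this
    have h1 := (hasValueAt_map_iff _).mp (hasValueAt_zero_of_ord_pos hP)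
    rw [pull_mulHom] at h1
    have h3 : n • (-P) = -(n • P) := smul_neg n P
    obtain ⟨S, hS⟩ : ∃ S, S = n • P := ⟨_, rfl⟩
    rw [← hS] at h1 h3
    match S, h1, h3, hS with
    | 0, h1, _, _ =>
      have := h1.isRegularAt.ord_nonneg
      rw [ord_xFun_sub_zero] at this
      omega
    | .some x' y' h', h1, h3, hS =>
      have h2 := ((hasValueAt_xFun h').sub (HasValueAt.const _ x)).unique h1
      rw [sub_eq_zero] at h2
      subst h2
      rcases Affine.Point.X_eq_iff (h₁ := h) (h₂ := h') |>.mp rfl with h4 | h4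
      · exact ⟨P, by rw [← hS, h4]⟩
      · exact ⟨-P, by rw [h3, h4]⟩

end Multiplication

end WeilPairing

namespace WeilPairing

variable {F : Type*} [Field F] {W : Affine F}

/-! ### The Weil pairing -/

section Products

lemma HasValueAt.prod {ι : Type*} {T : Finset ι} {f : ι → W.FunctionField} {c : ι → F}
    {P : W.Point} (h : ∀ i ∈ T, HasValueAt (f i) P (c i)) :
    HasValueAt (∏ i ∈ T, f i) P (∏ i ∈ T, c i) := by
  classical
  induction T using Finset.induction_on with
  | empty => rw [Finset.prod_empty, Finset.prod_empty]; exact HasValueAt.one P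
  | insert i T hi ih =>
    rw [Finset.prod_insert hi, Finset.prod_insert hi]
    exact (h i (Finset.mem_insert_self i T)).mul (ih fun j hj => h j (Finset.mem_insert_of_mem hj))

variable [W.IsElliptic]

omit [W.IsElliptic] in
lemma ord_prod {ι : Type*} {T : Finset ι} {f : ι → W.FunctionField} {P : W.Point}
    (h : ∀ i ∈ T, f i ≠ 0) : ord P (∏ i ∈ T, f i) = ∑ i ∈ T, ord P (f i) := by
  classical
  induction T using Finset.induction_on with
  | empty => rw [Finset.prod_empty, Finset.sum_empty, ord_one]
  | insert i T hi ih =>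
    have h' : ∀ j ∈ T, f j ≠ 0 := fun j hj => h j (Finset.mem_insert_of_mem hj)
    rw [Finset.prod_insert hi, Finset.sum_insert hi,
      ord_mul (h i (Finset.mem_insert_self i T)) (Finset.prod_ne_zero_iff.mpr h'), ih h']

lemma unitVal_map {σ : W.FunctionField →ₐ[F] W.FunctionField} {P : W.Point} {f : W.FunctionField}
    (hf : f ≠ 0) (h : ord (pull σ P) f = 0) : unitVal (σ f) P = unitVal f (pull σ P) :=
  (HasValueAt.map (hasValueAt_unitVal hf h)).unitVal_eq (unitVal_ne_zero _ _)

omit [W.IsElliptic] in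
lemma pairing_sum {ι : Type*} (f : W.FunctionField) (T : Finset ι) (D : ι → Divisor W) :
    pairing f (∑ i ∈ T, D i) = ∏ i ∈ T, pairing f (D i) := by
  classical
  induction T using Finset.induction_on with
  | empty => rw [Finset.sum_empty, Finset.prod_empty, pairing_zero]
  | insert i T hi ih => rw [Finset.sum_insert hi, Finset.prod_insert hi, pairing_add, ih]

end Products

/-! ### The functions g_P, and the first definition against the third for special divisors. -/

section Torsion

variable [DecidableEq F]

lemma pt_apply (P Q : W.Point) : pt P Q = if P = Q then 1 else 0 := Finsupp.single_apply

variable {n : ℕ} {T : Finset W.Point}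

/-- The divisor on the left is the pullback of [nA] under [n], each preimage having multiplicity
one. -/
lemma sum_pt_add_apply (hT : ∀ R, R ∈ T ↔ n • R = 0) (A X : W.Point) :
    (∑ R ∈ T, pt (A + R)) X = pt (n • A) (n • X) := by
  rw [Finsupp.finsetSum_apply]
  by_cases h : n • A = n • X
  · have hm : X - A ∈ T := by rw [hT, nsmul_sub, h, sub_self]
    rw [Finset.sum_eq_single_of_mem _ hm, pt_apply, if_pos (add_sub_cancel A X), pt_apply, if_pos h]
    intro R _ hR
    exact pt_apply_of_ne fun h' => hR (eq_sub_of_add_eq' h')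
  · rw [pt_apply_of_ne h]
    refine Finset.sum_eq_zero fun R hR => pt_apply_of_ne fun h' => h ?_
    rw [← h', nsmul_add, (hT R).mp hR, add_zero]

lemma sum_pt_apply_add (hT : ∀ R, R ∈ T ↔ n • R = 0) (A X : W.Point) :
    ∑ R ∈ T, pt A (X + R) = pt (n • A) (n • X) := by
  by_cases h : n • A = n • X
  · have hm : A - X ∈ T := by rw [hT, nsmul_sub, h, sub_self]
    rw [Finset.sum_eq_single_of_mem _ hm, pt_apply, if_pos (add_sub_cancel X A).symm, pt_apply,
      if_pos h]
    intro R _ hR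
    exact pt_apply_of_ne fun h' => hR (eq_sub_of_add_eq' h'.symm)
  · rw [pt_apply_of_ne h]
    refine Finset.sum_eq_zero fun R hR => pt_apply_of_ne fun h' => h ?_
    rw [h', nsmul_add, (hT R).mp hR, add_zero]

lemma sum_pt_add_sub_apply (hT : ∀ R, R ∈ T ↔ n • R = 0) (A X : W.Point) :
    (∑ R ∈ T, (pt (A + R) - pt R)) X = (pt (n • A) - pt 0 : Divisor W) (n • X) := by
  have h := sum_pt_add_apply hT (0 : W.Point) X
  simp only [zero_add, nsmul_zero] at h
  rw [Finset.sum_sub_distrib, Finsupp.sub_apply, Finsupp.sub_apply, sum_pt_add_apply hT, h]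

variable [W.IsElliptic] [IsAlgClosed F]

variable (W) in
lemma exists_torsion_finset (n : ℕ) [NeZero n] : ∃ T : Finset W.Point, ∀ R, R ∈ T ↔ n • R = 0 :=
  ⟨(finite_torsion W (NeZero.ne n)).toFinset, fun R => by
    rw [Set.Finite.mem_toFinset, Set.mem_ofPred_eq]⟩

/-- `g` has the divisor of a function `g_P`. -/
def IsRootFun (n : ℕ) (P : W.Point) (g : W.FunctionField) : Prop :=
  g ≠ 0 ∧ ∀ X, ord X g = (pt P - pt 0 : Divisor W) (n • X)

lemma IsG.isRootFun {P : W.Point} {g : W.FunctionField} (h : IsG n P g) : IsRootFun n P g := by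
  obtain ⟨T, hT, P₀, rfl, h⟩ := h
  obtain ⟨hg, hd⟩ := hasDivisor_iff.mp h
  exact ⟨hg, fun X => by rw [← divOf_apply, hd, sum_pt_add_sub_apply hT]⟩

variable [NeZero n] {P Q : W.Point}

lemma exists_isG (hn : (n : F) ≠ 0) (hP : n • P = 0) : ∃ g, IsG n P g := by
  obtain ⟨T, hT⟩ := exists_torsion_finset W n
  obtain ⟨P₀, hP₀⟩ := exists_nsmul_eq n P
  obtain ⟨g, hg, hd⟩ := exists_divOf_eq (D := ∑ R ∈ T, (pt (P₀ + R) - pt R)) (by simp) (by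
    simp only [map_sum, map_sub, pointSum_pt, add_sub_cancel_right, Finset.sum_const]
    -- The sum of the divisor is |E[n]|·P₀ = n²P₀ = nP = O; this is where the exact number of
    -- torsion points enters.
    rw [card_torsion hn hT, pow_two, mul_nsmul, hP₀, hP])
  exact ⟨g, T, hT, P₀, hP₀, hasDivisor_iff.mpr ⟨hg, hd⟩⟩

omit [NeZero n] in
lemma IsRootFun.exists_const_mul_eq {g g' : W.FunctionField} (h : IsRootFun n P g)
    (h' : IsRootFun n P g') : ∃ c, c ≠ 0 ∧ g' = const W c * g :=
  exists_const_mul_of_divOf_eq h'.1 h.1 (by ext X; rw [divOf_apply, divOf_apply, h.2, h'.2])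

omit [NeZero n] in
lemma IsRootFun.transHom {g : W.FunctionField} (h : IsRootFun n P g) (hQ : n • Q = 0) :
    IsRootFun n P (transHom Q g) :=
  ⟨(_root_.map_ne_zero _).mpr h.1, fun X => by rw [ord_transHom, h.2, nsmul_add, hQ, add_zero]⟩

/-- The constant of the first definition. -/
lemma exists_transHom_eq (hn : (n : F) ≠ 0) (hP : n • P = 0) (hQ : n • Q = 0) :
    ∃ c, c ≠ 0 ∧ ∀ g, IsRootFun n P g → transHom Q g = const W c * g := by
  obtain ⟨g, hg⟩ := exists_isG hn hP
  obtain ⟨c, hc, h⟩ := hg.isRootFun.exists_const_mul_eq (hg.isRootFun.transHom hQ)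
  refine ⟨c, hc, fun g' hg' => ?_⟩
  obtain ⟨k, -, rfl⟩ := hg.isRootFun.exists_const_mul_eq hg'
  rw [map_mul, map_const, h]
  ring

/-- Both f ∘ [n] and gⁿ have n times the pullback of [P] - [O] as divisor. -/
lemma mulHom_eq_const_mul_pow (hn : (n : F) ≠ 0) {f g : W.FunctionField} (hg : IsRootFun n P g)
    (hf : f ≠ 0) (hd : divOf f = (n : ℤ) • (pt P - pt 0)) :
    ∃ k, k ≠ 0 ∧ mulHom W n f = const W k * g ^ n := by
  refine exists_const_mul_of_divOf_eq ((_root_.map_ne_zero _).mpr hf) (pow_ne_zero n hg.1) ?_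
  ext X
  rw [divOf_apply, divOf_apply, ord_mulHom hn, ord_pow, hg.2, ← divOf_apply, hd,
    Finsupp.smul_apply, smul_eq_mul]

omit [DecidableEq F] [W.IsElliptic] [IsAlgClosed F] in
lemma sub_apply_eq_zero {A B X : W.Point} (hA : A ≠ X) (hB : B ≠ X) :
    (pt A - pt B : Divisor W) X = 0 := by
  rw [Finsupp.sub_apply, pt_apply_of_ne hA, pt_apply_of_ne hB, sub_zero]

/-- The first and the third definition agree, for special divisors. -/
lemma pairing_eq_mul_pairing (hn : (n : F) ≠ 0) {c : F} (hc : c ≠ 0)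
    (hP : n • P = 0) {S : W.Point} (hS0 : S ≠ 0) (hSP : S ≠ P) (hQS0 : Q + S ≠ 0)
    (hQSP : Q + S ≠ P) (hQ : n • Q = 0)
    (h : ∀ g, IsRootFun n P g → transHom Q g = const W c * g) {f f' : W.FunctionField}
    (hf : f ≠ 0) (hd : divOf f = (n : ℤ) • (pt P - pt 0)) (hf' : f' ≠ 0)
    (hd' : divOf f' = (n : ℤ) • (pt (Q + S) - pt S)) :
    pairing f (pt (Q + S) - pt S) = c * pairing f' (pt P - pt 0) := by
  obtain ⟨T, hT⟩ := exists_torsion_finset W n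
  obtain ⟨Q₀, hQ₀⟩ := exists_nsmul_eq n Q
  obtain ⟨S₀, hS₀⟩ := exists_nsmul_eq n S
  obtain ⟨P₀, hP₀⟩ := exists_nsmul_eq n P
  obtain ⟨g, hg⟩ := exists_isG hn hP
  replace hg := hg.isRootFun
  have hdg : divOf g = ∑ R ∈ T, (pt (P₀ + R) - pt R) := by
    ext X
    rw [divOf_apply, hg.2, sum_pt_add_sub_apply hT, hP₀]
  -- The n-fold part of div v makes g(div v) contain n-th powers of values of g, that is, values of
  -- f. The correction [S₀+Q] - [S₀], needed to make the sum zero, contributes g(S₀+Q)/g(S₀) = c.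
  obtain ⟨v, hv, hdv⟩ := exists_divOf_eq
    (D := (n : ℤ) • (pt (Q₀ + S₀) - pt S₀) - (pt (S₀ + Q) - pt S₀)) (by simp) (by
      simp only [map_sub, map_zsmul, pointSum_pt, add_sub_cancel_right, add_sub_cancel_left]
      rw [natCast_zsmul, hQ₀, sub_self])
  have hordv : ∀ Z, n • Z ≠ Q + S → n • Z ≠ S → ord Z v = 0 := by
    intro Z h1 h2
    have e1 : Q₀ + S₀ ≠ Z := by rintro rfl; exact h1 (by rw [nsmul_add, hQ₀, hS₀])
    have e2 : S₀ ≠ Z := by rintro rfl; exact h2 hS₀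
    have e3 : S₀ + Q ≠ Z := by rintro rfl; exact h2 (by rw [nsmul_add, hQ, add_zero, hS₀])
    rw [← divOf_apply, hdv, Finsupp.sub_apply, Finsupp.smul_apply, sub_apply_eq_zero e1 e2,
      sub_apply_eq_zero e3 e2, smul_zero, sub_zero]
  have hordg : ∀ X, n • X ≠ P → n • X ≠ 0 → ord X g = 0 := fun X h1 h2 => by
    rw [hg.2, sub_apply_eq_zero h1.symm h2.symm]
  have hordf : ∀ X, X ≠ P → X ≠ 0 → ord X f = 0 := fun X h1 h2 => by
    rw [← divOf_apply, hd, Finsupp.smul_apply, sub_apply_eq_zero h1.symm h2.symm, smul_zero]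
  have hordf' : ∀ X, X ≠ Q + S → X ≠ S → ord X f' = 0 := fun X h1 h2 => by
    rw [← divOf_apply, hd', Finsupp.smul_apply, sub_apply_eq_zero h1.symm h2.symm, smul_zero]
  have hrec : pairing g (divOf v) = pairing v (divOf g) := by
    refine pairing_divOf_comm hg.1 hv fun X => ?_
    by_cases h1 : n • X = P
    · exact .inr (hordv X (h1 ▸ hQSP.symm) (h1 ▸ hSP.symm))
    by_cases h2 : n • X = 0
    · exact .inr (hordv X (h2 ▸ hQS0.symm) (h2 ▸ hS0.symm))
    · exact .inl (hordg X h1 h2)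
  have hQS₀ : n • (Q₀ + S₀) = Q + S := by rw [nsmul_add, hQ₀, hS₀]
  -- the values of `g`
  obtain ⟨k, hk, hfg⟩ := mulHom_eq_const_mul_pow hn hg hf hd
  have hfval : ∀ X, n • X ≠ P → n • X ≠ 0 → unitVal f (n • X) = k * unitVal g X ^ n := by
    intro X h1 h2
    rw [← pull_mulHom n X, ← unitVal_map hf (by rw [pull_mulHom]; exact hordf _ h1 h2), hfg]
    exact ((HasValueAt.const X k).mul ((hasValueAt_unitVal hg.1 (hordg X h1 h2)).pow n)).unitVal_eq
      (mul_ne_zero hk (pow_ne_zero n (unitVal_ne_zero _ _)))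
  have h1 := hfval (Q₀ + S₀) (by rwa [hQS₀]) (by rwa [hQS₀])
  have h2 := hfval S₀ (by rwa [hS₀]) (by rwa [hS₀])
  rw [hQS₀] at h1
  rw [hS₀] at h2
  have h3 : unitVal g (S₀ + Q) = c * unitVal g S₀ := by
    have hS₀Q : n • (S₀ + Q) = S := by rw [nsmul_add, hQ, add_zero, hS₀]
    rw [← pull_transHom, ← unitVal_map hg.1 (by
      rw [pull_transHom]; exact hordg _ (by rwa [hS₀Q]) (by rwa [hS₀Q])), h g hg]
    exact ((HasValueAt.const S₀ c).mul (hasValueAt_unitVal hg.1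
      (hordg S₀ (by rwa [hS₀]) (by rwa [hS₀])))).unitVal_eq
      (mul_ne_zero hc (unitVal_ne_zero _ _))
  -- the values of `v`
  have htr : ∀ R, transHom R v ≠ 0 := fun R => (_root_.map_ne_zero _).mpr hv
  -- Summed over translations by E[n], div v becomes a pullback under [n]. The points S₀ + Q and S₀
  -- both lie over S, so the correction terms cancel and n[Q+S] - n[S] is left.
  obtain ⟨k', hk', hvf⟩ : ∃ k, k ≠ 0 ∧ ∏ R ∈ T, transHom R v = const W k * mulHom W n f' := by
    refine exists_const_mul_of_divOf_eq (Finset.prod_ne_zero_iff.mpr fun R _ => htr R)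
      ((_root_.map_ne_zero _).mpr hf') ?_
    ext X
    rw [divOf_apply, divOf_apply, ord_prod (fun R _ => htr R), ord_mulHom hn, ← divOf_apply f', hd']
    simp only [ord_transHom, ← divOf_apply v, hdv, Finsupp.sub_apply, Finsupp.smul_apply,
      smul_eq_mul, Finset.sum_sub_distrib, ← Finset.mul_sum, sum_pt_apply_add hT, nsmul_add, hQ₀,
      hS₀, hQ, add_zero]
    ring
  have hvval : ∀ X, n • X ≠ Q + S → n • X ≠ S →
      ∏ R ∈ T, unitVal v (X + R) = k' * unitVal f' (n • X) := by
    intro X h1 h2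
    have e1 : HasValueAt (∏ R ∈ T, transHom R v) X (∏ R ∈ T, unitVal v (X + R)) := by
      refine HasValueAt.prod fun R hR => ?_
      have hR' : n • (X + R) = n • X := by rw [nsmul_add, (hT R).mp hR, add_zero]
      rw [hasValueAt_map_iff, pull_transHom]
      exact hasValueAt_unitVal hv (hordv _ (by rwa [hR']) (by rwa [hR']))
    have e2 : HasValueAt (const W k' * mulHom W n f') X (k' * unitVal f' (n • X)) := by
      refine (HasValueAt.const X k').mul ?_
      rw [hasValueAt_map_iff, pull_mulHom]
      exact hasValueAt_unitVal hf' (hordf' _ h1 h2)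
    rw [hvf] at e1
    exact e1.unique e2
  have h4 := hvval P₀ (by rw [hP₀]; exact hQSP.symm) (by rw [hP₀]; exact hSP.symm)
  have h5 := hvval 0 (by rw [nsmul_zero]; exact hQS0.symm) (by rw [nsmul_zero]; exact hS0.symm)
  rw [hP₀] at h4
  simp only [nsmul_zero, zero_add] at h5
  -- Reciprocity now says (g(Q₀+S₀)/g(S₀))ⁿ / c = f'(P)/f'(O), and the n-th power is f(Q+S)/f(S).
  rw [hdv, hdg, pairing_sum] at hrec
  simp only [pairing_sub, pairing_zsmul, pairing_pt, Finset.prod_div_distrib, h4, h5, h3,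
    zpow_natCast] at hrec
  rw [pairing_sub, pairing_pt, pairing_pt, pairing_sub, pairing_pt, pairing_pt, h1, h2]
  have e1 := unitVal_ne_zero g S₀
  have e2 := unitVal_ne_zero g (Q₀ + S₀)
  have e3 := unitVal_ne_zero f' 0
  rw [mul_div_mul_left _ _ hk', mul_div_assoc, div_self e1, mul_one, div_eq_iff hc] at hrec
  rw [mul_div_mul_left _ _ hk, ← div_pow, hrec, mul_comm]

end Torsion

end WeilPairing

namespace WeilPairing

variable {F : Type*} [Field F] {W : Affine F}

/-! ### Independence of the divisors, the alternating property and the sign. -/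

section Comparison

variable [DecidableEq F] [W.IsElliptic] [IsAlgClosed F] {n : ℕ} {P Q : W.Point}

lemma linEquiv_iff {D D' : Divisor W} :
    LinEquiv D D' ↔ deg D = deg D' ∧ pointSum D = pointSum D' := by
  rw [← sub_eq_zero (a := deg D), ← sub_eq_zero (a := pointSum D), ← map_sub, ← map_sub]
  constructor
  · rintro ⟨h, hh⟩
    obtain ⟨-, hd⟩ := hasDivisor_iff.mp hh
    rw [← hd]
    exact ⟨deg_divOf h, pointSum_divOf h⟩
  · rintro ⟨h1, h2⟩
    obtain ⟨h, hh, hd⟩ := exists_divOf_eq h1 h2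
    exact ⟨h, hasDivisor_iff.mpr ⟨hh, hd⟩⟩

omit [DecidableEq F] in
lemma ord_eq_zero_of_divOf_eq {f : W.FunctionField} {D : Divisor W} (hd : divOf f = (n : ℤ) • D)
    {X : W.Point} (hX : D X = 0) : ord X f = 0 := by
  rw [← divOf_apply, hd, Finsupp.smul_apply, hX, smul_zero]

/-- The pairing of the third definition only depends on the class of the second divisor. -/
lemma pairing_mul_pairing_comm {D D₁ D₂ : Divisor W} {f f₁ f₂ : W.FunctionField}
    (hdeg : deg D = 0) (hdeg' : deg D₁ = deg D₂) (hsum : pointSum D₁ = pointSum D₂)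
    (h₁ : ∀ X, D X = 0 ∨ D₁ X = 0) (h₂ : ∀ X, D X = 0 ∨ D₂ X = 0) (hf : f ≠ 0) (hf₁ : f₁ ≠ 0)
    (hf₂ : f₂ ≠ 0) (hd : divOf f = (n : ℤ) • D) (hd₁ : divOf f₁ = (n : ℤ) • D₁)
    (hd₂ : divOf f₂ = (n : ℤ) • D₂) :
    pairing f D₂ * pairing f₁ D = pairing f D₁ * pairing f₂ D := by
  -- As D₂ - D₁ = div h, f₂ is a constant times f₁hⁿ. The constant drops out because deg D = 0, and
  -- h(D)ⁿ = h(div f) = f(div h) = f(D₂)/f(D₁) by reciprocity.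
  obtain ⟨h, hh, hdh⟩ := exists_divOf_eq (D := D₂ - D₁) (by rw [map_sub, hdeg', sub_self])
    (by rw [map_sub, hsum, sub_self])
  have hhn := pow_ne_zero n hh
  obtain ⟨k, hk, rfl⟩ := exists_const_mul_of_divOf_eq hf₂ (mul_ne_zero hf₁ hhn) (by
    rw [divOf_mul hf₁ hhn, divOf_pow, hd₁, hdh, hd₂, natCast_zsmul, natCast_zsmul, ← nsmul_add,
      add_sub_cancel])
  have hk' := (_root_.map_ne_zero (const W)).mpr hk
  have hordh : ∀ X, D X ≠ 0 → ord X h = 0 := fun X hX => by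
    rw [← divOf_apply, hdh, Finsupp.sub_apply, (h₁ X).resolve_left hX, (h₂ X).resolve_left hX,
      sub_zero]
  have hord₁ : ∀ X, D X ≠ 0 → ord X f₁ = 0 := fun X hX =>
    ord_eq_zero_of_divOf_eq hd₁ ((h₁ X).resolve_left hX)
  have e1 : pairing h D ^ n = pairing f D₂ / pairing f D₁ := by
    rw [← pairing_nsmul, ← natCast_zsmul, ← hd, ← pairing_sub, ← hdh]
    refine pairing_divOf_comm hh hf fun X => ?_
    by_cases hX : D X = 0
    · exact .inr (ord_eq_zero_of_divOf_eq hd hX)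
    · exact .inl (hordh X hX)
  rw [pairing_mul hk' (mul_ne_zero hf₁ hhn) (fun _ _ _ => ord_const ..) (fun X _ hX => by
      rw [ord_mul hf₁ hhn, ord_pow, hordh X hX, hord₁ X hX, mul_zero, add_zero]),
    pairing_mul hf₁ hhn (fun X _ hX => hord₁ X hX) (fun X _ hX => by
      rw [ord_pow, hordh X hX, mul_zero]),
    pairing_pow hh (fun X _ hX => hordh X hX), pairing_const hk, hdeg, zpow_zero, one_mul, e1]
  have := pairing_ne_zero f D₁
  field_simp

omit [W.IsElliptic] in
lemma exists_generic_point [W.IsElliptic] (Q : W.Point) {Z : Set W.Point} (hZ : Z.Finite) :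
    ∃ S, S ∉ Z ∧ Q + S ∉ Z := by
  have h1 : ∀ᶠ S in Filter.cofinite, S ∉ Z := hZ.compl_mem_cofinite
  exact (h1.and (((add_right_injective Q).tendsto_cofinite).eventually h1)).exists

lemma exists_divOf_eq_nsmul {D : Divisor W} (hdeg : deg D = 0) (hsum : n • pointSum D = 0) :
    ∃ f : W.FunctionField, f ≠ 0 ∧ divOf f = (n : ℤ) • D :=
  exists_divOf_eq (by rw [map_zsmul, hdeg, smul_zero]) (by rw [map_zsmul, natCast_zsmul, hsum])

variable [NeZero n]

/-- The first and the third definition agree. -/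
lemma pairing_eq_mul_pairing_of_disjoint (hn : (n : F) ≠ 0) {c : F} (hc : c ≠ 0)
    (hP : n • P = 0) (hQ : n • Q = 0) (h : ∀ g, IsRootFun n P g → transHom Q g = const W c * g)
    {D D' : Divisor W} {f f' : W.FunctionField} (hdeg : deg D = 0) (hsum : pointSum D = P)
    (hdeg' : deg D' = 0) (hsum' : pointSum D' = Q) (hDD' : ∀ X, D X = 0 ∨ D' X = 0)
    (hf : f ≠ 0) (hf' : f' ≠ 0) (hd : divOf f = (n : ℤ) • D) (hd' : divOf f' = (n : ℤ) • D') :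
    pairing f D' = c * pairing f' D := by
  -- For generic S the divisor [Q+S] - [S] is disjoint both from [P] - [O] and from D. The special
  -- case is transported in two moves, from [P] - [O] to D and then from [Q+S] - [S] to D'.
  obtain ⟨S, hS, hQS⟩ := exists_generic_point Q
    ((D.hasFiniteSupport.union (Set.toFinite {0, P})))
  simp only [Set.mem_union, Set.mem_insert_iff, Set.mem_singleton_iff, Function.mem_support,
    not_or, not_not] at hS hQS
  obtain ⟨f₀, hf₀, hd₀⟩ := exists_divOf_eq_nsmul (n := n) (D := pt P - pt 0) (by simp)
    (by simpa using hP)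
  obtain ⟨f₁, hf₁, hd₁⟩ := exists_divOf_eq_nsmul (n := n) (D := pt (Q + S) - pt S) (by simp)
    (by simpa using hQ)
  have e0 := pairing_eq_mul_pairing hn hc hP hS.2.1 hS.2.2 hQS.2.1 hQS.2.2 hQ h hf₀ hd₀ hf₁ hd₁
  have hE : ∀ X, (pt (Q + S) - pt S : Divisor W) X = 0 ∨ D X = 0 := fun X => by
    by_cases h1 : Q + S = X
    · exact .inr (h1 ▸ hQS.1)
    by_cases h2 : S = X
    · exact .inr (h2 ▸ hS.1)
    · exact .inl (sub_apply_eq_zero h1 h2)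
  have hE' : ∀ X, (pt (Q + S) - pt S : Divisor W) X = 0 ∨ (pt P - pt 0 : Divisor W) X = 0 :=
    fun X => by
    by_cases h1 : Q + S = X
    · exact .inr (h1 ▸ sub_apply_eq_zero (Ne.symm hQS.2.2) (Ne.symm hQS.2.1))
    by_cases h2 : S = X
    · exact .inr (h2 ▸ sub_apply_eq_zero (Ne.symm hS.2.2) (Ne.symm hS.2.1))
    · exact .inl (sub_apply_eq_zero h1 h2)
  have e1 := pairing_mul_pairing_comm (by simp) (by rw [hdeg]; simp) (by rw [hsum]; simp) hE' hE
    hf₁ hf₀ hf hd₁ hd₀ hd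
  have e2 := pairing_mul_pairing_comm hdeg (by rw [hdeg']; simp) (by rw [hsum']; simp)
    (fun X => (hE X).symm) hDD' hf hf₁ hf' hd hd₁ hd'
  have n1 := pairing_ne_zero f₁ (pt P - pt 0)
  have n2 := pairing_ne_zero f₁ D
  have e3 : pairing f (pt (Q + S) - pt S) = c * pairing f₁ D := by
    refine mul_left_cancel₀ n1 ?_
    rw [← e1, e0]
    ring
  rw [e3] at e2
  refine mul_right_cancel₀ n2 ?_
  rw [e2]
  ring

/-- The Weil pairing is alternating, in terms of the first definition. -/
lemma transHom_eq_self_of_isRootFun (hP : n • P = 0) {g : W.FunctionField}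
    (hg : IsRootFun n P g) : transHom P g = g := by
  obtain ⟨P₀, hP₀⟩ := exists_nsmul_eq n P
  have h0 : ∀ R, transHom R g ≠ 0 := fun R => (_root_.map_ne_zero _).mpr hg.1
  -- Translation by iP₀ replaces nX by nX + iP, so the orders of successive factors telescope around
  -- the cycle generated by P.
  have hord : ∀ X, ord X (∏ i ∈ Finset.range n, transHom (i • P₀) g) = 0 := by
    intro X
    rw [ord_prod fun i _ => h0 _]
    have key : ∀ i : ℕ, ord X (transHom (i • P₀) g) =
        pt 0 (n • X + i • P - P) - pt 0 (n • X + (i + 1) • P - P) := by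
      intro i
      have e : n • (X + i • P₀) = n • X + i • P := by
        rw [nsmul_add, ← mul_nsmul, mul_nsmul', hP₀]
      have e' : n • X + (i + 1) • P - P = n • X + i • P := by
        rw [succ_nsmul, ← add_assoc, add_sub_cancel_right]
      rw [ord_transHom, hg.2, e, e', Finsupp.sub_apply]
      congr 1
      rw [pt_apply, pt_apply]
      exact if_congr ⟨fun h => by rw [← h, sub_self], fun h => (sub_eq_zero.mp h.symm).symm⟩ rfl rfl
    rw [Finset.sum_congr rfl fun i _ => key i, Finset.sum_range_sub', hP]
    simp
  obtain ⟨c, hc⟩ := exists_eq_const (f := ∏ i ∈ Finset.range n, transHom (i • P₀) g)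
    fun X => (hord X).ge
  have h1 := congrArg (transHom P₀) hc
  rw [map_const, ← hc, map_prod] at h1
  have h2 : ∀ i : ℕ, transHom P₀ (transHom (i • P₀) g) = transHom ((i + 1) • P₀) g := fun i => by
    rw [← AlgHom.comp_apply, transHom_comp, succ_nsmul']
  -- The product is constant, hence invariant under translation by P₀. This translation shifts the
  -- factors by one, so the factor leaving at one end, g, equals the factor entering at the other, g
  -- ∘ τ_P.
  have h3 := Finset.prod_range_succ' (fun i => transHom (i • P₀) g) n
  rw [Finset.prod_range_succ, hP₀, zero_nsmul, transHom_zero, AlgHom.id_apply,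
    ← Finset.prod_congr rfl fun i _ => h2 i, h1] at h3
  exact mul_left_cancel₀ (Finset.prod_ne_zero_iff.mpr fun i _ => h0 _) h3

/-- The formula of the second definition, for functions that need not be monic. -/
lemma unitVal_eq_mul_unitVal (hn : (n : F) ≠ 0) {c : F} (hc : c ≠ 0) (hP : n • P = 0)
    (hQ : n • Q = 0) (h : ∀ g, IsRootFun n P g → transHom Q g = const W c * g)
    (hP0 : P ≠ 0) (hQ0 : Q ≠ 0) (hPQ : P ≠ Q) {f f' : W.FunctionField} (hf : f ≠ 0) (hf' : f' ≠ 0)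
    (hd : divOf f = (n : ℤ) • (pt P - pt 0)) (hd' : divOf f' = (n : ℤ) • (pt Q - pt 0)) :
    (-1) ^ n * (unitVal f Q / unitVal f 0) = c * (unitVal f' P / unitVal f' 0) := by
  obtain ⟨S, hS, hQS⟩ := exists_generic_point Q (Set.toFinite {0, P})
  simp only [Set.mem_insert_iff, Set.mem_singleton_iff, not_or] at hS hQS
  -- Multiplying f' by vⁿ moves its divisor from n([Q] - [O]) to n([Q+S] - [S]), where the special
  -- case applies.
  obtain ⟨v, hv, hdv⟩ := exists_divOf_eq (D := pt (Q + S) - pt S - (pt Q - pt 0)) (by simp) (by simp)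
  have hvn := pow_ne_zero n hv
  have e0 := pairing_eq_mul_pairing hn hc hP hS.1 hS.2 hQS.1 hQS.2 hQ h hf hd
    (mul_ne_zero hf' hvn) (by
      rw [divOf_mul hf' hvn, hd', divOf_pow, hdv, natCast_zsmul, natCast_zsmul, ← nsmul_add,
        add_sub_cancel])
  have hord : ∀ X ≠ 0, (pt P - pt 0 : Divisor W) X ≠ 0 → X = P := by
    intro X h0 hX
    by_contra hXP
    exact hX (sub_apply_eq_zero (Ne.symm hXP) (Ne.symm h0))
  have hordv : ord P v = 0 := by
    rw [← divOf_apply, hdv, Finsupp.sub_apply, sub_apply_eq_zero hQS.2 hS.2,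
      sub_apply_eq_zero hPQ.symm hP0.symm, sub_zero]
  have hordf' : ord P f' = 0 := ord_eq_zero_of_divOf_eq hd' (sub_apply_eq_zero hPQ.symm hP0.symm)
  -- f and v meet only at O, with orders -n and 1. The tame symbol there is the sign (-1)ⁿ of the
  -- second definition.
  have hrec := reciprocal hf hv fun X h0 => by
    by_cases hX : X = P
    · exact .inr (hX ▸ hordv)
    · exact .inl (ord_eq_zero_of_divOf_eq hd (sub_apply_eq_zero (Ne.symm hX) (Ne.symm h0)))
  have hf0 : ord 0 f = -n := by
    rw [← divOf_apply, hd, Finsupp.smul_apply, Finsupp.sub_apply, pt_apply_of_ne hP0, pt_apply,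
      if_pos rfl]
    simp
  have hv0 : ord 0 v = 1 := by
    rw [← divOf_apply, hdv, Finsupp.sub_apply, sub_apply_eq_zero hQS.1 hS.1, Finsupp.sub_apply,
      pt_apply_of_ne hQ0, pt_apply, if_pos rfl]
    simp
  rw [Reciprocal, hf0, hv0, mul_one, zpow_neg, zpow_natCast, hdv, hd, pairing_sub, e0,
    natCast_zsmul, pairing_nsmul, pairing_mul hf' hvn (fun X h0 hX => hord X h0 hX ▸ hordf')
      (fun X h0 hX => by rw [hord X h0 hX, ord_pow, hordv, mul_zero]),
    pairing_pow hv (fun X h0 hX => hord X h0 hX ▸ hordv), ← inv_pow, inv_neg, inv_one] at hrec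
  have n1 := pow_ne_zero n (pairing_ne_zero v (pt P - pt 0))
  have n2 := pairing_ne_zero f (pt Q - pt 0)
  rw [div_eq_iff n2] at hrec
  rw [← pairing_pt, ← pairing_pt, ← pairing_sub, ← pairing_pt, ← pairing_pt, ← pairing_sub]
  refine mul_right_cancel₀ n1 ?_
  linear_combination -hrec

end Comparison

/-! ### Verification of the three definitions. -/

section Definitions

variable [DecidableEq F] [W.IsElliptic] [IsAlgClosed F] {n : ℕ} {P Q : W.Point}

omit [DecidableEq F] in
lemma isMillerFun_iff {f : W.FunctionField} :
    IsMillerFun n P f ↔ f ≠ 0 ∧ divOf f = (n : ℤ) • (pt P - pt 0) := by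
  rw [IsMillerFun, ← smul_sub, hasDivisor_iff]

lemma exists_isF {D : Divisor W} (hdeg : deg D = 0) (hsum : n • pointSum D = 0) :
    ∃ f, IsF n D f := by
  obtain ⟨f, hf, hd⟩ := exists_divOf_eq_nsmul hdeg hsum
  obtain ⟨c, g, hc, hg, rfl⟩ := exists_eq_const_mul_isMonic hf
  refine ⟨g, hasDivisor_iff.mpr ⟨hg.ne_zero, ?_⟩, hg⟩
  rw [← hd, divOf_mul ((_root_.map_ne_zero _).mpr hc) hg.ne_zero, divOf_const, zero_add]

lemma exists_isMillerFun (hP : n • P = 0) : ∃ f, IsMillerFun n P f ∧ IsMonic f := by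
  obtain ⟨f, hf⟩ := exists_isF (n := n) (D := pt P - pt 0) (by simp) (by simpa using hP)
  exact ⟨f, by rw [IsMillerFun, ← smul_sub]; exact hf.1, hf.2⟩

variable [NeZero n]

lemma firstDefinition_of_transHom_eq (hn : (n : F) ≠ 0) {c : F} (hP : n • P = 0)
    (h : ∀ g, IsRootFun n P g → transHom Q g = const W c * g) : FirstDefinition n P Q c := by
  refine ⟨exists_isG hn hP, fun g hg => ⟨transHom Q g, isTranslate_transHom Q g, ?_⟩⟩
  rw [h g hg.isRootFun, mul_div_cancel_right₀ _ hg.isRootFun.1]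

lemma secondDefinition_of_transHom_eq (hn : (n : F) ≠ 0) {c : F} (hc : c ≠ 0) (hP : n • P = 0)
    (hQ : n • Q = 0) (h : ∀ g, IsRootFun n P g → transHom Q g = const W c * g) :
    SecondDefinition n P Q c := by
  refine ⟨fun hdeg => ?_, fun hP0 hQ0 hPQ => ⟨exists_isMillerFun hP, exists_isMillerFun hQ,
    fun fP fQ hfP hfQ => ?_⟩⟩
  · obtain ⟨g, hg⟩ := exists_isG hn hP
    have hg' := hg.isRootFun
    have key : transHom Q g = g := by
      -- For P = O the function g has trivial divisor and is constant; for Q = O the translation is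
      -- the identity; P = Q is the alternating property.
      rcases hdeg with rfl | rfl | rfl
      · obtain ⟨k, rfl⟩ := exists_eq_const (f := g) fun X => by rw [hg'.2, sub_self]; rfl
        exact map_const _ k
      · rw [transHom_zero, AlgHom.id_apply]
      · exact transHom_eq_self_of_isRootFun hP hg'
    have h1 := h g hg'
    rw [key] at h1
    have h2 : const W c = 1 := (mul_eq_right₀ hg'.1).mp h1.symm
    exact const_injective (h2.trans (map_one _).symm)
  · obtain ⟨hf, hd⟩ := isMillerFun_iff.mp hfP
    obtain ⟨hf', hd'⟩ := isMillerFun_iff.mp hfQ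
    have hordP : ord Q fP = 0 := ord_eq_zero_of_divOf_eq hd (sub_apply_eq_zero hPQ hQ0.symm)
    have hordQ : ord P fQ = 0 :=
      ord_eq_zero_of_divOf_eq hd' (sub_apply_eq_zero hPQ.symm hP0.symm)
    have hord0 : ord 0 (fQ / fP) = 0 := by
      rw [ord_div hf' hf, ← divOf_apply, ← divOf_apply, hd, hd', Finsupp.smul_apply,
        Finsupp.smul_apply, Finsupp.sub_apply, Finsupp.sub_apply, pt_apply_of_ne hP0,
        pt_apply_of_ne hQ0, sub_self]
    have hval : value (fQ / fP) 0 = unitVal fQ 0 / unitVal fP 0 := by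
      have := ((hasLeadingCoeff_unitVal hf').mul (hasLeadingCoeff_unitVal hf).inv)
      rw [← div_eq_mul_inv, ← div_eq_mul_inv] at this
      exact value_eq (this.hasValueAt_of_ord hord0)
    have key := unitVal_eq_mul_unitVal hn hc hP hQ h hP0 hQ0 hPQ hf hf' hd hd'
    have n1 := unitVal_ne_zero fP 0
    have n2 := unitVal_ne_zero fQ 0
    have n3 := unitVal_ne_zero fQ P
    have hmain : (-1) ^ n * (value fP Q / value fQ P) * value (fQ / fP) 0 = c := by
      rw [hval, ← unitVal_eq_value hf hordP, ← unitVal_eq_value hf' hordQ]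
      field_simp at key ⊢
      linear_combination key
    refine ⟨⟨isRegularAt_iff.mpr hordP.ge, isRegularAt_iff.mpr hordQ.ge,
      isRegularAt_iff.mpr hord0.ge⟩, hmain, fun hm hm' => ?_⟩
    rwa [hval, hm.unitVal_eq, hm'.unitVal_eq, div_one, mul_one] at hmain

lemma thirdDefinition_of_transHom_eq (hn : (n : F) ≠ 0) {c : F} (hc : c ≠ 0) (hP : n • P = 0)
    (hQ : n • Q = 0) (h : ∀ g, IsRootFun n P g → transHom Q g = const W c * g) :
    ThirdDefinition n P Q c := by
  constructor
  · obtain ⟨S, hS, hQS⟩ := exists_generic_point Q (Set.toFinite {0, P})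
    simp only [Set.mem_insert_iff, Set.mem_singleton_iff, not_or] at hS hQS
    refine ⟨pt P - pt 0, pt (Q + S) - pt S, linEquiv_iff.mpr ⟨rfl, rfl⟩,
      linEquiv_iff.mpr (by simp), ?_⟩
    rw [Finset.disjoint_left]
    intro X hX hX'
    rw [Finsupp.mem_support_iff] at hX hX'
    refine hX (sub_apply_eq_zero ?_ ?_) <;> rintro rfl <;> refine hX' (sub_apply_eq_zero ?_ ?_)
    · exact hQS.2
    · exact hS.2
    · exact hQS.1
    · exact hS.1
  · rintro DP DQ ⟨hDP, hDQ, hdisj⟩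
    obtain ⟨hdegP, hsumP⟩ := linEquiv_iff.mp hDP
    obtain ⟨hdegQ, hsumQ⟩ := linEquiv_iff.mp hDQ
    simp only [map_sub, deg_pt, pointSum_pt, sub_self, sub_zero] at hdegP hsumP hdegQ hsumQ
    refine ⟨exists_isF hdegP (by rw [hsumP, hP]), exists_isF hdegQ (by rw [hsumQ, hQ]),
      fun fP fQ hfP hfQ => ?_⟩
    obtain ⟨hf, hd⟩ := hasDivisor_iff.mp hfP.1
    obtain ⟨hf', hd'⟩ := hasDivisor_iff.mp hfQ.1
    have hDD : ∀ X, DP X = 0 ∨ DQ X = 0 := fun X => by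
      by_contra! hX
      exact Finset.disjoint_left.mp hdisj (Finsupp.mem_support_iff.mpr hX.1)
        (Finsupp.mem_support_iff.mpr hX.2)
    have hordP : ∀ X, DQ X ≠ 0 → ord X fP = 0 := fun X hX =>
      ord_eq_zero_of_divOf_eq hd ((hDD X).resolve_right hX)
    have hordQ : ∀ X, DP X ≠ 0 → ord X fQ = 0 := fun X hX =>
      ord_eq_zero_of_divOf_eq hd' ((hDD X).resolve_left hX)
    refine ⟨fun X hX => isRegularAt_iff.mpr (hordP X (Finsupp.mem_support_iff.mp hX)).ge,
      fun X hX => isRegularAt_iff.mpr (hordQ X (Finsupp.mem_support_iff.mp hX)).ge, ?_⟩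
    rw [← pairing_eq_valueDiv hf hordP, ← pairing_eq_valueDiv hf' hordQ,
      pairing_eq_mul_pairing_of_disjoint hn hc hP hQ h hdegP hsumP hdegQ hsumQ hDD hf hf' hd hd',
      mul_div_cancel_right₀ _ (pairing_ne_zero _ _)]

end Definitions

end WeilPairing

/-- For an elliptic curve over an algebraically closed field, `n` prime to the characteristic and
`n`-torsion points `P`, `Q`, the three definitions of the Weil pairing of `P` and `Q` are
independent of all choices and give the same non-zero value. -/
theorem mainTheorem2 {F : Type*} [Field F] [IsAlgClosed F] [DecidableEq F]
    (W : WeierstrassCurve.Affine F) [W.IsElliptic] (n : ℕ) (hn : (n : F) ≠ 0)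
    (P Q : W.Point) (hP : n • P = 0) (hQ : n • Q = 0) :
    ∃ c : F, c ≠ 0 ∧
      WeilPairing.FirstDefinition n P Q c ∧
      WeilPairing.SecondDefinition n P Q c ∧
      WeilPairing.ThirdDefinition n P Q c := by
  have : NeZero n := ⟨by rintro rfl; simp at hn⟩
  obtain ⟨c, hc, h⟩ := WeilPairing.exists_transHom_eq hn hP hQ
  exact ⟨c, hc, WeilPairing.firstDefinition_of_transHom_eq hn hP h,
    WeilPairing.secondDefinition_of_transHom_eq hn hc hP hQ h,
    WeilPairing.thirdDefinition_of_transHom_eq hn hc hP hQ h⟩
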